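/- For $n\ge 1$ let $a_n$ be the number of pairs of integers $(a,c)$ (of any sign) with $a^2+c^4=n$. For real $x$ and integers $d\ge 1$ put $$A(x)=\sum_{1\le n\le x}a_n,\qquad A_d(x)=\sum_{\substack{1\le n\le x\\ d\mid n}}a_n .$$ Let $\chi_4$ be the nontrivial Dirichlet character modulo $4$, and for a prime $p$ let $\rho(p)$ be the number of solutions $\alpha \pmod p$ of $\alpha^2+1\equiv 0\pmod p$. Let $g$ be the multiplicative function on cubefree integers given, for primes $p$, by $$g(p)=\frac1p\Big(1+\chi_4(p)\Big(1-\frac1p\Big)\Big),\qquad g(p^2)=\frac1{p^2}\Big(1+\rho(p)\Big(1-\frac1p\Big)\Big)\quad(p\neq 2),\qquad g(4)=\frac14,$$ and put $r_d(t)=A_d(t)-g(d)A(t)$. (i) For every $\varepsilon>0$ there is a constant $C=C(\varepsilon)>0$, depending only on $\varepsilon$, such that for all real $x\ge1$, $D\ge1$ and $t\le x$, $$\sum_{\substack{d\le D\\ d\text{ cubefree}}}|r_d(t)|\le C\,D^{1/4}x^{9/16+\varepsilon}.$$ (ii) Consequently the sequence $(a_n)$ has level of distribution $x^{3/4-\varepsilon}$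 for every $\varepsilon>0$: for every $\varepsilon>0$ and $B>0$ there is $x_0=x_0(\varepsilon,B)$ such that for all $x\ge x_0$ and all $t\le x$, $$\sum_{\substack{d\le x^{3/4-\varepsilon}(\log x)^{B}\\ d\text{ cubefree}}}|r_d(t)|\le A(x)(\log x)^{-B}.$$ -/

import Mathlib

namespace QuarticSieve

/-- The number of pairs of integers `(a, c)`, of any sign, with `a ^ 2 + c ^ 4 = n`. -/
noncomputable def repCount (n : ℕ) : ℕ :=
  Set.ncard {v : ℤ × ℤ | v.1 ^ 2 + v.2 ^ 4 = (n : ℤ)}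

/-- `A(x)`: the sum of `a_n` over `0 < n ≤ x`. -/
noncomputable def total (x : ℝ) : ℝ :=
  ∑ n ∈ Finset.Icc 1 ⌊x⌋₊, (repCount n : ℝ)

/-- `A_d(x)`: the sum of `a_n` over `0 < n ≤ x` with `n ≡ 0 (mod d)`. -/
noncomputable def totalDvd (d : ℕ) (x : ℝ) : ℝ :=
  ∑ n ∈ Finset.Icc 1 ⌊x⌋₊ with d ∣ n, (repCount n : ℝ)

/-- `ρ(d)`: the number of solutions `α (mod d)` of `α ^ 2 + 1 ≡ 0 (mod d)`. -/
noncomputable def rho (d : ℕ) : ℕ :=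
  Nat.card {α : ZMod d // α ^ 2 + 1 = 0}

/-- The value `g(p ^ k)` for a prime `p`. Only `k ≤ 2` occurs for cubefree arguments of `g`;
for `k ≥ 3` the value is an unused default. -/
noncomputable def densityPrimePow (p k : ℕ) : ℝ :=
  if k = 0 then 1
  else if k = 1 then (1 + (ZMod.χ₄ (p : ZMod 4) : ℝ) * (1 - 1 / (p : ℝ))) / (p : ℝ)
  else if k = 2 then
    if p = 2 then 1 / 4 else (1 + (rho p : ℝ) * (1 - 1 / (p : ℝ))) / (p : ℝ) ^ 2
  else 0

/-- The multiplicative function `g`, as the product of `g(p ^ k)` over the exact prime powers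
`p ^ k` dividing `d`. -/
noncomputable def density (d : ℕ) : ℝ :=
  d.factorization.prod densityPrimePow

/-- The sieve remainder `r_d(t) = A_d(t) - g(d) A(t)`. -/
noncomputable def remainder (d : ℕ) (t : ℝ) : ℝ :=
  totalDvd d t - density d * total t

/-- `d` is not divisible by the cube of a prime. -/
def Cubefree (d : ℕ) : Prop :=
  ∀ p : ℕ, p.Prime → ¬ p ^ 3 ∣ d

open Classical in
/-- The sum of `|r_d(t)|` over cubefree `1 ≤ d ≤ D`. -/
noncomputable def remainderSum (D t : ℝ) : ℝ :=
  ∑ d ∈ Finset.Icc 1 ⌊D⌋₊ with Cubefree d, |remainder d t|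

end QuarticSieve

namespace QuarticSieve

/-! If `c` is invertible modulo `q`, then `q ∣ a² + c⁴` means `a ≡ ν c²` modulo `q` for one root `ν`
of `ν² + 1`. For cubefree `d` the primes dividing both `d` and `c` need only a small correction at
each `p` and `p²`. So divisibility by `d` is a short signed combination of conditions `k ∣ c`, `u ∣
a`, `a ≡ ν c² (mod q)` (`hasExpansion`), and the same weights reproduce `g(d)` exactly. Over a fixed
`c = k j` the admissible `a` lie in one class of a symmetric interval. Their number is a length
minus two sawtooth values, at `W / (u q) ± κ j² ν / q` with `κ = k² / u` and `W = √(N - c⁴)`. Up to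
`O(√N / (u q))` for each root, the lengths add up to `1 / (k u q)` times their sum for `d = 1`. The
main terms therefore cancel against `g(d) A(t)`, and no asymptotic formula for `A` is needed.

What remains is to bound the sawtooth sums on average over `q ~ Q` and `ν`. The points `(ν + i) / q`
lie in the `SL₂(ℤ)`-orbit of `i` (`exists_matrix_of_dvd_sq_add_one`), so by discreteness an interval
of length `1 / Q` contains boundedly many fractions `ν / q` (`card_near_le`). For general fractions
with such denominators the scale would be `1 / Q²`. Hence the large sieve holds with `Q + L` in
place of `Q² + L` (`large_sieve`). It is applied to the frequencies `h κ j²`, whose multiplicity is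
at most a divisor function.

The phase `W / (u q)` varies with `q`. The moduli are cut into `K` short intervals and `q` is frozen
at the left endpoint. Since the sawtooth jumps only downwards, its means over short intervals to the
right and to the left bound it from below and from above (`le_saw_sub`, `saw_sub_le`). With `N =
x¹⁶`, `D = y⁴` and `k = u = 1`, this costs `K y² x⁶` for the large sieve and `x¹² / K` for the
smoothing, up to divisor factors. The choice `K ≈ x³ / y` makes both equal to `y x⁹ = D^{1/4}
N^{9/16}` (`dispersion_bound`). It requires `D ≤ N^{3/4}`, and for larger `D` the trivial bound
suffices (`remainderSum_le_trivial`). Part (ii) follows from `A(x) ≥ x^{3/4} / 4` and a comparison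
of exponents. -/

/-! ### Spacing of the roots of `ν ^ 2 + 1` -/

/-- A root `ν` of `ν ^ 2 + 1` modulo `d` comes from a matrix of determinant one that maps `i` to
`(ν + i) / d`. -/
theorem exists_matrix_of_dvd_sq_add_one (n : ℕ) : ∀ d ν : ℤ, 0 < d → d ≤ n → d ∣ ν ^ 2 + 1 →
    ∃ A B C E : ℤ, A * E - B * C = 1 ∧ C ^ 2 + E ^ 2 = d ∧ A * C + B * E = ν := by
  induction n with
  | zero => intro d ν h0 h1; exact absurd h1 (by push_cast; omega)
  | succ n ih =>
    intro d ν hd hdn hdvd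
    rcases eq_or_lt_of_le (show 1 ≤ d from hd) with h1 | h1
    · exact ⟨1, ν, 0, 1, by ring, by rw [← h1]; ring, by ring⟩
    -- Here `k` is the integer nearest to `ν / d`, so `|μ| ≤ d / 2`. Then `μ ^ 2 + 1 = d * e` with
    -- `e < d` because `d ≥ 2`, and the descent continues with `e`.
    · set k := (2 * ν + d) / (2 * d) with hk
      set μ := ν - k * d with hμ
      have e1 := Int.emod_add_mul_ediv (2 * ν + d) (2 * d)
      have e2 := Int.emod_nonneg (2 * ν + d) (show (2 * d) ≠ 0 by omega)
      have e3 := Int.emod_lt_of_pos (2 * ν + d) (show 0 < 2 * d by omega)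
      rw [← hk] at e1
      have hμ1 : 2 * μ ≤ d := by rw [hμ]; linarith
      have hμ2 : -d ≤ 2 * μ := by rw [hμ]; linarith
      have hμd : d ∣ μ ^ 2 + 1 := by
        have : μ ^ 2 + 1 = (ν ^ 2 + 1) + d * (-2 * ν * k + k ^ 2 * d) := by rw [hμ]; ring
        rw [this]; exact dvd_add hdvd (dvd_mul_right _ _)
      obtain ⟨e, he⟩ := hμd
      have he0 : 0 < e := by
        by_contra h
        push Not at h
        nlinarith [sq_nonneg μ]
      have hed : e < d := by
        by_contra h
        push Not at h
        nlinarith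
      -- The residue is `-μ` because `-1 / ((μ + i) / d) = (-μ + i) / e`.
      obtain ⟨A, B, C, E, h1, h2, h3⟩ := ih e (-μ) he0 (by push_cast at hdn; omega)
        ⟨d, by linarith [neg_sq μ]⟩
      -- the inversion `z ↦ -1 / z` followed by a translation
      have hsq : A ^ 2 + B ^ 2 = d := by
        have h4 : e * (A ^ 2 + B ^ 2) = e * d := by
          have : (C ^ 2 + E ^ 2) * (A ^ 2 + B ^ 2) = (A * C + B * E) ^ 2 + (A * E - B * C) ^ 2 := by
            ring
          rw [h1, h2, h3] at this
          rw [this]; linarith [neg_sq μ]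
        exact mul_left_cancel₀ he0.ne' h4
      refine ⟨-C + k * A, -E + k * B, A, B, by linarith, hsq, ?_⟩
      have : μ = -(A * C + B * E) := by rw [h3]; ring
      have h5 : ν = μ + k * d := by rw [hμ]; ring
      rw [h5, this, ← hsq]; ring

/-- The roots of `ν ^ 2 + 1` modulo `q`, for `Q ≤ q < 2 * Q`, give fractions `ν / q` of which a
bounded number lie within `1 / Q` of a given one. -/
theorem card_near_le (Q : ℕ) (hQ : 0 < Q) (q₁ ν₁ : ℤ) (hq₁ : (Q : ℤ) ≤ q₁) (hq₁' : q₁ < 2 * Q)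
    (h₁ : q₁ ∣ ν₁ ^ 2 + 1) (s : Finset (ℤ × ℤ))
    (hs : ∀ v ∈ s, (Q : ℤ) ≤ v.1 ∧ v.1 < 2 * Q ∧ v.1 ∣ v.2 ^ 2 + 1 ∧
      |(ν₁ : ℝ) / q₁ - v.2 / v.1| ≤ 1 / Q) : s.card ≤ 625 := by
  have hQ' : (0 : ℤ) < Q := by exact_mod_cast hQ
  obtain ⟨A, B, C, E, d1, c1, n1⟩ :=
    exists_matrix_of_dvd_sq_add_one q₁.toNat q₁ ν₁ (by omega) (by omega) h₁
  -- With `γ₁`, `γ` the matrices attached to the two roots, `w` holds the entries of `γ₁⁻¹ γ`. They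
  -- will be at most `2` in absolute value, and `γ₁ w` determines the pair, whence `5 ^ 4 = 625`.
  have key : ∀ v ∈ s, ∃ w ∈ (Finset.Icc (-2 : ℤ) 2 ×ˢ Finset.Icc (-2 : ℤ) 2) ×ˢ
      (Finset.Icc (-2 : ℤ) 2 ×ˢ Finset.Icc (-2 : ℤ) 2),
      v = ((C * w.1.1 + E * w.2.1) ^ 2 + (C * w.1.2 + E * w.2.2) ^ 2,
        (A * w.1.1 + B * w.2.1) * (C * w.1.1 + E * w.2.1) +
        (A * w.1.2 + B * w.2.2) * (C * w.1.2 + E * w.2.2)) := by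
    rintro ⟨q, ν⟩ hv
    obtain ⟨g1, g2, g3, g4⟩ := hs _ hv
    simp only at g1 g2 g3 g4
    obtain ⟨A', B', C', E', d2, c2, n2⟩ :=
      exists_matrix_of_dvd_sq_add_one q.toNat q ν (by omega) (by omega) g3
    have hq1R : (Q : ℝ) ≤ q₁ := by exact_mod_cast hq₁
    have hq1R' : (q₁ : ℝ) < 2 * Q := by exact_mod_cast hq₁'
    have hqR : (Q : ℝ) ≤ q := by exact_mod_cast g1
    have hqR' : (q : ℝ) < 2 * Q := by exact_mod_cast g2
    have hQR : (0 : ℝ) < Q := by exact_mod_cast hQ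
    have p1 : (0 : ℝ) < q₁ := by linarith
    have p2 : (0 : ℝ) < q := by linarith
    have hdiff : ((ν₁ : ℝ) * q - ν * q₁) ^ 2 ≤ 4 * (q₁ * q) := by
      have e : (ν₁ : ℝ) * q - ν * q₁ = (ν₁ / q₁ - ν / q) * (q₁ * q) := by field_simp
      rw [e, mul_pow]
      have h : ((ν₁ : ℝ) / q₁ - ν / q) ^ 2 ≤ (1 / Q) ^ 2 := by
        rw [← sq_abs]; gcongr
      have h' : ((ν₁ : ℝ) / q₁ - ν / q) ^ 2 * (q₁ * q) ^ 2 ≤ (1 / Q) ^ 2 * (q₁ * q) ^ 2 := by gcongr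
      refine h'.trans ?_
      have : (1 / (Q : ℝ)) ^ 2 * (q₁ * q) ^ 2 = (q₁ * q) * ((q₁ * q) / Q ^ 2) := by
        field_simp
      rw [this, mul_comm]
      gcongr
      rw [div_le_iff₀ (by positivity)]
      nlinarith
    -- The squared norm of `γ₁⁻¹ γ` is `((ν₁ q - ν q₁)² + q₁² + q²) / (q₁ q)`, that is `2 cosh` of
    -- the hyperbolic distance between the two points. It is at most `4 + 5/2`, as both moduli lie
    -- in `[Q, 2Q)`.
    have hnorm : (E * A' - B * C') ^ 2 + (E * B' - B * E') ^ 2 + (-C * A' + A * C') ^ 2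
        + (-C * B' + A * E') ^ 2 < 9 := by
      set F := (E * A' - B * C') ^ 2 + (E * B' - B * E') ^ 2 + (-C * A' + A * C') ^ 2
        + (-C * B' + A * E') ^ 2 with hF
      have hid : q₁ * q * F = (ν₁ * q - ν * q₁) ^ 2 + q₁ ^ 2 + q ^ 2 := by
        have l1 : (A ^ 2 + B ^ 2) * q₁ = ν₁ ^ 2 + 1 := by
          rw [← c1, ← n1, ← one_pow 2, ← d1]; ring
        have l2 : (A' ^ 2 + B' ^ 2) * q = ν ^ 2 + 1 := by
          rw [← c2, ← n2, ← one_pow 2, ← d2]; ring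
        have l3 : F = (A' ^ 2 + B' ^ 2) * q₁ - 2 * ν₁ * ν + q * (A ^ 2 + B ^ 2) := by
          rw [hF, ← c1, ← n1, ← c2, ← n2]; ring
        rw [l3]
        linear_combination q₁ ^ 2 * l2 + q ^ 2 * l1
      have hidR : (q₁ : ℝ) * q * F = (ν₁ * q - ν * q₁) ^ 2 + q₁ ^ 2 + q ^ 2 := by
        exact_mod_cast hid
      have : (F : ℝ) < 9 := by
        have h : (q₁ : ℝ) * q * F < q₁ * q * 9 := by
          rw [hidR]
          nlinarith [mul_pos p1 p2, mul_nonneg (show (0 : ℝ) ≤ 2 * q₁ - q by linarith)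
            (show (0 : ℝ) ≤ 2 * q - q₁ by linarith)]
        exact lt_of_mul_lt_mul_left h (by positivity)
      exact_mod_cast this
    refine ⟨((E * A' - B * C', E * B' - B * E'), (-C * A' + A * C', -C * B' + A * E')), ?_, ?_⟩
    · simp only [Finset.mem_product, Finset.mem_Icc]
      have small : ∀ z : ℤ, z ^ 2 < 9 → -2 ≤ z ∧ z ≤ 2 := fun z hz => by
        constructor <;> nlinarith
      have s1 := sq_nonneg (E * A' - B * C')
      have s2 := sq_nonneg (E * B' - B * E')
      have s3 := sq_nonneg (-C * A' + A * C')
      have s4 := sq_nonneg (-C * B' + A * E')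
      exact ⟨⟨small _ (by linarith), small _ (by linarith)⟩,
        small _ (by linarith), small _ (by linarith)⟩
    · have r1 : A * (E * A' - B * C') + B * (-C * A' + A * C') = A' := by
        linear_combination A' * d1
      have r2 : A * (E * B' - B * E') + B * (-C * B' + A * E') = B' := by
        linear_combination B' * d1
      have r3 : C * (E * A' - B * C') + E * (-C * A' + A * C') = C' := by
        linear_combination C' * d1
      have r4 : C * (E * B' - B * E') + E * (-C * B' + A * E') = E' := by
        linear_combination E' * d1
      simp only [r1, r2, r3, r4, c2, n2]
  choose! f hf hf' using key
  have hinj : Set.InjOn f s := by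
    intro v hv w hw h
    rw [hf' v hv, hf' w hw, h]
  calc s.card ≤ _ := Finset.card_le_card_of_injOn f hf hinj
    _ = 625 := by simp


/-! ### A large sieve inequality for the fractions `ν / q` -/

/-- The additive character `exp (2 π i x)`. -/
noncomputable def expi (x : ℝ) : ℂ := Complex.exp ((2 * Real.pi * x : ℝ) * Complex.I)

theorem norm_expi (x : ℝ) : ‖expi x‖ = 1 := Complex.norm_exp_ofReal_mul_I _

theorem expi_add (x y : ℝ) : expi (x + y) = expi x * expi y := by
  unfold expi
  rw [← Complex.exp_add]; push_cast; ring_nf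

theorem expi_neg (x : ℝ) : expi (-x) = (starRingEnd ℂ) (expi x) := by
  unfold expi
  rw [← Complex.exp_conj, map_mul, Complex.conj_ofReal, Complex.conj_I]
  push_cast; ring_nf

theorem expi_intCast (n : ℤ) : expi n = 1 := by
  unfold expi
  rw [Complex.exp_eq_one_iff]
  exact ⟨n, by push_cast; ring⟩

theorem expi_natCast_mul (n : ℕ) (x : ℝ) : expi (n * x) = expi x ^ n := by
  unfold expi
  rw [← Complex.exp_nat_mul]; push_cast; ring_nf

theorem re_expi (x : ℝ) : (expi x).re = Real.cos (2 * Real.pi * x) := by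
  unfold expi
  rw [Complex.exp_ofReal_mul_I_re]

theorem norm_geom_sum_expi_le (n : ℕ) (x : ℝ) (h0 : x ≠ 0) (h1 : |x| ≤ 1 / 2) :
    ‖∑ m ∈ Finset.range n, expi (m * x)‖ ≤ 1 / (2 * |x|) := by
  have hpos : 0 < |x| := abs_pos.mpr h0
  have hsub : 4 * |x| ≤ ‖expi x - 1‖ := by
    unfold expi
    rw [mul_comm _ Complex.I, Complex.norm_exp_I_mul_ofReal_sub_one, Real.norm_eq_abs, abs_mul]
    have h2 : 2 * Real.pi * x / 2 = Real.pi * x := by ring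
    have h3 := Real.mul_abs_le_abs_sin (x := Real.pi * x) (by
      rw [abs_mul, abs_of_pos Real.pi_pos]; nlinarith [Real.pi_pos])
    rw [abs_mul, abs_of_pos Real.pi_pos] at h3
    rw [h2, abs_of_pos (by norm_num : (0 : ℝ) < 2)]
    have h4 : 2 / Real.pi * (Real.pi * |x|) = 2 * |x| := by
      field_simp
    rw [h4] at h3; linarith
  have hne : expi x ≠ 1 := by
    intro h
    rw [h, sub_self, norm_zero] at hsub; linarith
  simp_rw [expi_natCast_mul]
  rw [geom_sum_eq hne, norm_div, div_le_div_iff₀ (by linarith) (by linarith)]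
  have : ‖expi x ^ n - 1‖ ≤ 2 := by
    refine (norm_sub_le _ _).trans ?_
    rw [norm_pow, norm_expi]; norm_num
  nlinarith

/-- The pairs `(q, ν)` with `Q ≤ q < 2 * Q` and `ν` a root of `ν ^ 2 + 1` modulo `q`. -/
def rootPairs (Q : ℕ) : Finset (ℕ × ℕ) :=
  (Finset.Ico Q (2 * Q) ×ˢ Finset.range (2 * Q)).filter fun v => v.2 < v.1 ∧ v.1 ∣ v.2 ^ 2 + 1

theorem mem_rootPairs {Q : ℕ} {v : ℕ × ℕ} :
    v ∈ rootPairs Q ↔ Q ≤ v.1 ∧ v.1 < 2 * Q ∧ v.2 < v.1 ∧ v.1 ∣ v.2 ^ 2 + 1 := by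
  simp only [rootPairs, Finset.mem_filter, Finset.mem_product, Finset.mem_Ico, Finset.mem_range]
  constructor
  · rintro ⟨⟨⟨a, b⟩, c⟩, d, e⟩; exact ⟨a, b, d, e⟩
  · rintro ⟨a, b, d, e⟩; exact ⟨⟨⟨a, b⟩, by omega⟩, d, e⟩

theorem summable_one_div_int_sq_add_one : Summable fun j : ℤ => 1 / ((j : ℝ) ^ 2 + 1) := by
  have h : Summable fun j : ℤ => 1 / (j : ℝ) ^ 2 := Real.summable_one_div_int_pow.mpr one_lt_two
  refine h.of_norm_bounded_eventually ?_
  have : {j : ℤ | ¬ ‖1 / ((j : ℝ) ^ 2 + 1)‖ ≤ 1 / (j : ℝ) ^ 2} ⊆ {0} := by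
    intro j hj
    by_contra hne
    refine hj ?_
    have hj0 : (j : ℝ) ≠ 0 := by exact_mod_cast hne
    rw [Real.norm_of_nonneg (by positivity)]
    have : 0 < (j : ℝ) ^ 2 := by positivity
    gcongr; linarith
  exact Filter.eventually_cofinite.mpr ((Set.finite_singleton _).subset this)

/-- The fibre of the points `ν / q` at signed distance about `j / Q` modulo one from `x`. -/
theorem card_shell_le (Q : ℕ) (hQ : 0 < Q) (x : ℝ) (j : ℤ) :
    ((rootPairs Q).filter fun s =>
      ⌊(Q : ℝ) * (x - (s.2 : ℝ) / s.1 - round (x - (s.2 : ℝ) / s.1))⌋ = j).card ≤ 625 := by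
  set F := (rootPairs Q).filter fun s =>
      ⌊(Q : ℝ) * (x - (s.2 : ℝ) / s.1 - round (x - (s.2 : ℝ) / s.1))⌋ = j with hF
  have hQR : (0 : ℝ) < Q := by exact_mod_cast hQ
  set n : ℕ × ℕ → ℤ := fun s => round (x - (s.2 : ℝ) / s.1) with hn
  -- Replacing `ν` by `ν + n q` lifts distances modulo one to distances on the line, where
  -- `card_near_le` applies.
  set φ : ℕ × ℕ → ℤ × ℤ := fun s => ((s.1 : ℤ), (s.2 : ℤ) + n s * s.1) with hφ
  have hinj : Set.InjOn φ F := by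
    intro s hs t ht h
    have hs' := mem_rootPairs.mp (Finset.mem_filter.mp hs).1
    have ht' := mem_rootPairs.mp (Finset.mem_filter.mp ht).1
    simp only [hφ, Prod.mk.injEq] at h
    obtain ⟨h1, h2⟩ := h
    have h1' : s.1 = t.1 := by exact_mod_cast h1
    refine Prod.ext h1' ?_
    have h3 : ((s.2 : ℤ)) % s.1 = (t.2 : ℤ) % s.1 := by
      have := congrArg (· % (s.1 : ℤ)) h2
      simpa [← h1, Int.add_mul_emod_self_right] using this
    rw [Int.emod_eq_of_lt (by omega) (by omega), Int.emod_eq_of_lt (by omega) (by omega)] at h3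
    exact_mod_cast h3
  rcases F.eq_empty_or_nonempty with h | ⟨s₀, hs₀⟩
  · simp [h]
  rw [← Finset.card_image_of_injOn hinj]
  have hval : ∀ s ∈ F, (((φ s).2 : ℤ) : ℝ) / ((φ s).1 : ℤ) = (s.2 : ℝ) / s.1 + n s := by
    intro s hs
    have hs' := mem_rootPairs.mp (Finset.mem_filter.mp hs).1
    have : (0 : ℝ) < s.1 := by exact_mod_cast (by omega : 0 < s.1)
    simp only [hφ]; push_cast; field_simp
  have hdvd : ∀ s ∈ F, (Q : ℤ) ≤ (φ s).1 ∧ (φ s).1 < 2 * Q ∧ (φ s).1 ∣ (φ s).2 ^ 2 + 1 := by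
    intro s hs
    obtain ⟨a, b, c, d⟩ := mem_rootPairs.mp (Finset.mem_filter.mp hs).1
    refine ⟨by simp only [hφ]; exact_mod_cast a, by simp only [hφ]; exact_mod_cast b, ?_⟩
    have : (φ s).2 ^ 2 + 1 = ((s.2 : ℤ) ^ 2 + 1) + s.1 * (2 * s.2 * n s + n s ^ 2 * s.1) := by
      simp only [hφ]; ring
    rw [this]
    exact dvd_add (by simp only [hφ]; exact_mod_cast d) (dvd_mul_right _ _)
  obtain ⟨a, b, c⟩ := hdvd s₀ hs₀
  refine card_near_le Q hQ (φ s₀).1 (φ s₀).2 a b c _ ?_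
  intro v hv
  obtain ⟨s, hs, rfl⟩ := Finset.mem_image.mp hv
  obtain ⟨a', b', c'⟩ := hdvd s hs
  refine ⟨a', b', c', ?_⟩
  rw [hval s hs, hval s₀ hs₀]
  have e1 := (Int.floor_eq_iff.mp (Finset.mem_filter.mp hs).2)
  have e2 := (Int.floor_eq_iff.mp (Finset.mem_filter.mp hs₀).2)
  rw [le_div_iff₀ hQR]
  nth_rewrite 1 [← abs_of_pos hQR]
  rw [← abs_mul, abs_le]
  simp only [hn]
  constructor <;> nlinarith

/-- The points are sorted into shells of width `1 / Q` around `x`. In shell `j` the geometric sum is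
`O(L / (1 + |j|))`, since `Q ≤ L`. A shell holds at most `625` points and the squares are summable
over `j`. The constant is `16 * 625 = 10000`. -/
theorem sum_sq_norm_geom_sum_le : ∃ C : ℝ, 0 < C ∧ ∀ Q L : ℕ, 0 < Q → Q ≤ L → ∀ x : ℝ,
    ∑ s ∈ rootPairs Q, ‖∑ m ∈ Finset.range (2 * L), expi (m * (x - (s.2 : ℝ) / s.1))‖ ^ 2
      ≤ C * (L : ℝ) ^ 2 := by
  set K := ∑' j : ℤ, 1 / ((j : ℝ) ^ 2 + 1) with hK
  have hK0 : 0 ≤ K := tsum_nonneg fun j => by positivity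
  refine ⟨10000 * K + 1, by positivity, fun Q L hQ hL x => ?_⟩
  have hQR : (0 : ℝ) < Q := by exact_mod_cast hQ
  have hLR : (Q : ℝ) ≤ L := by exact_mod_cast hL
  set δ : ℕ × ℕ → ℝ := fun s => x - (s.2 : ℝ) / s.1 - round (x - (s.2 : ℝ) / s.1) with hδ
  set j : ℕ × ℕ → ℤ := fun s => ⌊(Q : ℝ) * δ s⌋ with hj
  have hterm : ∀ s, ‖∑ m ∈ Finset.range (2 * L), expi (m * (x - (s.2 : ℝ) / s.1))‖ ^ 2
      ≤ 16 * (L : ℝ) ^ 2 * (1 / ((j s : ℝ) ^ 2 + 1)) := by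
    intro s
    have hper : ∑ m ∈ Finset.range (2 * L), expi (m * (x - (s.2 : ℝ) / s.1))
        = ∑ m ∈ Finset.range (2 * L), expi (m * δ s) := by
      refine Finset.sum_congr rfl fun m _ => ?_
      have : (m : ℝ) * (x - (s.2 : ℝ) / s.1)
          = m * δ s + ((m * round (x - (s.2 : ℝ) / s.1) : ℤ) : ℝ) := by
        simp only [hδ]; push_cast; ring
      rw [this, expi_add, expi_intCast, mul_one]
    rw [hper]
    have hδ1 : |δ s| ≤ 1 / 2 := abs_sub_round _
    have f1 : (j s : ℝ) ≤ Q * δ s := Int.floor_le _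
    have f2 : (Q : ℝ) * δ s < j s + 1 := Int.lt_floor_add_one _
    have htriv : ‖∑ m ∈ Finset.range (2 * L), expi (m * δ s)‖ ≤ 2 * L := by
      refine (norm_sum_le _ _).trans ?_
      simp [norm_expi]
    have hgen : ∀ y : ℝ, 0 < y → y ≤ Q * |δ s| →
        ‖∑ m ∈ Finset.range (2 * L), expi (m * δ s)‖ ≤ L / (2 * y) := by
      intro y hy hyd
      have hd : 0 < |δ s| := by
        by_contra h
        have : |δ s| = 0 := le_antisymm (not_lt.mp h) (abs_nonneg _)
        rw [this] at hyd; linarith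
      refine (norm_geom_sum_expi_le _ _ (abs_pos.mp hd) hδ1).trans ?_
      rw [div_le_div_iff₀ (by positivity) (by positivity)]
      nlinarith
    have hsq : ∀ y : ℝ, ‖∑ m ∈ Finset.range (2 * L), expi (m * δ s)‖ ≤ y →
        y ^ 2 ≤ 16 * (L : ℝ) ^ 2 * (1 / ((j s : ℝ) ^ 2 + 1)) →
        ‖∑ m ∈ Finset.range (2 * L), expi (m * δ s)‖ ^ 2
          ≤ 16 * (L : ℝ) ^ 2 * (1 / ((j s : ℝ) ^ 2 + 1)) := fun y h1 h2 =>
      (pow_le_pow_left₀ (norm_nonneg _) h1 2).trans h2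
    have hL2 : (0 : ℝ) ≤ (L : ℝ) ^ 2 := by positivity
    rcases lt_trichotomy (j s) 0 with h | h | h
    -- Shells `0` and `-1` reach `x` itself, so only the trivial bound `2 L` is available there.
    · rcases eq_or_ne (j s) (-1) with h1 | h1
      · refine hsq _ htriv ?_
        rw [h1]; push_cast; nlinarith
      · have h2 : j s ≤ -2 := by omega
        have h2R : (j s : ℝ) ≤ -2 := by exact_mod_cast h2
        -- For `j ≤ -2` the distance is at least `|j + 1| / Q ≥ |j| / (2 Q)`.
        refine hsq _ (hgen (-(j s : ℝ) / 2) (by linarith) ?_) ?_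
        · have := neg_le_abs (δ s)
          nlinarith
        · have e : (L / (2 * (-(j s : ℝ) / 2))) ^ 2 = (L : ℝ) ^ 2 * (1 / (j s : ℝ) ^ 2) := by
            field_simp
          rw [e, mul_assoc, mul_left_comm]
          refine mul_le_mul_of_nonneg_left ?_ hL2
          rw [← mul_div_assoc, mul_one, div_le_div_iff₀ (by nlinarith) (by positivity)]
          nlinarith
    · refine hsq _ htriv ?_
      rw [h]; push_cast; nlinarith
    · have h2R : (1 : ℝ) ≤ (j s : ℝ) := by exact_mod_cast h
      refine hsq _ (hgen (j s : ℝ) (by linarith) ?_) ?_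
      · have := le_abs_self (δ s)
        nlinarith
      · have e : (L / (2 * (j s : ℝ))) ^ 2 = (L : ℝ) ^ 2 * (1 / (4 * (j s : ℝ) ^ 2)) := by
          field_simp; norm_num
        rw [e, mul_assoc, mul_left_comm]
        refine mul_le_mul_of_nonneg_left ?_ hL2
        rw [← mul_div_assoc, mul_one, div_le_div_iff₀ (by nlinarith) (by positivity)]
        nlinarith
  calc ∑ s ∈ rootPairs Q, ‖∑ m ∈ Finset.range (2 * L), expi (m * (x - (s.2 : ℝ) / s.1))‖ ^ 2
      ≤ ∑ s ∈ rootPairs Q, 16 * (L : ℝ) ^ 2 * (1 / ((j s : ℝ) ^ 2 + 1)) :=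
        Finset.sum_le_sum fun s _ => hterm s
    _ = ∑ i ∈ (rootPairs Q).image j, ∑ s ∈ (rootPairs Q).filter (fun s => j s = i),
          16 * (L : ℝ) ^ 2 * (1 / ((j s : ℝ) ^ 2 + 1)) :=
        (Finset.sum_fiberwise_of_maps_to (fun s hs => Finset.mem_image_of_mem j hs) _).symm
    _ ≤ ∑ i ∈ (rootPairs Q).image j, 10000 * (L : ℝ) ^ 2 * (1 / ((i : ℝ) ^ 2 + 1)) := by
        refine Finset.sum_le_sum fun i _ => ?_
        have hc : (((rootPairs Q).filter (fun s => j s = i)).card : ℝ) ≤ 625 := by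
          exact_mod_cast card_shell_le Q hQ x i
        have : ∑ s ∈ (rootPairs Q).filter (fun s => j s = i),
            16 * (L : ℝ) ^ 2 * (1 / ((j s : ℝ) ^ 2 + 1))
            = ((rootPairs Q).filter (fun s => j s = i)).card
              * (16 * (L : ℝ) ^ 2 * (1 / ((i : ℝ) ^ 2 + 1))) := by
          rw [← nsmul_eq_mul, ← Finset.sum_const]
          refine Finset.sum_congr rfl fun s hs => ?_
          rw [(Finset.mem_filter.mp hs).2]
        rw [this]
        calc _ ≤ 625 * (16 * (L : ℝ) ^ 2 * (1 / ((i : ℝ) ^ 2 + 1))) := by gcongr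
          _ = _ := by ring
    _ = 10000 * (L : ℝ) ^ 2 * ∑ i ∈ (rootPairs Q).image j, (1 / ((i : ℝ) ^ 2 + 1)) := by
        rw [Finset.mul_sum]
    _ ≤ 10000 * (L : ℝ) ^ 2 * K := by
        gcongr
        exact summable_one_div_int_sq_add_one.sum_le_tsum _ fun i _ => by positivity
    _ ≤ _ := by nlinarith [sq_nonneg (L : ℝ)]

theorem sum_sum_expi_mul_sub (n : ℕ) (y : ℝ) :
    ∑ m ∈ Finset.range n, ∑ k ∈ Finset.range n, expi (((m : ℝ) - k) * y)
      = ((‖∑ m ∈ Finset.range n, expi (m * y)‖ ^ 2 : ℝ) : ℂ) := by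
  push_cast
  rw [← Complex.mul_conj', map_sum, Finset.sum_mul_sum]
  refine Finset.sum_congr rfl fun m _ => Finset.sum_congr rfl fun k _ => ?_
  rw [← expi_neg, ← expi_add]; ring_nf

/-- The sharp cutoff to `n < L` is dominated by the Fejér weight of the differences `m - k`. The
resulting kernel `G` is a squared modulus, hence nonnegative, and a Schur test reduces the claim to
the row sums bounded in `sum_sq_norm_geom_sum_le`. -/
theorem large_sieve_dual : ∃ C : ℝ, 0 < C ∧ ∀ Q L : ℕ, 0 < Q → Q ≤ L → ∀ b : ℕ × ℕ → ℂ,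
    ∑ n ∈ Finset.range L, ‖∑ v ∈ rootPairs Q, b v * expi (n * ((v.2 : ℝ) / v.1))‖ ^ 2
      ≤ C * L * ∑ v ∈ rootPairs Q, ‖b v‖ ^ 2 := by
  obtain ⟨C, hC, hsum⟩ := sum_sq_norm_geom_sum_le
  refine ⟨C, hC, fun Q L hQ hL b => ?_⟩
  have hL0 : (0 : ℝ) < L := by exact_mod_cast (by omega : 0 < L)
  set x : ℕ × ℕ → ℝ := fun v => (v.2 : ℝ) / v.1 with hx
  set f : ℝ → ℂ := fun z => ∑ v ∈ rootPairs Q, b v * expi (z * x v) with hf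
  set G : ℝ → ℝ := fun y => ‖∑ m ∈ Finset.range (2 * L), expi (m * y)‖ ^ 2 with hG
  have hGneg : ∀ y, G (-y) = G y := by
    intro y
    simp only [hG]
    rw [← Complex.norm_conj, map_sum]
    congr 2
    refine Finset.sum_congr rfl fun m _ => ?_
    rw [← expi_neg]; ring_nf
  -- For each `k < L` the window `k ≤ m < k + L` lies in `[0, 2L)` and reproduces the sum over `n <
  -- L`, so that sum occurs `L` times on the right.
  have h1 : (L : ℝ) * ∑ n ∈ Finset.range L, ‖f n‖ ^ 2
      ≤ ∑ m ∈ Finset.range (2 * L), ∑ k ∈ Finset.range (2 * L), ‖f ((m : ℝ) - k)‖ ^ 2 := by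
    rw [Finset.sum_comm]
    have e : (L : ℝ) * ∑ n ∈ Finset.range L, ‖f n‖ ^ 2
        = ∑ k ∈ Finset.range L, ∑ n ∈ Finset.range L, ‖f n‖ ^ 2 := by
      rw [Finset.sum_const, Finset.card_range, nsmul_eq_mul]
    rw [e]
    refine (Finset.sum_le_sum fun k hk => ?_).trans (Finset.sum_le_sum_of_subset_of_nonneg
      (Finset.range_subset_range.mpr (by omega : L ≤ 2 * L)) fun k _ _ =>
        Finset.sum_nonneg fun m _ => by positivity)
    have hk' := Finset.mem_range.mp hk
    have e2 : ∑ n ∈ Finset.range L, ‖f n‖ ^ 2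
        = ∑ m ∈ Finset.Ico k (k + L), ‖f ((m : ℝ) - k)‖ ^ 2 := by
      rw [Finset.sum_Ico_eq_sum_range, Nat.add_sub_cancel_left]
      refine Finset.sum_congr rfl fun n _ => ?_
      push_cast; ring_nf
    rw [e2]
    refine Finset.sum_le_sum_of_subset_of_nonneg ?_ fun m _ _ => by positivity
    intro m hm
    have := Finset.mem_Ico.mp hm
    exact Finset.mem_range.mpr (by omega)
  have h2 : ((∑ m ∈ Finset.range (2 * L), ∑ k ∈ Finset.range (2 * L),
      ‖f ((m : ℝ) - k)‖ ^ 2 : ℝ) : ℂ)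
      = ∑ v ∈ rootPairs Q, ∑ w ∈ rootPairs Q,
        b v * (starRingEnd ℂ) (b w) * (G (x v - x w) : ℝ) := by
    simp only [hG, ← sum_sum_expi_mul_sub, Finset.mul_sum]
    push_cast
    have hexp : ∀ z : ℝ, ((‖f z‖ : ℂ)) ^ 2 = ∑ v ∈ rootPairs Q, ∑ w ∈ rootPairs Q,
        b v * (starRingEnd ℂ) (b w) * expi (z * (x v - x w)) := by
      intro z
      rw [← Complex.mul_conj', hf]
      simp only [map_sum, map_mul]
      rw [Finset.sum_mul_sum]
      refine Finset.sum_congr rfl fun v _ => Finset.sum_congr rfl fun w _ => ?_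
      rw [← expi_neg, show z * (x v - x w) = z * x v + -(z * x w) by ring, expi_add]; ring
    simp_rw [hexp]
    rw [Finset.sum_congr rfl fun m _ => Finset.sum_comm, Finset.sum_comm]
    refine Finset.sum_congr rfl fun v _ => ?_
    rw [Finset.sum_congr rfl fun m _ => Finset.sum_comm, Finset.sum_comm]
  have h3 : ∑ m ∈ Finset.range (2 * L), ∑ k ∈ Finset.range (2 * L), ‖f ((m : ℝ) - k)‖ ^ 2
      ≤ C * (L : ℝ) ^ 2 * ∑ v ∈ rootPairs Q, ‖b v‖ ^ 2 := by
    have hnn : 0 ≤ ∑ m ∈ Finset.range (2 * L), ∑ k ∈ Finset.range (2 * L),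
        ‖f ((m : ℝ) - k)‖ ^ 2 :=
      Finset.sum_nonneg fun m _ => Finset.sum_nonneg fun k _ => by positivity
    rw [← abs_of_nonneg hnn, ← Real.norm_eq_abs, ← Complex.norm_real, h2]
    have hG0 : ∀ y, 0 ≤ G y := fun y => by simp only [hG]; positivity
    calc _ ≤ ∑ v ∈ rootPairs Q, ∑ w ∈ rootPairs Q, ‖b v‖ * ‖b w‖ * G (x v - x w) := by
          refine (norm_sum_le _ _).trans (Finset.sum_le_sum fun v _ =>
            (norm_sum_le _ _).trans (Finset.sum_le_sum fun w _ => ?_))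
          rw [norm_mul, norm_mul, Complex.norm_conj, Complex.norm_real, Real.norm_of_nonneg (hG0 _)]
      _ ≤ ∑ v ∈ rootPairs Q, ∑ w ∈ rootPairs Q,
            (‖b v‖ ^ 2 * G (x v - x w) / 2 + ‖b w‖ ^ 2 * G (x w - x v) / 2) := by
          refine Finset.sum_le_sum fun v _ => Finset.sum_le_sum fun w _ => ?_
          rw [← hGneg (x w - x v), neg_sub]
          nlinarith [mul_nonneg (sq_nonneg (‖b v‖ - ‖b w‖)) (hG0 (x v - x w))]
      _ = ∑ v ∈ rootPairs Q, ‖b v‖ ^ 2 * ∑ w ∈ rootPairs Q, G (x v - x w) := by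
          simp only [Finset.sum_add_distrib]
          rw [Finset.sum_comm (f := fun v w => ‖b w‖ ^ 2 * G (x w - x v) / 2),
            ← Finset.sum_add_distrib]
          refine Finset.sum_congr rfl fun v _ => ?_
          rw [← Finset.sum_add_distrib, Finset.mul_sum]
          refine Finset.sum_congr rfl fun w _ => by ring
      _ ≤ ∑ v ∈ rootPairs Q, ‖b v‖ ^ 2 * (C * (L : ℝ) ^ 2) := by
          refine Finset.sum_le_sum fun v _ => ?_
          gcongr
          exact hsum Q L hQ hL (x v)
      _ = _ := by rw [← Finset.sum_mul]; ring
  have h4 := h1.trans h3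
  have h5 : C * (L : ℝ) ^ 2 * ∑ v ∈ rootPairs Q, ‖b v‖ ^ 2
      = L * (C * L * ∑ v ∈ rootPairs Q, ‖b v‖ ^ 2) := by ring
  rw [h5] at h4
  exact le_of_mul_le_mul_left h4 hL0

/-- The large sieve inequality at the points `ν / q`, for frequencies `n i < L` each of which
occurs at most `R` times. -/
theorem large_sieve : ∃ C : ℝ, 0 < C ∧ ∀ (Q L R : ℕ), 0 < Q → Q ≤ L →
    ∀ {ι : Type} (s : Finset ι) (n : ι → ℕ) (β : ι → ℂ), (∀ i ∈ s, n i < L) →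
    (∀ m, (s.filter fun i => n i = m).card ≤ R) →
    ∑ v ∈ rootPairs Q, ‖∑ i ∈ s, β i * expi (n i * ((v.2 : ℝ) / v.1))‖ ^ 2
      ≤ C * R * L * ∑ i ∈ s, ‖β i‖ ^ 2 := by
  obtain ⟨C, hC, hdual⟩ := large_sieve_dual
  refine ⟨C, hC, fun Q L R hQ hL ι s n β hn hR => ?_⟩
  set S : ℕ × ℕ → ℂ := fun v => ∑ i ∈ s, β i * expi (n i * ((v.2 : ℝ) / v.1)) with hS
  -- Duality: `T` is a pairing of `β` with `F`, and the dual inequality with coefficients `conj (S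
  -- v)` bounds `F` in mean square by `T` itself. After Cauchy–Schwarz one factor `T` cancels.
  set F : ℕ → ℂ := fun m =>
    ∑ v ∈ rootPairs Q, (starRingEnd ℂ) (S v) * expi (m * ((v.2 : ℝ) / v.1)) with hF
  set T := ∑ v ∈ rootPairs Q, ‖S v‖ ^ 2 with hT
  have hT0 : 0 ≤ T := Finset.sum_nonneg fun v _ => by positivity
  have hB0 : 0 ≤ ∑ i ∈ s, ‖β i‖ ^ 2 := Finset.sum_nonneg fun v _ => by positivity
  have h1 : (T : ℂ) = ∑ i ∈ s, β i * F (n i) := by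
    simp only [hT, hF, Finset.mul_sum]
    rw [Finset.sum_comm]
    push_cast
    refine Finset.sum_congr rfl fun v _ => ?_
    rw [← Complex.conj_mul']
    nth_rewrite 2 [hS]
    simp only [Finset.mul_sum]
    refine Finset.sum_congr rfl fun i _ => by ring
  have h2 : T ≤ ∑ i ∈ s, ‖β i‖ * ‖F (n i)‖ := by
    rw [← abs_of_nonneg hT0, ← Real.norm_eq_abs, ← Complex.norm_real, h1]
    refine (norm_sum_le _ _).trans (Finset.sum_le_sum fun i _ => (norm_mul _ _).le)
  have h3 : ∑ i ∈ s, ‖F (n i)‖ ^ 2 ≤ R * (C * L * T) := by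
    have hd := hdual Q L hQ hL (fun v => (starRingEnd ℂ) (S v))
    simp only [Complex.norm_conj] at hd
    calc ∑ i ∈ s, ‖F (n i)‖ ^ 2
        = ∑ m ∈ Finset.range L, ∑ i ∈ s.filter (fun i => n i = m), ‖F (n i)‖ ^ 2 :=
          (Finset.sum_fiberwise_of_maps_to
            (fun i hi => Finset.mem_range.mpr (hn i hi)) _).symm
      _ ≤ ∑ m ∈ Finset.range L, R * ‖F m‖ ^ 2 := by
          refine Finset.sum_le_sum fun m _ => ?_
          have : ∑ i ∈ s.filter (fun i => n i = m), ‖F (n i)‖ ^ 2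
              = (s.filter (fun i => n i = m)).card * ‖F m‖ ^ 2 := by
            rw [← nsmul_eq_mul, ← Finset.sum_const]
            refine Finset.sum_congr rfl fun i hi => ?_
            rw [(Finset.mem_filter.mp hi).2]
          rw [this]
          gcongr
          exact hR m
      _ = R * ∑ m ∈ Finset.range L, ‖F m‖ ^ 2 := by rw [Finset.mul_sum]
      _ ≤ _ := by gcongr
  have h4 : T ^ 2 ≤ (∑ i ∈ s, ‖β i‖ ^ 2) * (R * (C * L * T)) :=
    (pow_le_pow_left₀ hT0 h2 2).trans
      ((Finset.sum_mul_sq_le_sq_mul_sq s _ _).trans (by gcongr))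
  rcases hT0.eq_or_lt with h | h
  · rw [← h]; positivity
  · have h5 : T * T ≤ T * (C * R * L * ∑ i ∈ s, ‖β i‖ ^ 2) := by nlinarith
    exact le_of_mul_le_mul_left h5 h

/-- The large sieve with one term of frequency zero and `L = Q`. It takes the place of a mean value
estimate for `ρ`. -/
theorem card_rootPairs_le : ∃ C : ℝ, 0 < C ∧ ∀ Q : ℕ, 0 < Q → ((rootPairs Q).card : ℝ) ≤ C * Q := by
  obtain ⟨C, hC, h⟩ := large_sieve
  refine ⟨C, hC, fun Q hQ => ?_⟩
  have := h Q Q 1 hQ le_rfl {()} (fun _ => 0) (fun _ => 1) (fun _ _ => hQ)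
    (fun m => (Finset.card_filter_le _ _).trans (by simp))
  have e : expi 0 = 1 := by simpa using expi_intCast 0
  simpa [e] using this


/-! ### The sawtooth function and its smoothed Fourier expansion -/

/-- The sawtooth function. -/
noncomputable def saw (x : ℝ) : ℝ := Int.fract x - 1 / 2

/-- The periodic primitive of `saw` with mean zero. -/
noncomputable def sawPrim (x : ℝ) : ℝ := (Int.fract x ^ 2 - Int.fract x + 1 / 6) / 2

/-- The sawtooth has slope one and all its jumps are downward. This one-sidedness is what allows
majorants and minorants below. -/
theorem saw_add_le (y : ℝ) {v : ℝ} (hv : 0 ≤ v) : saw (y + v) ≤ saw y + v := by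
  unfold saw Int.fract
  have h : ⌊y⌋ ≤ ⌊y + v⌋ := Int.floor_le_floor (by linarith)
  have : (⌊y⌋ : ℝ) ≤ ⌊y + v⌋ := by exact_mod_cast h
  linarith

theorem exists_fract_add (y : ℝ) {e : ℝ} (he : 0 ≤ e) :
    ∃ n : ℕ, Int.fract (y + e) = Int.fract y + e - n := by
  have h : ⌊y⌋ ≤ ⌊y + e⌋ := Int.floor_le_floor (by linarith)
  refine ⟨(⌊y + e⌋ - ⌊y⌋).toNat, ?_⟩
  have h2 : (((⌊y + e⌋ - ⌊y⌋).toNat : ℤ) : ℝ) = ((⌊y + e⌋ - ⌊y⌋ : ℤ) : ℝ) := by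
    rw [Int.toNat_of_nonneg (by omega)]
  push_cast at h2
  rw [h2]; unfold Int.fract; ring

theorem natCast_mul_nonneg_of_pos_imp (n : ℕ) (z : ℝ) (h : 1 ≤ (n : ℝ) → 0 ≤ z) :
    0 ≤ (n : ℝ) * z := by
  rcases Nat.eq_zero_or_pos n with h0 | h0
  · simp [h0]
  · exact mul_nonneg (by positivity) (h (by exact_mod_cast h0))

/-- If `n` integers are crossed, the right side exceeds the left by `n (2 {y + e} + n - 1) / 2`.
This vanishes for `n = 0` and is nonnegative for `n ≥ 1`. -/
theorem sawPrim_add_sub_le (y : ℝ) {e : ℝ} (he : 0 ≤ e) :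
    sawPrim (y + e) - sawPrim y ≤ e * saw y + e ^ 2 / 2 := by
  obtain ⟨n, hn⟩ := exists_fract_add y he
  have h0 := Int.fract_nonneg (y + e)
  have := natCast_mul_nonneg_of_pos_imp n (2 * Int.fract (y + e) + n - 1) fun h => by linarith
  unfold sawPrim saw
  rw [hn] at this ⊢
  nlinarith

theorem le_sawPrim_sub (y : ℝ) {e : ℝ} (he : 0 ≤ e) :
    e * saw y - e ^ 2 / 2 ≤ sawPrim y - sawPrim (y - e) := by
  obtain ⟨n, hn⟩ := exists_fract_add (y - e) he
  have h0 := Int.fract_lt_one (y - e)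
  have := natCast_mul_nonneg_of_pos_imp n (n + 1 - 2 * Int.fract (y - e)) fun h => by linarith
  rw [sub_add_cancel] at hn
  unfold sawPrim saw
  rw [hn]
  nlinarith

/-- The quotient is the mean of `saw` over `[y, y + e]`, to the right of the point `y - v`.
One-sidedness costs `v ≤ e` to pass from `y - v` to `y`, and `e / 2` to pass to the mean. -/
theorem le_saw_sub (y : ℝ) {e v : ℝ} (he : 0 < e) (hv : 0 ≤ v) (hve : v ≤ e) :
    (sawPrim (y + e) - sawPrim y) / e - 3 * e / 2 ≤ saw (y - v) := by
  have h1 := sawPrim_add_sub_le y he.le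
  have h2 := saw_add_le (y - v) hv
  rw [sub_add_cancel] at h2
  have h3 : (sawPrim (y + e) - sawPrim y) / e ≤ saw y + e / 2 := by
    rw [div_le_iff₀ he]; nlinarith
  linarith

/-- The companion majorant averages over `[y - 2e, y - e]`, to the left of every `y - v`. It has the
same shape as the minorant with `y` shifted by `-2e`, so one Fourier expansion serves both. -/
theorem saw_sub_le (y : ℝ) {e v : ℝ} (he : 0 < e) (hv : 0 ≤ v) (hve : v ≤ e) :
    saw (y - v) ≤ (sawPrim (y - 2 * e + e) - sawPrim (y - 2 * e)) / e + 3 * e / 2 := by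
  have h1 := le_sawPrim_sub (y - e) he.le
  have h2 := saw_add_le (y - e) (sub_nonneg.mpr hve)
  rw [show y - e + (e - v) = y - v by ring] at h2
  rw [show y - e - e = y - 2 * e by ring] at h1
  have h3 : saw (y - e) - e / 2 ≤ (sawPrim (y - e) - sawPrim (y - 2 * e)) / e := by
    rw [le_div_iff₀ he]; nlinarith
  rw [show y - 2 * e + e = y - e by ring]
  linarith

/-- `sawPrim` is half the periodic second Bernoulli polynomial. The term `n = 0` is zero because
division by zero gives zero. -/
theorem hasSum_sawPrim (x : ℝ) :
    HasSum (fun n : ℕ => Real.cos (2 * Real.pi * n * x) / (2 * Real.pi ^ 2 * (n : ℝ) ^ 2))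
      (sawPrim x) := by
  have h := hasSum_one_div_nat_pow_mul_cos one_ne_zero
    (⟨Int.fract_nonneg x, (Int.fract_lt_one x).le⟩ : Int.fract x ∈ Set.Icc (0 : ℝ) 1)
  have h2 := h.mul_left (1 / (2 * Real.pi ^ 2))
  convert! h2 using 1
  · ext n
    have : Real.cos (2 * Real.pi * n * x) = Real.cos (2 * Real.pi * n * Int.fract x) := by
      have e : 2 * Real.pi * n * x
          = 2 * Real.pi * n * Int.fract x + ((n * ⌊x⌋ : ℤ) : ℝ) * (2 * Real.pi) := by
        unfold Int.fract; push_cast; ring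
      rw [e, Real.cos_add_int_mul_two_pi]
    rw [this, mul_one]
    rcases Nat.eq_zero_or_pos n with h0 | h0
    · simp [h0]
    · have : (n : ℝ) ≠ 0 := by positivity
      field_simp
  · have hb : (Polynomial.map (algebraMap ℚ ℝ) (Polynomial.bernoulli (2 * 1))).eval (Int.fract x)
        = Int.fract x ^ 2 - Int.fract x + 1 / 6 := by
      rw [mul_one, Polynomial.bernoulli_def]
      simp [Finset.sum_range_succ, bernoulli_two, bernoulli_one, Polynomial.eval_add]
      ring
    rw [hb]
    unfold sawPrim
    have := Real.pi_pos.ne'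
    norm_num [Nat.factorial]
    field_simp

/-- The Fourier coefficients of the smoothed counting function. -/
noncomputable def smoothCoeff (e σ : ℝ) (n : ℕ) : ℝ :=
  (Real.cos (2 * Real.pi * n * (σ + e)) - Real.cos (2 * Real.pi * n * σ))
    / (Real.pi ^ 2 * (n : ℝ) ^ 2 * e)

/-- The smoothed counterpart of `saw (σ - θ) + saw (σ + θ)`. -/
noncomputable def smoothSaw (e σ θ : ℝ) : ℝ :=
  (sawPrim (σ - θ + e) - sawPrim (σ - θ)) / e + (sawPrim (σ + θ + e) - sawPrim (σ + θ)) / e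

/-- Pairing `θ` with `-θ` turns the cosines of sums and differences into products. The coefficients
then depend on `σ` only and are separated from the fraction `θ`. -/
theorem hasSum_smoothSaw (e σ θ : ℝ) :
    HasSum (fun n : ℕ => smoothCoeff e σ n * Real.cos (2 * Real.pi * n * θ))
      (smoothSaw e σ θ) := by
  have h := (((hasSum_sawPrim (σ - θ + e)).sub (hasSum_sawPrim (σ - θ))).div_const e).add
    (((hasSum_sawPrim (σ + θ + e)).sub (hasSum_sawPrim (σ + θ))).div_const e)
  unfold smoothSaw
  convert! h using 1
  ext n
  unfold smoothCoeff
  rw [show 2 * Real.pi * n * (σ - θ + e) = 2 * Real.pi * n * (σ + e) - 2 * Real.pi * n * θ by ring,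
    show 2 * Real.pi * n * (σ + θ + e) = 2 * Real.pi * n * (σ + e) + 2 * Real.pi * n * θ by ring,
    show 2 * Real.pi * n * (σ - θ) = 2 * Real.pi * n * σ - 2 * Real.pi * n * θ by ring,
    show 2 * Real.pi * n * (σ + θ) = 2 * Real.pi * n * σ + 2 * Real.pi * n * θ by ring]
  simp only [Real.cos_add, Real.cos_sub]
  rcases eq_or_ne e 0 with h0 | h0
  · simp [h0]
  rcases Nat.eq_zero_or_pos n with h1 | h1
  · simp [h1]
  · have : (n : ℝ) ≠ 0 := by positivity
    have := Real.pi_pos.ne'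
    field_simp
    ring

theorem smoothCoeff_zero (e σ : ℝ) : smoothCoeff e σ 0 = 0 := by simp [smoothCoeff]

theorem abs_smoothCoeff_le_inv_sq {e : ℝ} (he : 0 < e) (σ : ℝ) (n : ℕ) :
    |smoothCoeff e σ n| ≤ ((n : ℝ) ^ 2)⁻¹ / e := by
  rcases Nat.eq_zero_or_pos n with h1 | h1
  · simp [h1, smoothCoeff_zero]
  have hn : (0 : ℝ) < n := by exact_mod_cast h1
  unfold smoothCoeff
  have hpi : (2 : ℝ) ≤ Real.pi ^ 2 := by nlinarith [Real.pi_gt_three]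
  have a1 := abs_le.mp (Real.abs_cos_le_one (2 * Real.pi * n * (σ + e)))
  have a2 := abs_le.mp (Real.abs_cos_le_one (2 * Real.pi * n * σ))
  rw [abs_div, abs_of_pos (show 0 < Real.pi ^ 2 * (n : ℝ) ^ 2 * e by positivity)]
  have : |Real.cos (2 * Real.pi * n * (σ + e)) - Real.cos (2 * Real.pi * n * σ)| ≤ 2 := by
    rw [abs_le]; constructor <;> linarith
  calc _ ≤ 2 / (Real.pi ^ 2 * (n : ℝ) ^ 2 * e) := by gcongr
    _ ≤ 2 / (2 * (n : ℝ) ^ 2 * e) := by gcongr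
    _ = _ := by field_simp

theorem abs_cos_sub_cos_le (a b : ℝ) : |Real.cos a - Real.cos b| ≤ |a + b| * |a - b| / 2 := by
  rw [Real.cos_sub_cos, abs_mul, abs_mul]
  have h1 := Real.abs_sin_le_abs (x := (a + b) / 2)
  have h2 := Real.abs_sin_le_abs (x := (a - b) / 2)
  rw [abs_div, abs_of_pos (by norm_num : (0 : ℝ) < 2)] at h1 h2
  have h3 := mul_le_mul h1 h2 (abs_nonneg _) (by positivity)
  rw [abs_neg, abs_of_pos (by norm_num : (0 : ℝ) < 2)]
  linarith

theorem abs_cos_sub_cos_le' (a b : ℝ) : |Real.cos a - Real.cos b| ≤ |a - b| := by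
  rw [Real.cos_sub_cos, abs_mul, abs_mul]
  have h1 := Real.abs_sin_le_one ((a + b) / 2)
  have h2 := Real.abs_sin_le_abs (x := (a - b) / 2)
  rw [abs_div, abs_of_pos (by norm_num : (0 : ℝ) < 2)] at h2
  have h3 := mul_le_mul h1 h2 (abs_nonneg _) (by positivity)
  rw [abs_neg, abs_of_pos (by norm_num : (0 : ℝ) < 2)]
  linarith

theorem abs_smoothCoeff_le_inv {e : ℝ} (he : 0 < e) (σ : ℝ) (n : ℕ) :
    |smoothCoeff e σ n| ≤ (n : ℝ)⁻¹ := by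
  rcases Nat.eq_zero_or_pos n with h1 | h1
  · simp [h1, smoothCoeff_zero]
  have hn : (0 : ℝ) < n := by exact_mod_cast h1
  have hpi := Real.pi_gt_three
  unfold smoothCoeff
  rw [abs_div, abs_of_pos (show 0 < Real.pi ^ 2 * (n : ℝ) ^ 2 * e by positivity)]
  have h := abs_cos_sub_cos_le' (2 * Real.pi * n * (σ + e)) (2 * Real.pi * n * σ)
  rw [show 2 * Real.pi * n * (σ + e) - 2 * Real.pi * n * σ = 2 * Real.pi * n * e by ring,
    abs_of_pos (show 0 < 2 * Real.pi * n * e by positivity)] at h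
  calc _ ≤ 2 * Real.pi * n * e / (Real.pi ^ 2 * (n : ℝ) ^ 2 * e) := by gcongr
    _ = (2 / Real.pi) * (n : ℝ)⁻¹ := by field_simp
    _ ≤ 1 * (n : ℝ)⁻¹ := by
      gcongr
      rw [div_le_one Real.pi_pos]; linarith
    _ = _ := one_mul _

/-- Both angles are small for small `n`, where the cosines differ to second order. With `|σ|` and
`e` of order `Y / Q`, this beats `1 / n` for `n < Q / Y`, which matters for moduli larger than `Y`.
-/
theorem abs_smoothCoeff_le {e : ℝ} (he : 0 < e) (σ : ℝ) (n : ℕ) :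
    |smoothCoeff e σ n| ≤ 4 * |σ| + 2 * e := by
  rcases Nat.eq_zero_or_pos n with h1 | h1
  · simp only [h1, smoothCoeff_zero, abs_zero]; positivity
  have hn : (0 : ℝ) < n := by exact_mod_cast h1
  have hpi := Real.pi_pos
  unfold smoothCoeff
  rw [abs_div, abs_of_pos (show 0 < Real.pi ^ 2 * (n : ℝ) ^ 2 * e by positivity)]
  have h := abs_cos_sub_cos_le (2 * Real.pi * n * (σ + e)) (2 * Real.pi * n * σ)
  rw [show 2 * Real.pi * n * (σ + e) - 2 * Real.pi * n * σ = 2 * Real.pi * n * e by ring,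
    show 2 * Real.pi * n * (σ + e) + 2 * Real.pi * n * σ = 2 * Real.pi * n * (2 * σ + e) by ring,
    abs_of_pos (show 0 < 2 * Real.pi * n * e by positivity), abs_mul,
    abs_of_pos (show 0 < 2 * Real.pi * n by positivity)] at h
  have h2 : |2 * σ + e| ≤ 2 * |σ| + e := by
    refine (abs_add_le _ _).trans ?_
    rw [abs_mul, abs_of_pos he, abs_of_pos (by norm_num : (0 : ℝ) < 2)]
  calc _ ≤ (2 * Real.pi * n * |2 * σ + e| * (2 * Real.pi * n * e) / 2)
        / (Real.pi ^ 2 * (n : ℝ) ^ 2 * e) := by gcongr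
    _ = 2 * |2 * σ + e| := by field_simp
    _ ≤ _ := by linarith

theorem abs_smoothSaw_sub_sum_le {e : ℝ} (he : 0 < e) (σ θ : ℝ) {H : ℕ} (hH : 0 < H) :
    |smoothSaw e σ θ - ∑ n ∈ Finset.range H, smoothCoeff e σ n * Real.cos (2 * Real.pi * n * θ)|
      ≤ 2 / (H * e) := by
  have hs := (hasSum_smoothSaw e σ θ).tendsto_sum_nat
  have hs2 := ((hs.sub_const (∑ n ∈ Finset.range H,
    smoothCoeff e σ n * Real.cos (2 * Real.pi * n * θ)))).abs
  refine le_of_tendsto hs2 ?_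
  filter_upwards [Filter.eventually_ge_atTop H] with N hN
  rw [← Finset.sum_Ico_eq_sub _ hN]
  refine (Finset.abs_sum_le_sum_abs _ _).trans ?_
  calc _ ≤ ∑ n ∈ Finset.Ico H N, ((n : ℝ) ^ 2)⁻¹ / e := by
        refine Finset.sum_le_sum fun n _ => ?_
        rw [abs_mul]
        refine (mul_le_of_le_one_right (abs_nonneg _) (Real.abs_cos_le_one _)).trans
          (abs_smoothCoeff_le_inv_sq he σ n)
    _ = (∑ n ∈ Finset.Ioo (H - 1) N, ((n : ℝ) ^ 2)⁻¹) / e := by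
        rw [Finset.sum_div]
        congr 1
        ext n; simp only [Finset.mem_Ico, Finset.mem_Ioo]; omega
    _ ≤ (2 / ((H - 1 : ℕ) + 1)) / e := by
        gcongr
        exact sum_Ioo_inv_sq_le _ _
    _ = 2 / (H * e) := by
        rw [Nat.cast_sub hH, div_div]; push_cast; ring_nf


/-! ### Sums of sawtooth functions over the fractions `ν / q` -/

/-- The index `j` divides `m`, and `m = h κ j²` then determines `h`, so representations inject into
the divisors of `m`. -/
theorem card_filter_mul_sq_le (κ J H M m : ℕ) (hκ : 0 < κ)
    (hM : ∀ n : ℕ, 0 < n → n ≤ 2 * H * κ * J ^ 2 → n.divisors.card ≤ M) :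
    (((Finset.Icc 1 J) ×ˢ (Finset.Ico H (2 * H))).filter
      fun i : ℕ × ℕ => i.2 * κ * i.1 ^ 2 = m).card ≤ M := by
  set F := ((Finset.Icc 1 J) ×ˢ (Finset.Ico H (2 * H))).filter
      fun i : ℕ × ℕ => i.2 * κ * i.1 ^ 2 = m with hF
  rcases F.eq_empty_or_nonempty with h | ⟨i, hi⟩
  · simp [h]
  have hmem : ∀ i ∈ F, 1 ≤ i.1 ∧ i.1 ≤ J ∧ H ≤ i.2 ∧ i.2 < 2 * H ∧ i.2 * κ * i.1 ^ 2 = m := by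
    intro i hi
    simp only [hF, Finset.mem_filter, Finset.mem_product, Finset.mem_Icc, Finset.mem_Ico] at hi
    tauto
  obtain ⟨h1, h2, h3, h4, h5⟩ := hmem i hi
  have hm0 : 0 < m := by
    rw [← h5]
    have : 0 < i.2 := by omega
    positivity
  have hm1 : m ≤ 2 * H * κ * J ^ 2 := by
    rw [← h5]; gcongr
  refine le_trans ?_ (hM m hm0 hm1)
  refine Finset.card_le_card_of_injOn Prod.fst (fun j hj => ?_) ?_
  · obtain ⟨_, _, _, _, k5⟩ := hmem j hj
    simp only [Finset.mem_coe, Nat.mem_divisors]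
    exact ⟨⟨j.2 * κ * j.1, by rw [← k5]; ring⟩, hm0.ne'⟩
  · intro j hj k hk hjk
    obtain ⟨j1, _, _, _, j5⟩ := hmem j hj
    obtain ⟨k1, _, _, _, k5⟩ := hmem k hk
    refine Prod.ext hjk ?_
    rw [← k5, ← hjk, mul_assoc, mul_assoc] at j5
    exact Nat.eq_of_mul_eq_mul_right (by positivity) j5

/-- The contribution of a dyadic block of frequencies. -/
theorem sq_sum_abs_block_le : ∃ C : ℝ, 0 < C ∧ ∀ (Q J κ H M : ℕ) (e S : ℝ) (σ : ℕ → ℝ),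
    0 < Q → 0 < κ → 0 < H → 0 < e → (∀ j, 4 * |σ j| + 2 * e ≤ S) →
    (∀ n : ℕ, 0 < n → n ≤ 2 * H * κ * J ^ 2 → n.divisors.card ≤ M) →
    (∑ v ∈ rootPairs Q, |∑ j ∈ Finset.Icc 1 J, ∑ h ∈ Finset.Ico H (2 * H),
      smoothCoeff e (σ j) h * Real.cos (2 * Real.pi * h * (κ * j ^ 2 * ((v.2 : ℝ) / v.1)))|) ^ 2
      ≤ C * Q * M * (Q * J * S + 2 * κ * J ^ 3) := by
  obtain ⟨C₁, hC₁, hls⟩ := large_sieve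
  obtain ⟨C₂, hC₂, hcard⟩ := card_rootPairs_le
  refine ⟨C₂ * C₁, by positivity, fun Q J κ H M e S σ hQ hκ hH he hS hM => ?_⟩
  set s := (Finset.Icc 1 J) ×ˢ (Finset.Ico H (2 * H)) with hs
  set β : ℕ × ℕ → ℂ := fun i => ((smoothCoeff e (σ i.1) i.2 : ℝ) : ℂ) with hβ
  set n : ℕ × ℕ → ℕ := fun i => i.2 * κ * i.1 ^ 2 with hn
  -- The summand `Q` ensures `Q ≤ L`, the other exceeds no less than every frequency.
  set L := Q + 2 * H * κ * J ^ 2 with hL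
  have hHR : (0 : ℝ) < H := by exact_mod_cast hH
  have hS0 : 0 ≤ S := le_trans (by positivity) (hS 0)
  have hpt : ∀ v : ℕ × ℕ, |∑ j ∈ Finset.Icc 1 J, ∑ h ∈ Finset.Ico H (2 * H),
      smoothCoeff e (σ j) h * Real.cos (2 * Real.pi * h * (κ * j ^ 2 * ((v.2 : ℝ) / v.1)))|
      ≤ ‖∑ i ∈ s, β i * expi (n i * ((v.2 : ℝ) / v.1))‖ := by
    intro v
    rw [← Finset.sum_product']
    refine le_trans (le_of_eq ?_) (Complex.abs_re_le_norm _)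
    rw [Complex.re_sum]
    congr 1
    refine Finset.sum_congr rfl fun i _ => ?_
    simp only [hβ, hn]
    rw [Complex.re_ofReal_mul, re_expi]
    push_cast
    congr 2; ring
  have hnL : ∀ i ∈ s, n i < L := by
    intro i hi
    simp only [hs, Finset.mem_product, Finset.mem_Icc, Finset.mem_Ico] at hi
    have : n i ≤ 2 * H * κ * J ^ 2 := by
      simp only [hn]
      have := hi.1.2
      have := hi.2.2
      gcongr
    omega
  have hsum := hls Q L M hQ (by omega) s n β hnL
    (fun m => card_filter_mul_sq_le κ J H M m hκ hM)
  have hβ1 : ∀ i ∈ s, ‖β i‖ ^ 2 ≤ S / H := by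
    intro i hi
    simp only [hs, Finset.mem_product, Finset.mem_Icc, Finset.mem_Ico] at hi
    simp only [hβ]
    rw [Complex.norm_real, Real.norm_eq_abs, sq, div_eq_mul_inv]
    have hHi : (H : ℝ) ≤ i.2 := by exact_mod_cast hi.2.1
    refine mul_le_mul ((abs_smoothCoeff_le he _ _).trans (hS _))
      ((abs_smoothCoeff_le_inv he _ _).trans ?_) (abs_nonneg _) hS0
    gcongr
  have hβ2 : ∀ i ∈ s, ‖β i‖ ^ 2 ≤ 1 / (H : ℝ) ^ 2 := by
    intro i hi
    simp only [hs, Finset.mem_product, Finset.mem_Icc, Finset.mem_Ico] at hi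
    simp only [hβ]
    rw [Complex.norm_real, Real.norm_eq_abs, one_div, ← inv_pow]
    have hHi : (H : ℝ) ≤ i.2 := by exact_mod_cast hi.2.1
    refine pow_le_pow_left₀ (abs_nonneg _) ((abs_smoothCoeff_le_inv he _ _).trans ?_) 2
    gcongr
  have hcs : (s.card : ℝ) = J * H := by
    simp only [hs, Finset.card_product, Nat.card_Icc, Nat.card_Ico]
    push_cast
    rw [Nat.cast_sub (by omega)]; push_cast; ring
  -- The bound `S / H` is used against the part `Q` of `L`, and `1 / H ^ 2` against the part `2 * H
  -- * κ * J ^ 2`. Either way the dependence on `H` disappears.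
  have hLs : (L : ℝ) * ∑ i ∈ s, ‖β i‖ ^ 2 ≤ Q * J * S + 2 * κ * J ^ 3 := by
    have b1 : ∑ i ∈ s, ‖β i‖ ^ 2 ≤ J * S := by
      refine (Finset.sum_le_card_nsmul s _ _ hβ1).trans (le_of_eq ?_)
      rw [nsmul_eq_mul, hcs]; field_simp
    have b2 : ∑ i ∈ s, ‖β i‖ ^ 2 ≤ J / H := by
      refine (Finset.sum_le_card_nsmul s _ _ hβ2).trans (le_of_eq ?_)
      rw [nsmul_eq_mul, hcs]; field_simp
    have e1 : (L : ℝ) = Q + 2 * H * κ * J ^ 2 := by rw [hL]; push_cast; ring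
    rw [e1, add_mul]
    refine add_le_add ?_ ?_
    · rw [mul_assoc]; gcongr
    · calc 2 * (H : ℝ) * κ * J ^ 2 * ∑ i ∈ s, ‖β i‖ ^ 2 ≤ 2 * (H : ℝ) * κ * J ^ 2 * (J / H) := by
            gcongr
        _ = _ := by field_simp
  calc _ ≤ (∑ v ∈ rootPairs Q, 1 * ‖∑ i ∈ s, β i * expi (n i * ((v.2 : ℝ) / v.1))‖) ^ 2 := by
        refine pow_le_pow_left₀ (Finset.sum_nonneg fun v _ => abs_nonneg _) ?_ 2
        exact Finset.sum_le_sum fun v _ => by rw [one_mul]; exact hpt v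
    _ ≤ (∑ v ∈ rootPairs Q, (1 : ℝ) ^ 2) *
          ∑ v ∈ rootPairs Q, ‖∑ i ∈ s, β i * expi (n i * ((v.2 : ℝ) / v.1))‖ ^ 2 :=
        Finset.sum_mul_sq_le_sq_mul_sq _ _ _
    _ ≤ (C₂ * Q) * (C₁ * M * L * ∑ i ∈ s, ‖β i‖ ^ 2) := by
        refine mul_le_mul ?_ hsum (Finset.sum_nonneg fun v _ => by positivity) (by positivity)
        simpa using hcard Q hQ
    _ = C₂ * C₁ * Q * M * (L * ∑ i ∈ s, ‖β i‖ ^ 2) := by ring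
    _ ≤ _ := by gcongr

theorem sum_range_two_pow_eq (f : ℕ → ℝ) (h0 : f 0 = 0) (I : ℕ) :
    ∑ h ∈ Finset.range (2 ^ I), f h
      = ∑ i ∈ Finset.range I, ∑ h ∈ Finset.Ico (2 ^ i) (2 * 2 ^ i), f h := by
  induction I with
  | zero => simp [h0]
  | succ I ih =>
    rw [Finset.sum_range_succ, ← ih, Finset.sum_range_add_sum_Ico]
    · congr 2; ring
    · omega

/-- The mean over the fractions `ν / q` of the smoothed sums. -/
theorem sum_abs_sum_smoothSaw_le : ∃ C : ℝ, 0 < C ∧ ∀ (Q J κ I M : ℕ) (e S : ℝ) (σ : ℕ → ℝ),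
    0 < Q → 0 < κ → 0 < e → (∀ j, 4 * |σ j| + 2 * e ≤ S) →
    (∀ n : ℕ, 0 < n → n ≤ 2 ^ I * κ * J ^ 2 → n.divisors.card ≤ M) →
    ∑ v ∈ rootPairs Q, |∑ j ∈ Finset.Icc 1 J, smoothSaw e (σ j) (κ * j ^ 2 * ((v.2 : ℝ) / v.1))|
      ≤ I * √(C * Q * M * (Q * J * S + 2 * κ * J ^ 3)) + C * Q * J / (2 ^ I * e) := by
  obtain ⟨C₁, hC₁, hblock⟩ := sq_sum_abs_block_le
  obtain ⟨C₂, hC₂, hcard⟩ := card_rootPairs_le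
  refine ⟨C₁ + 2 * C₂, by positivity, fun Q J κ I M e S σ hQ hκ he hS hM => ?_⟩
  have hS0 : 0 ≤ S := le_trans (by positivity) (hS 0)
  set f : ℕ × ℕ → ℕ → ℝ := fun v i => ∑ j ∈ Finset.Icc 1 J, ∑ h ∈ Finset.Ico (2 ^ i) (2 * 2 ^ i),
      smoothCoeff e (σ j) h * Real.cos (2 * Real.pi * h * (κ * j ^ 2 * ((v.2 : ℝ) / v.1))) with hf
  have hpt : ∀ v : ℕ × ℕ,
      |∑ j ∈ Finset.Icc 1 J, smoothSaw e (σ j) (κ * j ^ 2 * ((v.2 : ℝ) / v.1))|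
      ≤ ∑ i ∈ Finset.range I, |f v i| + J * (2 / (2 ^ I * e)) := by
    intro v
    have h1 : ∑ i ∈ Finset.range I, f v i = ∑ j ∈ Finset.Icc 1 J, ∑ h ∈ Finset.range (2 ^ I),
        smoothCoeff e (σ j) h * Real.cos (2 * Real.pi * h * (κ * j ^ 2 * ((v.2 : ℝ) / v.1))) := by
      simp only [hf]
      rw [Finset.sum_comm]
      refine Finset.sum_congr rfl fun j _ => ?_
      rw [sum_range_two_pow_eq _ (by rw [smoothCoeff_zero, zero_mul])]
    have h2 : |∑ j ∈ Finset.Icc 1 J, smoothSaw e (σ j) (κ * j ^ 2 * ((v.2 : ℝ) / v.1))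
        - ∑ i ∈ Finset.range I, f v i| ≤ J * (2 / (2 ^ I * e)) := by
      rw [h1, ← Finset.sum_sub_distrib]
      refine (Finset.abs_sum_le_sum_abs _ _).trans ?_
      refine (Finset.sum_le_card_nsmul _ _ (2 / (2 ^ I * e)) fun j _ => ?_).trans (le_of_eq ?_)
      · have := abs_smoothSaw_sub_sum_le he (σ j) (κ * j ^ 2 * ((v.2 : ℝ) / v.1))
          (show 0 < 2 ^ I by positivity)
        simpa using this
      · simp
    have h3 := Finset.abs_sum_le_sum_abs (f v) (Finset.range I)
    have h4 := abs_sub_abs_le_abs_sub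
      (∑ j ∈ Finset.Icc 1 J, smoothSaw e (σ j) (κ * j ^ 2 * ((v.2 : ℝ) / v.1)))
      (∑ i ∈ Finset.range I, f v i)
    linarith
  calc _ ≤ ∑ v ∈ rootPairs Q, (∑ i ∈ Finset.range I, |f v i| + J * (2 / (2 ^ I * e))) :=
        Finset.sum_le_sum fun v _ => hpt v
    _ = ∑ i ∈ Finset.range I, ∑ v ∈ rootPairs Q, |f v i|
          + (rootPairs Q).card * (J * (2 / (2 ^ I * e))) := by
        rw [Finset.sum_add_distrib, Finset.sum_comm, Finset.sum_const, nsmul_eq_mul]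
    _ ≤ ∑ i ∈ Finset.range I, √((C₁ + 2 * C₂) * Q * M * (Q * J * S + 2 * κ * J ^ 3))
          + (C₂ * Q) * (J * (2 / (2 ^ I * e))) := by
        refine add_le_add (Finset.sum_le_sum fun i hi => ?_) ?_
        · refine Real.le_sqrt_of_sq_le ?_
          have hi' := Finset.mem_range.mp hi
          refine (hblock Q J κ (2 ^ i) M e S σ hQ hκ (by positivity) he hS fun n hn hn' =>
            hM n hn (hn'.trans ?_)).trans ?_
          · have : 2 * 2 ^ i ≤ 2 ^ I := by
              rw [← pow_succ']; exact Nat.pow_le_pow_right (by norm_num) hi'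
            gcongr
          · gcongr; linarith
        · gcongr; exact hcard Q hQ
    _ ≤ _ := by
        rw [Finset.sum_const, Finset.card_range, nsmul_eq_mul]
        have : C₂ * Q * (J * (2 / (2 ^ I * e))) = 2 * C₂ * Q * J / (2 ^ I * e) := by ring
        rw [this]
        gcongr; linarith

/-- Equidistribution on average over the moduli `Q ≤ q < 2 * Q`, after a subdivision of the
moduli into `K` short intervals. -/
theorem sum_abs_sum_saw_le : ∃ C : ℝ, 0 < C ∧ ∀ (Q J κ I M K : ℕ) (Y : ℝ) (T : ℕ → ℝ),
    0 < Q → 0 < κ → 0 < K → 0 < Y → (∀ j, 0 ≤ T j) → (∀ j, T j ≤ Y) →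
    (Q : ℝ) ^ 2 * K ^ 3 ≤ 2 ^ I * Y ^ 2 →
    (∀ n : ℕ, 0 < n → n ≤ 2 ^ I * κ * J ^ 2 → n.divisors.card ≤ M) →
    ∑ v ∈ rootPairs Q, |∑ j ∈ Finset.Icc 1 J,
        (saw (T j / v.1 - κ * j ^ 2 * ((v.2 : ℝ) / v.1))
          + saw (T j / v.1 + κ * j ^ 2 * ((v.2 : ℝ) / v.1)))|
      ≤ C * (K * I * √(Q * M * (J * Y + κ * J ^ 3)) + J * Y / K) := by
  obtain ⟨C₁, hC₁, hsm⟩ := sum_abs_sum_smoothSaw_le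
  obtain ⟨C₂, hC₂, hcard⟩ := card_rootPairs_le
  refine ⟨2 * √(14 * C₁) + 2 * C₁ + 3 * C₂, by positivity,
    fun Q J κ I M K Y T hQ hκ hK hY hT0 hTY hI hM => ?_⟩
  have hQR : (0 : ℝ) < Q := by exact_mod_cast hQ
  have hKR : (0 : ℝ) < K := by exact_mod_cast hK
  have hK1 : (1 : ℝ) ≤ K := by exact_mod_cast hK
  -- This is the largest change of `T j / q` when `q` moves across one of the `K` subintervals.
  set e : ℝ := Y / (Q * K) with he
  have he0 : 0 < e := by positivity
  set q₀ : ℕ → ℝ := fun i => Q + i * (Q / K) with hq₀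
  have hq₀Q : ∀ i, (Q : ℝ) ≤ q₀ i := fun i => by
    simp only [hq₀]; have : (0 : ℝ) ≤ i * (Q / K) := by positivity
    linarith
  set U : (ℕ → ℝ) → ℕ × ℕ → ℝ := fun σ v =>
    ∑ j ∈ Finset.Icc 1 J, smoothSaw e (σ j) (κ * j ^ 2 * ((v.2 : ℝ) / v.1)) with hU
  set σ₁ : ℕ → ℕ → ℝ := fun i j => T j / q₀ i with hσ₁
  set σ₂ : ℕ → ℕ → ℝ := fun i j => T j / q₀ i - 2 * e with hσ₂
  -- pointwise comparison with the smoothed sums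
  have hpt : ∀ v ∈ rootPairs Q, |∑ j ∈ Finset.Icc 1 J,
        (saw (T j / v.1 - κ * j ^ 2 * ((v.2 : ℝ) / v.1))
          + saw (T j / v.1 + κ * j ^ 2 * ((v.2 : ℝ) / v.1)))|
      ≤ ∑ i ∈ Finset.range K, (|U (σ₁ i) v| + |U (σ₂ i) v|) + 3 * e * J := by
    intro v hv
    obtain ⟨v1, v2, v3, v4⟩ := mem_rootPairs.mp hv
    have v1R : (Q : ℝ) ≤ v.1 := by exact_mod_cast v1
    have v2R : (v.1 : ℝ) < 2 * Q := by exact_mod_cast v2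
    set i := ⌊((v.1 : ℝ) - Q) / (Q / K)⌋₊ with hi
    have i1 : (i : ℝ) * (Q / K) ≤ v.1 - Q := by
      rw [← le_div_iff₀ (by positivity)]
      exact Nat.floor_le (div_nonneg (by linarith) (by positivity))
    have i2 : (v.1 : ℝ) - Q < (i + 1) * (Q / K) := by
      rw [← div_lt_iff₀ (by positivity)]
      exact Nat.lt_floor_add_one _
    have iK : i < K := by
      have : (i : ℝ) * (Q / K) < K * (Q / K) := by
        have : (K : ℝ) * (Q / K) = Q := by field_simp
        linarith
      exact_mod_cast lt_of_mul_lt_mul_right this (by positivity)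
    have g1 : q₀ i ≤ v.1 := by simp only [hq₀]; linarith
    have g2 : (v.1 : ℝ) - q₀ i ≤ Q / K := by simp only [hq₀]; nlinarith
    have hq0 : 0 < q₀ i := lt_of_lt_of_le hQR (hq₀Q i)
    have hv0 : (0 : ℝ) < v.1 := by linarith
    set w : ℕ → ℝ := fun j => T j / q₀ i - T j / v.1 with hw
    have hw0 : ∀ j, 0 ≤ w j := fun j => by
      simp only [hw]; rw [sub_nonneg]
      exact div_le_div_of_nonneg_left (hT0 j) hq0 g1
    have hwe : ∀ j, w j ≤ e := fun j => by
      have : w j = T j * (v.1 - q₀ i) / (q₀ i * v.1) := by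
        simp only [hw]; field_simp
      rw [this, he]
      have h1 : T j * (v.1 - q₀ i) ≤ Y * (Q / K) :=
        mul_le_mul (hTY j) g2 (by linarith) hY.le
      have h2 : (Q : ℝ) * Q ≤ q₀ i * v.1 := mul_le_mul (hq₀Q i) v1R hQR.le hq0.le
      calc _ ≤ Y * (Q / K) / (Q * Q) :=
            div_le_div₀ (by positivity) h1 (by positivity) h2
        _ = _ := by field_simp
    have hlow : U (σ₁ i) v - 3 * e * J ≤ ∑ j ∈ Finset.Icc 1 J,
        (saw (T j / v.1 - κ * j ^ 2 * ((v.2 : ℝ) / v.1))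
          + saw (T j / v.1 + κ * j ^ 2 * ((v.2 : ℝ) / v.1))) := by
      have hc : 3 * e * J = ∑ j ∈ Finset.Icc 1 J, 3 * e := by simp; ring
      simp only [hU]
      rw [hc, ← Finset.sum_sub_distrib]
      refine Finset.sum_le_sum fun j _ => ?_
      have a1 := le_saw_sub (T j / q₀ i - κ * j ^ 2 * ((v.2 : ℝ) / v.1)) he0 (hw0 j) (hwe j)
      have a2 := le_saw_sub (T j / q₀ i + κ * j ^ 2 * ((v.2 : ℝ) / v.1)) he0 (hw0 j) (hwe j)
      rw [show T j / q₀ i - κ * j ^ 2 * ((v.2 : ℝ) / v.1) - w j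
        = T j / v.1 - κ * j ^ 2 * ((v.2 : ℝ) / v.1) by simp only [hw]; ring] at a1
      rw [show T j / q₀ i + κ * j ^ 2 * ((v.2 : ℝ) / v.1) - w j
        = T j / v.1 + κ * j ^ 2 * ((v.2 : ℝ) / v.1) by simp only [hw]; ring] at a2
      simp only [hσ₁, smoothSaw]
      linarith
    have hupp : ∑ j ∈ Finset.Icc 1 J,
        (saw (T j / v.1 - κ * j ^ 2 * ((v.2 : ℝ) / v.1))
          + saw (T j / v.1 + κ * j ^ 2 * ((v.2 : ℝ) / v.1))) ≤ U (σ₂ i) v + 3 * e * J := by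
      have hc : 3 * e * J = ∑ j ∈ Finset.Icc 1 J, 3 * e := by simp; ring
      simp only [hU]
      rw [hc, ← Finset.sum_add_distrib]
      refine Finset.sum_le_sum fun j _ => ?_
      have a1 := saw_sub_le (T j / q₀ i - κ * j ^ 2 * ((v.2 : ℝ) / v.1)) he0 (hw0 j) (hwe j)
      have a2 := saw_sub_le (T j / q₀ i + κ * j ^ 2 * ((v.2 : ℝ) / v.1)) he0 (hw0 j) (hwe j)
      rw [show T j / q₀ i - κ * j ^ 2 * ((v.2 : ℝ) / v.1) - w j
        = T j / v.1 - κ * j ^ 2 * ((v.2 : ℝ) / v.1) by simp only [hw]; ring,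
        show T j / q₀ i - κ * j ^ 2 * ((v.2 : ℝ) / v.1) - 2 * e
        = T j / q₀ i - 2 * e - κ * j ^ 2 * ((v.2 : ℝ) / v.1) by ring] at a1
      rw [show T j / q₀ i + κ * j ^ 2 * ((v.2 : ℝ) / v.1) - w j
        = T j / v.1 + κ * j ^ 2 * ((v.2 : ℝ) / v.1) by simp only [hw]; ring,
        show T j / q₀ i + κ * j ^ 2 * ((v.2 : ℝ) / v.1) - 2 * e
        = T j / q₀ i - 2 * e + κ * j ^ 2 * ((v.2 : ℝ) / v.1) by ring] at a2
      simp only [hσ₂, smoothSaw]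
      linarith
    -- The one relevant subinterval is replaced by the sum over all of them. This costs a factor
    -- `K`, but each phase `σ` is now independent of `v` and the average runs over all of `rootPairs
    -- Q`.
    have hsingle : |U (σ₁ i) v| + |U (σ₂ i) v|
        ≤ ∑ i ∈ Finset.range K, (|U (σ₁ i) v| + |U (σ₂ i) v|) :=
      Finset.single_le_sum (f := fun i => |U (σ₁ i) v| + |U (σ₂ i) v|)
        (fun i _ => by positivity) (Finset.mem_range.mpr iK)
    have b1 := neg_abs_le (U (σ₁ i) v)
    have b2 := le_abs_self (U (σ₂ i) v)
    have b3 := abs_nonneg (U (σ₁ i) v)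
    have b4 := abs_nonneg (U (σ₂ i) v)
    rw [abs_le]
    constructor <;> linarith
  -- the smoothed sums on average
  have hTq : ∀ i j, 0 ≤ T j / q₀ i ∧ T j / q₀ i ≤ Y / Q := fun i j =>
    ⟨div_nonneg (hT0 j) (hQR.le.trans (hq₀Q i)), div_le_div₀ hY.le (hTY j) hQR (hq₀Q i)⟩
  have heY : e ≤ Y / Q := by
    rw [he]; gcongr; nlinarith
  -- Both phases satisfy `|σ j| ≤ 3 Y / Q` and `e ≤ Y / Q`, and `4 * 3 + 2 = 14`.
  set S : ℝ := 14 * (Y / Q) with hS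
  set X := (√(14 * C₁)) * √(Q * M * (J * Y + κ * J ^ 3)) with hX
  have hJY : 0 ≤ (J : ℝ) * Y := by positivity
  have hroot : √(C₁ * Q * M * (Q * J * S + 2 * κ * J ^ 3)) ≤ X := by
    rw [hX, ← Real.sqrt_mul (by positivity)]
    refine Real.sqrt_le_sqrt ?_
    have : (Q : ℝ) * J * S = 14 * (J * Y) := by rw [hS]; field_simp
    rw [this]
    have h3 : 14 * (J * Y) + 2 * κ * (J : ℝ) ^ 3 ≤ 14 * (J * Y + κ * J ^ 3) := by
      have : (0 : ℝ) ≤ κ * (J : ℝ) ^ 3 := by positivity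
      linarith
    calc _ ≤ C₁ * Q * M * (14 * (J * Y + κ * J ^ 3)) := by gcongr
      _ = _ := by ring
  have htail : C₁ * Q * J / (2 ^ I * e) ≤ C₁ * (J * Y / K) / K := by
    rw [div_le_iff₀ (by positivity)]
    have : C₁ * (J * Y / K) / K * (2 ^ I * e) = (C₁ * J / (Q * K ^ 3)) * (2 ^ I * Y ^ 2) := by
      rw [he]; field_simp
    rw [this]
    calc C₁ * Q * J = (C₁ * J / (Q * K ^ 3)) * ((Q : ℝ) ^ 2 * K ^ 3) := by field_simp
      _ ≤ _ := by gcongr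
  have hav : ∀ σ : ℕ → ℝ, (∀ j, |σ j| ≤ 3 * (Y / Q)) →
      ∑ v ∈ rootPairs Q, |U σ v| ≤ I * X + C₁ * (J * Y / K) / K := by
    intro σ hσ
    refine (hsm Q J κ I M e S σ hQ hκ he0 (fun j => ?_) hM).trans ?_
    · have := hσ j; rw [hS]; linarith
    · gcongr
  have hav₁ : ∀ i, ∑ v ∈ rootPairs Q, |U (σ₁ i) v| ≤ I * X + C₁ * (J * Y / K) / K := fun i =>
    hav _ fun j => by
      have := hTq i j
      simp only [hσ₁]; rw [abs_le]; constructor <;> linarith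
  have hav₂ : ∀ i, ∑ v ∈ rootPairs Q, |U (σ₂ i) v| ≤ I * X + C₁ * (J * Y / K) / K := fun i =>
    hav _ fun j => by
      have := hTq i j
      simp only [hσ₂]; rw [abs_le]; constructor <;> linarith
  calc _ ≤ ∑ v ∈ rootPairs Q,
        (∑ i ∈ Finset.range K, (|U (σ₁ i) v| + |U (σ₂ i) v|) + 3 * e * J) :=
        Finset.sum_le_sum hpt
    _ = ∑ i ∈ Finset.range K, (∑ v ∈ rootPairs Q, |U (σ₁ i) v| + ∑ v ∈ rootPairs Q, |U (σ₂ i) v|)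
          + (rootPairs Q).card * (3 * e * J) := by
        rw [Finset.sum_add_distrib, Finset.sum_comm, Finset.sum_const, nsmul_eq_mul]
        simp only [Finset.sum_add_distrib]
    _ ≤ ∑ i ∈ Finset.range K, ((I * X + C₁ * (J * Y / K) / K) + (I * X + C₁ * (J * Y / K) / K))
          + (C₂ * Q) * (3 * e * J) := by
        refine add_le_add (Finset.sum_le_sum fun i _ => add_le_add (hav₁ i) (hav₂ i)) ?_
        gcongr
        exact hcard Q hQ
    _ = 2 * √(14 * C₁) * (K * I * √(Q * M * (J * Y + κ * J ^ 3)))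
          + (2 * C₁ + 3 * C₂) * (J * Y / K) := by
        rw [Finset.sum_const, Finset.card_range, nsmul_eq_mul, hX, he]
        field_simp
        ring
    _ ≤ _ := by
        have t1 : 0 ≤ (K : ℝ) * I * √(Q * M * (J * Y + κ * J ^ 3)) := by positivity
        have t2 : 0 ≤ (J : ℝ) * Y / K := by positivity
        have t3 : 0 ≤ 2 * √(14 * C₁) := by positivity
        nlinarith


/-! ### Local densities -/

/-- The number of roots `ν` of `ν ^ 2 + 1` modulo `q` with `a ≡ ν b` modulo `q`. -/
noncomputable def rootCount (q : ℕ) (a b : ℤ) : ℕ :=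
  Nat.card {ν : ZMod q // ν ^ 2 + 1 = 0 ∧ (a : ZMod q) = ν * b}

theorem rootCount_mul {q r : ℕ} (h : q.Coprime r) (a b : ℤ) :
    rootCount (q * r) a b = rootCount q a b * rootCount r a b := by
  unfold rootCount
  rw [← Nat.card_prod]
  refine Nat.card_congr ((Equiv.subtypeEquiv (ZMod.chineseRemainder h).toEquiv ?_).trans
    Equiv.subtypeProdEquivProd)
  intro ν
  set f := ZMod.chineseRemainder h
  have h1 : (ν ^ 2 + 1 = 0) ↔ ((f ν).1 ^ 2 + 1 = 0 ∧ (f ν).2 ^ 2 + 1 = 0) := by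
    rw [← map_eq_zero_iff f f.injective]
    simp [Prod.ext_iff]
  have h2 : ((a : ZMod (q * r)) = ν * b) ↔
      ((a : ZMod q) = (f ν).1 * b ∧ (a : ZMod r) = (f ν).2 * b) := by
    rw [← f.injective.eq_iff]
    simp [Prod.ext_iff]
  change _ ↔ (((f ν).1 ^ 2 + 1 = 0 ∧ (a : ZMod q) = (f ν).1 * b) ∧
    ((f ν).2 ^ 2 + 1 = 0 ∧ (a : ZMod r) = (f ν).2 * b))
  rw [h1, h2]; tauto

theorem rootCount_of_dvd {q : ℕ} {b : ℤ} (hb : (q : ℤ) ∣ b) (a : ℤ) :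
    rootCount q a b = if (q : ℤ) ∣ a then rho q else 0 := by
  have hb' : (b : ZMod q) = 0 := (ZMod.intCast_zmod_eq_zero_iff_dvd b q).mpr hb
  have ha' : (a : ZMod q) = 0 ↔ (q : ℤ) ∣ a := ZMod.intCast_zmod_eq_zero_iff_dvd a q
  unfold rootCount rho
  split_ifs with h
  · exact Nat.card_congr (Equiv.subtypeEquivRight fun ν => by
      rw [hb', mul_zero, ha'.mpr h]; simp)
  · have : IsEmpty {ν : ZMod q // ν ^ 2 + 1 = 0 ∧ (a : ZMod q) = ν * b} := by
      refine ⟨fun ⟨ν, _, h2⟩ => h (ha'.mp ?_)⟩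
      rw [h2, hb', mul_zero]
    exact Nat.card_of_isEmpty

theorem rho_eq_rootCount (q : ℕ) : rho q = rootCount q 0 0 := by
  rw [rootCount_of_dvd (dvd_zero _), if_pos (dvd_zero _)]

theorem rho_mul {q r : ℕ} (h : q.Coprime r) : rho (q * r) = rho q * rho r := by
  simp only [rho_eq_rootCount, rootCount_mul h]

/-- The only candidate is `ν = a c⁻²`, which is a root of `ν² + 1` exactly when `a² + c⁴` vanishes
modulo `q`. -/
theorem rootCount_of_isCoprime {q : ℕ} {c : ℤ} (hc : IsCoprime c (q : ℤ)) (a : ℤ) :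
    rootCount q a (c ^ 2) = if (q : ℤ) ∣ a ^ 2 + c ^ 4 then 1 else 0 := by
  obtain ⟨x, y, hxy⟩ := hc
  have hx : (x : ZMod q) * c = 1 := by
    have := congrArg (Int.cast : ℤ → ZMod q) hxy
    simpa using this
  have hdvd : (q : ℤ) ∣ a ^ 2 + c ^ 4 ↔ ((a : ZMod q) ^ 2 + c ^ 4 = 0) := by
    rw [← ZMod.intCast_zmod_eq_zero_iff_dvd]; push_cast; rfl
  unfold rootCount
  split_ifs with h
  · rw [hdvd] at h
    have : Unique {ν : ZMod q // ν ^ 2 + 1 = 0 ∧ (a : ZMod q) = ν * ((c ^ 2 : ℤ) : ZMod q)} := by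
      refine ⟨⟨⟨a * x ^ 2, ?_, ?_⟩⟩, ?_⟩
      · have e : (c : ZMod q) ^ 4 * x ^ 4 = 1 := by
          rw [← mul_pow, mul_comm, hx, one_pow]
        linear_combination (x : ZMod q) ^ 4 * h - e
      · push_cast
        linear_combination (-(a : ZMod q)) * (x * c + 1) * hx
      · rintro ⟨ν, h1, h2⟩
        refine Subtype.ext ?_
        change ν = a * x ^ 2
        push_cast at h2
        rw [h2]
        linear_combination (-ν) * (x * c + 1) * hx
    exact Nat.card_unique
  · have : IsEmpty {ν : ZMod q // ν ^ 2 + 1 = 0 ∧ (a : ZMod q) = ν * ((c ^ 2 : ℤ) : ZMod q)} := by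
      refine ⟨fun ⟨ν, h1, h2⟩ => h (hdvd.mpr ?_)⟩
      push_cast at h2
      rw [h2]; linear_combination (c : ZMod q) ^ 4 * h1
    exact Nat.card_of_isEmpty

theorem rho_one : rho 1 = 1 := by
  unfold rho
  have : Unique {α : ZMod 1 // α ^ 2 + 1 = 0} :=
    ⟨⟨⟨0, Subsingleton.elim _ _⟩⟩, fun a => Subtype.ext (Subsingleton.elim _ _)⟩
  exact Nat.card_unique

theorem rootCount_one (a b : ℤ) : rootCount 1 a b = 1 := by
  rw [rootCount_of_dvd (by simp), if_pos (by simp), rho_one]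

theorem rho_two : rho 2 = 1 := by
  unfold rho
  rw [Nat.card_eq_fintype_card]; decide

theorem rho_four : rho (2 ^ 2) = 0 := by
  unfold rho
  rw [Nat.card_eq_fintype_card]; decide

theorem rho_prime {p : ℕ} (hp : p.Prime) : (rho p : ℤ) = 1 + ZMod.χ₄ (p : ZMod 4) := by
  have := Fact.mk hp
  rcases eq_or_ne p 2 with rfl | h2
  · rw [rho_two]; decide
  · have h := legendreSym.card_sqrts p h2 (-1)
    rw [legendreSym.at_neg_one h2] at h
    rw [add_comm, ← h]
    unfold rho
    rw [Nat.card_eq_fintype_card, Set.toFinset_card]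
    refine congrArg Nat.cast (Fintype.card_congr (Equiv.subtypeEquivRight fun ν => ?_))
    simp only [Set.mem_ofPred_eq, Int.cast_neg, Int.cast_one]
    exact ⟨fun h => by linear_combination h, fun h => by linear_combination h⟩

theorem rho_prime_le {p : ℕ} (hp : p.Prime) : rho p ≤ 2 := by
  have h := rho_prime hp
  have : ∀ z : ZMod 4, ZMod.χ₄ z ≤ 1 := by decide
  have := this p
  omega

/-- Hensel lifting: a root `z` modulo an odd `p` has `2 z ≠ 0`, so reduction is a bijection on
roots. For `p = 2` it fails, as `ρ(4) = 0`. -/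
theorem rho_prime_sq {p : ℕ} (hp : p.Prime) (h2 : p ≠ 2) : rho (p ^ 2) = rho p := by
  have := Fact.mk hp
  have hp0 : NeZero (p ^ 2) := ⟨pow_ne_zero _ hp.ne_zero⟩
  set f := ZMod.castHom (dvd_pow_self p two_ne_zero) (ZMod p) with hf
  have hval : ∀ x : ZMod (p ^ 2), f x = (x.val : ZMod p) := by
    intro x
    conv_lhs => rw [← ZMod.natCast_zmod_val x]
    rw [map_natCast]
  have hunit : ∀ x : ZMod (p ^ 2), f x ≠ 0 → IsUnit x := by
    intro x hx
    rw [hval, Ne, ZMod.natCast_eq_zero_iff] at hx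
    rw [← ZMod.natCast_zmod_val x, ZMod.isUnit_iff_coprime]
    exact Nat.Coprime.pow_right _ ((Nat.Prime.coprime_iff_not_dvd hp).mpr hx).symm
  have hker : ∀ x : ZMod (p ^ 2), f x = 0 → x ^ 2 = 0 := by
    intro x hx
    rw [hval, ZMod.natCast_eq_zero_iff] at hx
    rw [← ZMod.natCast_zmod_val x, ← Nat.cast_pow, ZMod.natCast_eq_zero_iff]
    exact pow_dvd_pow_of_dvd hx 2
  have htwo : (2 : ZMod p) ≠ 0 := by
    have : ((2 : ℕ) : ZMod p) ≠ 0 := by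
      rw [Ne, ZMod.natCast_eq_zero_iff]
      intro h; exact h2 ((Nat.prime_dvd_prime_iff_eq hp Nat.prime_two).mp h)
    exact_mod_cast this
  have hroot : ∀ z : ZMod p, z ^ 2 + 1 = 0 → 2 * z ≠ 0 := by
    intro z hz h
    rcases mul_eq_zero.mp h with h | h
    · exact htwo h
    · rw [h] at hz; simp at hz
  unfold rho
  refine Nat.card_congr (Equiv.ofBijective
    (fun ν : {α : ZMod (p ^ 2) // α ^ 2 + 1 = 0} => (⟨f ν.1, by
      rw [← map_pow, ← map_one f, ← map_add, ν.2, map_zero]⟩ : {α : ZMod p // α ^ 2 + 1 = 0}))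
    ⟨?_, ?_⟩)
  · rintro ⟨x, hx⟩ ⟨y, hy⟩ h
    have hxy : f x = f y := congrArg Subtype.val h
    have hfy : (f y) ^ 2 + 1 = 0 := by rw [← map_pow, ← map_one f, ← map_add, hy, map_zero]
    have hu : IsUnit (x + y) := hunit _ (by
      rw [map_add, hxy, ← two_mul]; exact hroot _ hfy)
    refine Subtype.ext ?_
    have : (x + y) * (x - y) = 0 := by linear_combination hx - hy
    rw [hu.mul_right_eq_zero] at this
    exact sub_eq_zero.mp this
  · rintro ⟨z, hz⟩
    obtain ⟨x, rfl⟩ := ZMod.castHom_surjective (dvd_pow_self p two_ne_zero) z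
    obtain ⟨w, hw⟩ := (hunit (2 * x) (by rw [map_mul, map_ofNat]; exact hroot _ hz))
    have hfx : f (x ^ 2 + 1) = 0 := by rw [map_add, map_pow, map_one]; exact hz
    obtain ⟨w', hw'⟩ : ∃ w' : ZMod (p ^ 2), 2 * x * w' = 1 :=
      ⟨((w⁻¹ : (ZMod (p ^ 2))ˣ) : ZMod (p ^ 2)), by rw [← hw]; exact w.mul_inv⟩
    -- The Newton correction: `t` lies in the kernel of reduction, so `t ^ 2 = 0` and `(x - t) ^ 2 +
    -- 1 = 0`.
    set t : ZMod (p ^ 2) := (x ^ 2 + 1) * w' with ht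
    have hft : f t = 0 := by rw [ht, map_mul, hfx, zero_mul]
    have hwt : 2 * x * t = x ^ 2 + 1 := by
      rw [ht]
      linear_combination (x ^ 2 + 1) * hw'
    refine ⟨⟨x - t, ?_⟩, Subtype.ext ?_⟩
    · linear_combination hker t hft - hwt
    · change f (x - t) = f x
      rw [map_sub, hft, sub_zero]

theorem rho_prime_sq_le {p : ℕ} (hp : p.Prime) : rho (p ^ 2) ≤ 2 := by
  rcases eq_or_ne p 2 with rfl | h2
  · rw [rho_four]; norm_num
  · rw [rho_prime_sq hp h2]; exact rho_prime_le hp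

theorem density_one : density 1 = 1 := by simp [density]

theorem density_mul {a b : ℕ} (h : a.Coprime b) : density (a * b) = density a * density b := by
  unfold density
  rw [Nat.factorization_mul_of_coprime h, Finsupp.prod_add_index_of_disjoint]
  simpa using h.disjoint_primeFactors

theorem density_prime_pow {p k : ℕ} (hp : p.Prime) :
    density (p ^ k) = densityPrimePow p k := by
  unfold density
  rw [hp.factorization_pow, Finsupp.prod_single_index (by simp [densityPrimePow])]

theorem density_prime {p : ℕ} (hp : p.Prime) :
    density p = rho p / p + (1 - rho p) / (p * p) := by
  have h := density_prime_pow (k := 1) hp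
  rw [pow_one] at h
  have hr : ((rho p : ℤ) : ℝ) = ((1 + ZMod.χ₄ (p : ZMod 4) : ℤ) : ℝ) := by rw [rho_prime hp]
  push_cast at hr
  have : (p : ℝ) ≠ 0 := by exact_mod_cast hp.ne_zero
  rw [h, hr]
  simp only [densityPrimePow, one_ne_zero, if_false, if_true]
  field_simp
  ring

/-- The three summands are the weights of the three pieces in `hasExpansion_prime_sq`. Written with
`ρ(p²)`, the formula includes `p = 2`, where `ρ(4) = 0` leaves `1 / 4`. -/
theorem density_prime_sq {p : ℕ} (hp : p.Prime) :
    density (p ^ 2) = rho (p ^ 2) / (p : ℝ) ^ 2 + 1 / (p * p) - rho (p ^ 2) / (p * (p : ℝ) ^ 2) := by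
  rw [density_prime_pow hp]
  simp only [densityPrimePow, two_ne_zero, if_false, OfNat.ofNat_ne_one, if_true]
  split_ifs with h
  · subst h
    rw [rho_four]; norm_num
  · have : (p : ℝ) ≠ 0 := by exact_mod_cast hp.ne_zero
    rw [rho_prime_sq hp h]
    field_simp
    ring

/-- Induction over the coprime prime power factors of a cubefree number. -/
theorem cubefree_induction {P : ℕ → Prop} (one : P 1) (prime : ∀ p : ℕ, p.Prime → P p)
    (sq : ∀ p : ℕ, p.Prime → P (p ^ 2))
    (mul : ∀ a b : ℕ, 0 < a → 0 < b → a.Coprime b → P a → P b → P (a * b)) (d : ℕ) :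
    0 < d → Cubefree d → P d := by
  induction d using Nat.recOnPosPrimePosCoprime with
  | prime_pow p n hp hn =>
    intro _ hc
    have : n < 3 := by
      by_contra h
      exact hc p hp (pow_dvd_pow p (not_lt.mp h))
    interval_cases n
    · simpa using prime p hp
    · exact sq p hp
  | zero => intro h; exact absurd h (lt_irrefl 0)
  | one => intro _ _; exact one
  | coprime a b ha hb hab iha ihb =>
    intro _ hc
    exact mul a b (by omega) (by omega) hab
      (iha (by omega) fun p hp h => hc p hp (h.mul_right b))
      (ihb (by omega) fun p hp h => hc p hp (h.mul_left a))

theorem card_divisors_prime_sq {p : ℕ} (hp : p.Prime) : (p ^ 2).divisors.card = 3 := by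
  rw [Nat.divisors_prime_pow hp]; simp

theorem card_divisors_prime {p : ℕ} (hp : p.Prime) : p.divisors.card = 2 := by
  have := Nat.divisors_prime_pow hp 1
  rw [pow_one] at this
  rw [this]; simp

theorem abs_density_le {d : ℕ} (hd : 0 < d) (hc : Cubefree d) :
    |density d| ≤ d.divisors.card / d := by
  refine cubefree_induction (P := fun d => |density d| ≤ d.divisors.card / d) ?_ ?_ ?_ ?_ d hd hc
  · simp [density_one]
  · intro p hp
    have hp2 : (2 : ℝ) ≤ p := by exact_mod_cast hp.two_le
    have hr : (rho p : ℝ) ≤ 2 := by exact_mod_cast rho_prime_le hp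
    have hr0 : (0 : ℝ) ≤ rho p := by positivity
    have e : density p = (rho p + (1 - rho p) / p) / p := by
      rw [density_prime hp]; field_simp
    have h1 : (1 - (rho p : ℝ)) / p ≤ 1 / p := by gcongr; linarith
    have h2 : (1 - (rho p : ℝ)) / p = 1 / p - rho p * (1 / p) := by ring
    have h3 : 1 / (p : ℝ) ≤ 1 / 2 := by gcongr
    have h4 : 0 < 1 / (p : ℝ) := by positivity
    rw [e, card_divisors_prime hp, abs_div, abs_of_pos (by linarith : (0 : ℝ) < p)]
    gcongr
    rw [abs_le, h2]
    push_cast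
    constructor <;> nlinarith
  · intro p hp
    have hp2 : (2 : ℝ) ≤ p := by exact_mod_cast hp.two_le
    have hr : (rho (p ^ 2) : ℝ) ≤ 2 := by exact_mod_cast rho_prime_sq_le hp
    have hr0 : (0 : ℝ) ≤ rho (p ^ 2) := by positivity
    have e : density (p ^ 2) = (rho (p ^ 2) + 1 - rho (p ^ 2) * (1 / p)) / ((p ^ 2 : ℕ) : ℝ) := by
      rw [density_prime_sq hp]; push_cast; field_simp
    have h3 : 1 / (p : ℝ) ≤ 1 / 2 := by gcongr
    have h4 : 0 < 1 / (p : ℝ) := by positivity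
    rw [e, card_divisors_prime_sq hp, abs_div, Nat.abs_cast]
    gcongr
    rw [abs_le]
    push_cast
    constructor <;> nlinarith
  · intro a b ha hb hab iha ihb
    rw [density_mul hab, abs_mul, hab.card_divisors_mul]
    push_cast
    calc |density a| * |density b| ≤ (a.divisors.card / a) * (b.divisors.card / b) := by gcongr
      _ = _ := by field_simp

/-! ### Expansion of the divisibility condition into residue classes -/

/-- The indicator of a proposition, as a real number. -/
noncomputable def ind (P : Prop) : ℝ := open Classical in if P then 1 else 0

theorem ind_true {P : Prop} (h : P) : ind P = 1 := by simp [ind, h]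

theorem ind_false {P : Prop} (h : ¬ P) : ind P = 0 := by simp [ind, h]

theorem ind_mul (P P' : Prop) : ind P * ind P' = ind (P ∧ P') := by
  by_cases h : P <;> by_cases h' : P' <;> simp [ind, h, h']

theorem ind_mul_dvd {a b : ℕ} (h : a.Coprime b) (z : ℤ) :
    ind (((a * b : ℕ) : ℤ) ∣ z) = ind ((a : ℤ) ∣ z) * ind ((b : ℤ) ∣ z) := by
  rw [ind_mul]
  congr 1
  rw [eq_iff_iff]
  push_cast
  exact ⟨fun h => ⟨(dvd_mul_right _ _).trans h, (dvd_mul_left _ _).trans h⟩,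
    fun h' => (Nat.isCoprime_iff_coprime.mpr h).mul_dvd h'.1 h'.2⟩

/-- A decomposition of the condition `d ∣ a ^ 2 + c ^ 4` into conditions `k ∣ c`, `u ∣ a` and
`a ≡ ν c ^ 2` modulo `q`, together with the matching decomposition of `density d`. -/
def HasExpansion (d : ℕ) : Prop :=
  ∃ (ι : Type) (_ : Fintype ι) (lam : ι → ℝ) (k u m q : ι → ℕ),
    (∀ i, m i * q i = d ∧ (m i).Coprime (q i) ∧ k i ∣ u i ∧ u i ∣ m i ∧ m i ∣ k i ^ 2 ∧
      |lam i| ≤ d.divisors.card) ∧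
    Fintype.card ι ≤ d.divisors.card ∧
    (∀ a c : ℤ, ind ((d : ℤ) ∣ a ^ 2 + c ^ 4) = ∑ i, lam i *
      (ind ((k i : ℤ) ∣ c) * ind ((u i : ℤ) ∣ a) * rootCount (q i) a (c ^ 2))) ∧
    density d = ∑ i, lam i * (rho (q i) / (k i * u i * q i))

theorem hasExpansion_one : HasExpansion 1 := by
  refine ⟨Unit, inferInstance, fun _ => 1, fun _ => 1, fun _ => 1, fun _ => 1, fun _ => 1,
    fun _ => by simp, by simp, fun a c => ?_, by simp [density_one, rho_one]⟩
  simp [ind, rootCount_one]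

/-- For `p ∤ c` the root count is already the indicator. For `p ∣ c` it equals `ρ(p)` when `p ∣ a`
and `0` otherwise, so the weight `1 - ρ(p)` on `p ∣ c, p ∣ a` repairs it. -/
theorem hasExpansion_prime {p : ℕ} (hp : p.Prime) : HasExpansion p := by
  have hr : (rho p : ℝ) ≤ 2 := by exact_mod_cast rho_prime_le hp
  have hr0 : (0 : ℝ) ≤ rho p := by positivity
  refine ⟨Fin 2, inferInstance, ![1, 1 - rho p], ![1, p], ![1, p], ![1, p], ![p, 1], ?_, ?_, ?_, ?_⟩
  · rw [Fin.forall_fin_two]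
    simp only [card_divisors_prime hp]
    refine ⟨by simp, by simp, by simp, by simp, by simp, ?_, ?_⟩
    · exact dvd_pow_self p two_ne_zero
    · simp only [Matrix.cons_val_one, Matrix.cons_val_fin_one]
      rw [abs_le]; push_cast; constructor <;> linarith
  · simp [card_divisors_prime hp]
  · intro a c
    simp only [Fin.sum_univ_two, Matrix.cons_val_zero, Matrix.cons_val_one, Matrix.cons_val_fin_one,
      rootCount_one, Nat.cast_one, ind_true (one_dvd _), one_mul, mul_one]
    by_cases hc : (p : ℤ) ∣ c
    · have e : (p : ℤ) ∣ a ^ 2 + c ^ 4 ↔ (p : ℤ) ∣ a := by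
        rw [dvd_add_left (dvd_pow hc (by norm_num))]
        exact (Nat.prime_iff_prime_int.mp hp).dvd_pow_iff_dvd two_ne_zero
      rw [rootCount_of_dvd (dvd_pow hc two_ne_zero), e, ind_true hc]
      by_cases ha : (p : ℤ) ∣ a
      · simp [ind, ha]
      · simp [ind, ha]
    · have hco : IsCoprime c (p : ℤ) :=
        ((Nat.prime_iff_prime_int.mp hp).coprime_iff_not_dvd.mpr hc).symm
      rw [rootCount_of_isCoprime hco, ind_false hc]
      by_cases h : (p : ℤ) ∣ a ^ 2 + c ^ 4 <;> simp [ind, h]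
  · simp only [Fin.sum_univ_two, Matrix.cons_val_zero, Matrix.cons_val_one, Matrix.cons_val_fin_one,
      rho_one, Nat.cast_one, one_mul, mul_one, density_prime hp]
    ring

/-- For `p ∣ c` divisibility by `p²` just means `p ∣ a`, which the second piece detects. The third
removes the `ρ(p²)` roots counted by the first when `p² ∣ a`. -/
theorem hasExpansion_prime_sq {p : ℕ} (hp : p.Prime) : HasExpansion (p ^ 2) := by
  have hr : (rho (p ^ 2) : ℝ) ≤ 2 := by exact_mod_cast rho_prime_sq_le hp
  have hr0 : (0 : ℝ) ≤ rho (p ^ 2) := by positivity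
  have hpZ := Nat.prime_iff_prime_int.mp hp
  refine ⟨Fin 3, inferInstance, ![1, 1, -rho (p ^ 2)], ![1, p, p], ![1, p, p ^ 2],
    ![1, p ^ 2, p ^ 2], ![p ^ 2, 1, 1], ?_, ?_, ?_, ?_⟩
  · rw [card_divisors_prime_sq hp]
    intro i
    have h1 : p ∣ p ^ 2 := dvd_pow_self p two_ne_zero
    fin_cases i
    · simp
    · simp
    · simp only [Fin.reduceFinMk, Matrix.cons_val]
      refine ⟨by simp, by simp, h1, dvd_rfl, dvd_rfl, ?_⟩
      rw [abs_neg, abs_of_nonneg hr0]; push_cast; linarith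
  · simp [card_divisors_prime_sq hp]
  · intro a c
    simp only [Fin.sum_univ_three, Matrix.cons_val,
      rootCount_one, Nat.cast_one, ind_true (one_dvd _), one_mul, mul_one]
    by_cases hc : (p : ℤ) ∣ c
    · have hc2 : ((p ^ 2 : ℕ) : ℤ) ∣ c ^ 2 := by push_cast; exact pow_dvd_pow_of_dvd hc 2
      have e : ((p ^ 2 : ℕ) : ℤ) ∣ a ^ 2 + c ^ 4 ↔ (p : ℤ) ∣ a := by
        rw [dvd_add_left (hc2.trans (pow_dvd_pow c (by norm_num)))]
        push_cast
        exact Int.pow_dvd_pow_iff two_ne_zero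
      rw [rootCount_of_dvd hc2, e, ind_true hc]
      by_cases ha : ((p ^ 2 : ℕ) : ℤ) ∣ a
      · simp only [if_pos ha, ind_true ha]; ring
      · simp only [if_neg ha, ind_false ha]; push_cast; ring
    · have hco : IsCoprime c ((p ^ 2 : ℕ) : ℤ) := by
        push_cast
        exact ((hpZ.coprime_iff_not_dvd.mpr hc).symm).pow_right
      rw [rootCount_of_isCoprime hco, ind_false hc]
      by_cases h : ((p ^ 2 : ℕ) : ℤ) ∣ a ^ 2 + c ^ 4
      · rw [if_pos h, ind_true h]; push_cast; ring
      · rw [if_neg h, ind_false h]; push_cast; ring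
  · simp only [Fin.sum_univ_three, Matrix.cons_val,
      rho_one, Nat.cast_one, one_mul, mul_one, density_prime_sq hp]
    push_cast
    ring

theorem HasExpansion.mul {d e : ℕ} (hde : d.Coprime e) (hd : HasExpansion d)
    (he : HasExpansion e) : HasExpansion (d * e) := by
  obtain ⟨ι, _, lam, k, u, m, q, h1, h2, h3, h4⟩ := hd
  obtain ⟨ι', _, lam', k', u', m', q', h1', h2', h3', h4'⟩ := he
  have md : ∀ i, m i ∣ d := fun i => (h1 i).1 ▸ dvd_mul_right _ _
  have qd : ∀ i, q i ∣ d := fun i => (h1 i).1 ▸ dvd_mul_left _ _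
  have ud : ∀ i, u i ∣ d := fun i => (h1 i).2.2.2.1.trans (md i)
  have kd : ∀ i, k i ∣ d := fun i => (h1 i).2.2.1.trans (ud i)
  have me : ∀ i, m' i ∣ e := fun i => (h1' i).1 ▸ dvd_mul_right _ _
  have qe : ∀ i, q' i ∣ e := fun i => (h1' i).1 ▸ dvd_mul_left _ _
  have ue : ∀ i, u' i ∣ e := fun i => (h1' i).2.2.2.1.trans (me i)
  have ke : ∀ i, k' i ∣ e := fun i => (h1' i).2.2.1.trans (ue i)
  have cop : ∀ {x y : ℕ}, x ∣ d → y ∣ e → x.Coprime y := fun hx hy =>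
    (hde.coprime_dvd_left hx).coprime_dvd_right hy
  refine ⟨ι × ι', inferInstance, fun i => lam i.1 * lam' i.2, fun i => k i.1 * k' i.2,
    fun i => u i.1 * u' i.2, fun i => m i.1 * m' i.2, fun i => q i.1 * q' i.2, ?_, ?_, ?_, ?_⟩
  · rintro ⟨i, j⟩
    obtain ⟨a1, a2, a3, a4, a5, a6⟩ := h1 i
    obtain ⟨b1, b2, b3, b4, b5, b6⟩ := h1' j
    refine ⟨by simp only; rw [← a1, ← b1]; ring, ?_, mul_dvd_mul a3 b3, mul_dvd_mul a4 b4, ?_, ?_⟩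
    · exact Nat.Coprime.mul_left (Nat.Coprime.mul_right a2 (cop (md i) (qe j)))
        (Nat.Coprime.mul_right (cop (qd i) (me j)).symm b2)
    · simp only [mul_pow]; exact mul_dvd_mul a5 b5
    · rw [hde.card_divisors_mul, abs_mul]; push_cast
      exact mul_le_mul a6 b6 (abs_nonneg _) (by positivity)
  · rw [Fintype.card_prod, hde.card_divisors_mul]
    exact Nat.mul_le_mul h2 h2'
  · intro a c
    rw [ind_mul_dvd hde, h3, h3', Finset.sum_mul_sum, Fintype.sum_prod_type]
    refine Finset.sum_congr rfl fun i _ => Finset.sum_congr rfl fun j _ => ?_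
    simp only
    rw [ind_mul_dvd (cop (kd i) (ke j)), ind_mul_dvd (cop (ud i) (ue j)),
      rootCount_mul (cop (qd i) (qe j))]
    push_cast; ring
  · rw [density_mul hde, h4, h4', Finset.sum_mul_sum, Fintype.sum_prod_type]
    refine Finset.sum_congr rfl fun i _ => Finset.sum_congr rfl fun j _ => ?_
    simp only
    rw [rho_mul (cop (qd i) (qe j))]
    push_cast
    rw [mul_mul_mul_comm, div_mul_div_comm]
    congr 2; ring

theorem hasExpansion {d : ℕ} (hd : 0 < d) (hc : Cubefree d) : HasExpansion d :=
  cubefree_induction hasExpansion_one (fun _ hp => hasExpansion_prime hp)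
    (fun _ hp => hasExpansion_prime_sq hp) (fun _ _ _ _ h ha hb => ha.mul h hb) d hd hc


/-! ### Counting lattice points -/

/-- The pairs `(a, c)` with `a ^ 2 + c ^ 4 ≤ N`. -/
noncomputable def points (N : ℕ) : Finset (ℤ × ℤ) :=
  (Finset.Icc (-(N : ℤ)) N ×ˢ Finset.Icc (-(N : ℤ)) N).filter fun v => v.1 ^ 2 + v.2 ^ 4 ≤ N

theorem abs_le_sq_int (a : ℤ) : |a| ≤ a ^ 2 := by
  rw [← sq_abs]
  nlinarith [abs_nonneg a, show |a| = 0 ∨ 1 ≤ |a| by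
    rcases (abs_nonneg a).eq_or_lt with h | h
    · exact Or.inl h.symm
    · exact Or.inr h, sq_nonneg (|a|)]

theorem mem_points {N : ℕ} {v : ℤ × ℤ} : v ∈ points N ↔ v.1 ^ 2 + v.2 ^ 4 ≤ N := by
  simp only [points, Finset.mem_filter, Finset.mem_product, Finset.mem_Icc]
  refine ⟨fun h => h.2, fun h => ⟨⟨abs_le.mp ?_, abs_le.mp ?_⟩, h⟩⟩
  · have := abs_le_sq_int v.1
    have : 0 ≤ v.2 ^ 4 := by positivity
    linarith
  · have h1 := abs_le_sq_int v.2
    have h2 := abs_le_sq_int (v.2 ^ 2)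
    rw [abs_of_nonneg (sq_nonneg _), ← pow_mul, show 2 * 2 = 4 from rfl] at h2
    have : 0 ≤ v.1 ^ 2 := by positivity
    linarith

theorem repCount_eq {N n : ℕ} (hn : n ≤ N) :
    repCount n = ((points N).filter fun v => v.1 ^ 2 + v.2 ^ 4 = (n : ℤ)).card := by
  unfold repCount
  rw [← Set.ncard_coe_finset]
  congr 1
  ext v
  simp only [Set.mem_ofPred_eq, Finset.coe_filter, mem_points]
  exact ⟨fun h => ⟨by rw [h]; exact_mod_cast hn, h⟩, fun h => h.2⟩

/-- The extra `1` is the origin: it lies in `points` and has value `0`, divisible by every `d`,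
while the sums start at `n = 1`. -/
theorem totalDvd_add_one (d : ℕ) (t : ℝ) :
    totalDvd d t + 1 = ∑ v ∈ points ⌊t⌋₊, ind ((d : ℤ) ∣ v.1 ^ 2 + v.2 ^ 4) := by
  classical
  set N := ⌊t⌋₊ with hN
  set F := (points N).filter fun v : ℤ × ℤ =>
    (d : ℤ) ∣ v.1 ^ 2 + v.2 ^ 4 ∧ v.1 ^ 2 + v.2 ^ 4 ≠ 0 with hF
  have h1 : totalDvd d t = F.card := by
    unfold totalDvd
    rw [← hN, Finset.card_eq_sum_card_fiberwise (f := fun v : ℤ × ℤ => (v.1 ^ 2 + v.2 ^ 4).toNat)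
      (t := (Finset.Icc 1 N).filter fun n => d ∣ n)]
    · push_cast
      refine Finset.sum_congr rfl fun n hn => ?_
      simp only [Finset.mem_filter, Finset.mem_Icc] at hn
      rw [repCount_eq hn.1.2]
      congr 2
      ext v
      simp only [hF, Finset.mem_filter]
      have h0 : 0 ≤ v.1 ^ 2 + v.2 ^ 4 := by positivity
      constructor
      · rintro ⟨a, b⟩
        refine ⟨⟨a, ?_, by omega⟩, by omega⟩
        rw [b]; exact_mod_cast hn.2
      · rintro ⟨⟨a, b, c⟩, e⟩
        exact ⟨a, by omega⟩
    · intro v hv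
      simp only [hF, Finset.coe_filter, Set.mem_ofPred_eq, mem_points] at hv
      have h0 : 0 ≤ v.1 ^ 2 + v.2 ^ 4 := by positivity
      simp only [Finset.coe_filter, Finset.mem_Icc, Set.mem_ofPred_eq]
      refine ⟨by omega, ?_⟩
      rw [← Int.natCast_dvd_natCast, Int.toNat_of_nonneg h0]
      exact hv.2.1
  have h2 : ∑ v ∈ points N, ind ((d : ℤ) ∣ v.1 ^ 2 + v.2 ^ 4)
      = ((points N).filter fun v : ℤ × ℤ => (d : ℤ) ∣ v.1 ^ 2 + v.2 ^ 4).card := by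
    rw [Finset.natCast_card_filter]
    refine Finset.sum_congr rfl fun v _ => ?_
    by_cases h : (d : ℤ) ∣ v.1 ^ 2 + v.2 ^ 4 <;> simp [ind, h]
  have h3 : ((points N).filter fun v : ℤ × ℤ => (d : ℤ) ∣ v.1 ^ 2 + v.2 ^ 4) = insert (0, 0) F := by
    ext v
    simp only [hF, Finset.mem_insert, Finset.mem_filter]
    constructor
    · rintro ⟨a, b⟩
      by_cases h : v.1 ^ 2 + v.2 ^ 4 = 0
      · left
        have h4 : 0 ≤ v.2 ^ 4 := by positivity
        have h5 : 0 ≤ v.1 ^ 2 := by positivity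
        exact Prod.ext (pow_eq_zero_iff two_ne_zero |>.mp (by omega))
          (pow_eq_zero_iff four_ne_zero |>.mp (by omega))
      · exact Or.inr ⟨a, b, h⟩
    · rintro (h | h)
      · rw [h]; exact ⟨mem_points.mpr (by simp), by simp⟩
      · exact ⟨h.1, h.2.1⟩
  rw [h1, h2, h3, Finset.card_insert_of_notMem (by simp [hF])]
  push_cast; ring

theorem total_eq_totalDvd_one (t : ℝ) : total t = totalDvd 1 t := by
  unfold total totalDvd
  simp

/-- The residues `ν` with `ν ^ 2 + 1` divisible by `q`. -/
def roots (q : ℕ) : Finset ℕ := (Finset.range q).filter fun ν => q ∣ ν ^ 2 + 1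

theorem rootCount_eq {q : ℕ} (hq : 0 < q) (a b : ℤ) :
    rootCount q a b = ((roots q).filter fun ν : ℕ => (q : ℤ) ∣ a - ν * b).card := by
  have : NeZero q := ⟨hq.ne'⟩
  have hz : ∀ ν : ZMod q, ν ^ 2 + 1 = 0 ↔ q ∣ ν.val ^ 2 + 1 := by
    intro ν
    rw [← ZMod.natCast_eq_zero_iff]
    push_cast
    rw [ZMod.natCast_zmod_val]
  have ha : ∀ ν : ZMod q, (a : ZMod q) = ν * b ↔ (q : ℤ) ∣ a - ν.val * b := by
    intro ν
    rw [← ZMod.intCast_zmod_eq_zero_iff_dvd]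
    push_cast
    rw [ZMod.natCast_zmod_val, sub_eq_zero]
  classical
  unfold rootCount
  rw [Nat.card_eq_fintype_card, Fintype.card_subtype]
  refine Finset.card_bij (fun ν _ => ν.val) ?_ ?_ ?_
  · intro ν hν
    simp only [Finset.mem_filter, Finset.mem_univ, true_and, roots, Finset.mem_range] at hν ⊢
    exact ⟨⟨ZMod.val_lt ν, (hz ν).mp hν.1⟩, (ha ν).mp hν.2⟩
  · intro ν _ μ _ h
    exact ZMod.val_injective q h
  · intro n hn
    simp only [Finset.mem_filter, roots, Finset.mem_range] at hn
    have hv : ((n : ZMod q)).val = n := ZMod.val_natCast_of_lt hn.1.1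
    refine ⟨(n : ZMod q), ?_, hv⟩
    simp only [Finset.mem_filter, Finset.mem_univ, true_and]
    rw [hz, ha, hv]
    exact ⟨hn.1.2, hn.2⟩

theorem rho_eq_card_roots {q : ℕ} (hq : 0 < q) : rho q = (roots q).card := by
  rw [rho_eq_rootCount, rootCount_eq hq, Finset.filter_true_of_mem]
  intro ν _
  simp

theorem floor_eq_sub_saw (x : ℝ) : (⌊x⌋ : ℝ) = x - saw x - 1 / 2 := by
  unfold saw Int.fract; ring

theorem abs_saw_le (x : ℝ) : |saw x| ≤ 1 / 2 := by
  unfold saw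
  rw [abs_le]
  have := Int.fract_nonneg x
  have := Int.fract_lt_one x
  constructor <;> linarith

/-- The number of integers of a residue class modulo `q` in a symmetric interval. -/
theorem card_residue_class {q : ℕ} (hq : 0 < q) (b : ℤ) {X : ℝ} (hX : 0 ≤ X) (F : Finset ℤ)
    (hF : ∀ a : ℤ, a ∈ F ↔ |(a : ℝ)| ≤ X ∧ (q : ℤ) ∣ a - b) :
    (F.card : ℝ) = 2 * (X / q) - (saw (X / q - b / q) + saw (X / q + b / q)) := by
  have hqR : (0 : ℝ) < q := by exact_mod_cast hq
  have hqZ : (q : ℤ) ≠ 0 := by exact_mod_cast hq.ne'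
  have hcard : F.card = (Finset.Icc (-⌊X / q + b / q⌋) ⌊X / q - b / q⌋).card := by
    symm
    refine Finset.card_bij (fun n _ => b + q * n) ?_ ?_ ?_
    · intro n hn
      rw [Finset.mem_Icc] at hn
      rw [hF]
      refine ⟨?_, ⟨n, by ring⟩⟩
      have h1 := Int.le_floor.mp hn.2
      have h2 := Int.le_floor.mp (neg_le.mp hn.1)
      rw [← sub_div, le_div_iff₀ hqR] at h1
      rw [← add_div, le_div_iff₀ hqR] at h2
      push_cast at h2 ⊢
      rw [abs_le]; constructor <;> linarith
    · intro n _ m _ h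
      exact mul_left_cancel₀ hqZ (add_left_cancel h)
    · intro a ha
      obtain ⟨h1, n, hn⟩ := (hF a).mp ha
      refine ⟨n, ?_, by linarith⟩
      have ha' : (a : ℝ) = b + q * n := by
        have : a = b + q * n := by linarith
        rw [this]; push_cast; ring
      rw [abs_le, ha'] at h1
      rw [Finset.mem_Icc]
      constructor
      · rw [neg_le, Int.le_floor, ← add_div, le_div_iff₀ hqR]
        push_cast; linarith
      · rw [Int.le_floor, ← sub_div, le_div_iff₀ hqR]
        linarith
  -- The two floors add up to more than `2 X / q - 2 ≥ -2`, hence to at least `-1`, so the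
  -- cardinality formula needs no truncation at zero.
  have hnn : 0 ≤ ⌊X / q - b / q⌋ + 1 - -⌊X / q + b / q⌋ := by
    have h1 := Int.lt_floor_add_one (X / q - b / q)
    have h2 := Int.lt_floor_add_one (X / q + b / q)
    have h3 : 0 ≤ X / q := by positivity
    have h4 : (-2 : ℝ) < ((⌊X / q - b / q⌋ + ⌊X / q + b / q⌋ : ℤ) : ℝ) := by push_cast; linarith
    have h5 : -2 < ⌊X / q - b / q⌋ + ⌊X / q + b / q⌋ := by exact_mod_cast h4
    omega
  have : ((F.card : ℤ) : ℝ) = ((⌊X / q - b / q⌋ + 1 - -⌊X / q + b / q⌋ : ℤ) : ℝ) := by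
    rw [hcard, Int.card_Icc, Int.toNat_of_nonneg hnn]
  push_cast at this
  rw [this, floor_eq_sub_saw, floor_eq_sub_saw]
  ring

/-- The radius of the `a`-interval over `c = n`. -/
noncomputable def width (N n : ℕ) : ℝ := √((N : ℝ) - (n : ℝ) ^ 4)

theorem width_nonneg (N n : ℕ) : 0 ≤ width N n := Real.sqrt_nonneg _

theorem width_le (N n : ℕ) : width N n ≤ √N :=
  Real.sqrt_le_sqrt (by have : (0 : ℝ) ≤ (n : ℝ) ^ 4 := by positivity
                        linarith)

theorem width_antitone (N : ℕ) : Antitone (width N) := by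
  intro m n h
  refine Real.sqrt_le_sqrt ?_
  gcongr

/-- Points over a fixed `c = k j` with `u ∣ a` and `a ≡ ν c ^ 2` modulo `q`. -/
theorem card_fiber {N k u κ q : ℕ} (hq : 0 < q) (hu : 0 < u) (huq : u.Coprime q)
    (hκ : u * κ = k ^ 2) (ν : ℕ) (j : ℤ) (hj : ((k : ℤ) * j) ^ 4 ≤ N) (F : Finset ℤ)
    (hF : ∀ a : ℤ, a ∈ F ↔ a ^ 2 + ((k : ℤ) * j) ^ 4 ≤ N ∧ (u : ℤ) ∣ a ∧
      (q : ℤ) ∣ a - ν * ((k : ℤ) * j) ^ 2) :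
    (F.card : ℝ) = 2 * (width N (k * j.natAbs) / u / q)
      - (saw (width N (k * j.natAbs) / u / q - κ * (j.natAbs : ℝ) ^ 2 * ((ν : ℝ) / q))
        + saw (width N (k * j.natAbs) / u / q + κ * (j.natAbs : ℝ) ^ 2 * ((ν : ℝ) / q))) := by
  have huR : (0 : ℝ) < u := by exact_mod_cast hu
  have huZ : (u : ℤ) ≠ 0 := by exact_mod_cast hu.ne'
  set W := width N (k * j.natAbs) with hW
  have hjR : ((j.natAbs : ℝ)) ^ 2 = (j : ℝ) ^ 2 := by
    rw [Nat.cast_natAbs, Int.cast_abs, sq_abs]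
  have hj4 : ((j.natAbs : ℝ)) ^ 4 = (j : ℝ) ^ 4 := by
    rw [show 4 = 2 * 2 from rfl, pow_mul, hjR, ← pow_mul]
  have hrad : ∀ a : ℤ, a ^ 2 + ((k : ℤ) * j) ^ 4 ≤ N ↔ |(a : ℝ)| ≤ W := by
    intro a
    have e : ((k * j.natAbs : ℕ) : ℝ) ^ 4 = ((k : ℝ) * j) ^ 4 := by
      rw [Nat.cast_mul, mul_pow, hj4, mul_pow]
    have hj' : 0 ≤ (N : ℝ) - ((k : ℝ) * j) ^ 4 := by
      rw [sub_nonneg]; exact_mod_cast hj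
    rw [hW, width, e, Real.le_sqrt (abs_nonneg _) hj', sq_abs, le_sub_iff_add_le]
    exact_mod_cast Iff.rfl
  -- Dividing by `u`, which is coprime to `q`, leaves the single class `a ≡ ν κ j²` modulo `q` in an
  -- interval of radius `W / u`.
  have hcard : (F.image fun a => a / (u : ℤ)).card = F.card := by
    refine Finset.card_image_of_injOn fun a ha b hb h => ?_
    have h1 := Int.mul_ediv_cancel' ((hF a).mp ha).2.1
    have h2 := Int.mul_ediv_cancel' ((hF b).mp hb).2.1
    have h' : a / (u : ℤ) = b / u := h
    rw [← h1, ← h2, h']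
  have hmem : ∀ a : ℤ, a ∈ F.image (fun a => a / (u : ℤ)) ↔
      |(a : ℝ)| ≤ W / u ∧ (q : ℤ) ∣ a - ν * κ * j ^ 2 := by
    intro a
    have e1 : a ∈ F.image (fun a => a / (u : ℤ)) ↔ (u : ℤ) * a ∈ F := by
      rw [Finset.mem_image]
      constructor
      · rintro ⟨b, hb, rfl⟩
        rwa [Int.mul_ediv_cancel' ((hF b).mp hb).2.1]
      · intro h
        exact ⟨_, h, Int.mul_ediv_cancel_left _ huZ⟩
    have hκZ : (u : ℤ) * κ = (k : ℤ) ^ 2 := by exact_mod_cast hκ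
    have e2 : (u : ℤ) * a - ν * ((k : ℤ) * j) ^ 2 = u * (a - ν * κ * j ^ 2) := by
      rw [mul_pow, ← hκZ]; ring
    rw [e1, hF, hrad, e2]
    have e3 : |(((u : ℤ) * a : ℤ) : ℝ)| ≤ W ↔ |(a : ℝ)| ≤ W / u := by
      push_cast
      rw [abs_mul, abs_of_pos huR, le_div_iff₀ huR, mul_comm]
    rw [e3]
    have hco : IsCoprime (q : ℤ) (u : ℤ) := Nat.isCoprime_iff_coprime.mpr huq.symm
    exact ⟨fun h => ⟨h.1, hco.dvd_of_dvd_mul_left h.2.2⟩,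
      fun h => ⟨h.1, dvd_mul_right _ _, h.2.mul_left _⟩⟩
  have hW0 : 0 ≤ W / u := div_nonneg (width_nonneg _ _) huR.le
  have h := card_residue_class hq (ν * κ * j ^ 2) hW0 _ hmem
  rw [hcard] at h
  rw [h, hjR]
  have e4 : (((ν : ℤ) * κ * j ^ 2 : ℤ) : ℝ) / q = κ * (j : ℝ) ^ 2 * ((ν : ℝ) / q) := by
    push_cast; ring
  rw [e4]

theorem sum_Icc_natAbs (f : ℕ → ℝ) (J : ℕ) :
    ∑ j ∈ Finset.Icc (-(J : ℤ)) J, f j.natAbs = f 0 + 2 * ∑ j ∈ Finset.Icc 1 J, f j := by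
  induction J with
  | zero => simp
  | succ J ih =>
    have e : Finset.Icc (-((J + 1 : ℕ) : ℤ)) ((J + 1 : ℕ) : ℤ)
        = insert (-((J + 1 : ℕ) : ℤ)) (insert ((J + 1 : ℕ) : ℤ) (Finset.Icc (-(J : ℤ)) J)) := by
      ext z; simp only [Finset.mem_Icc, Finset.mem_insert]; push_cast; omega
    rw [e, Finset.sum_insert, Finset.sum_insert, ih, Finset.sum_Icc_succ_top (by omega),
      Int.natAbs_neg, Int.natAbs_natCast]
    · ring
    · simp only [Finset.mem_Icc]; push_cast; omega
    · simp only [Finset.mem_Icc, Finset.mem_insert]; push_cast; omega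

/-- The number of lattice points counted by a term of an expansion. -/
noncomputable def termCount (N k u q : ℕ) : ℝ :=
  ∑ v ∈ points N, ind ((k : ℤ) ∣ v.2) * ind ((u : ℤ) ∣ v.1) * rootCount q v.1 (v.2 ^ 2)

theorem pow_four_le_iff (N k : ℕ) (hk : 0 < k) (j : ℤ) :
    ((k : ℤ) * j) ^ 4 ≤ N ↔ j ∈ Finset.Icc (-((N.sqrt.sqrt / k : ℕ) : ℤ)) (N.sqrt.sqrt / k : ℕ) := by
  have h1 : ((k : ℤ) * j) ^ 4 = (((k * j.natAbs) ^ 4 : ℕ) : ℤ) := by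
    push_cast
    rw [mul_pow, mul_pow, show 4 = 2 * 2 from rfl, pow_mul |j|, sq_abs, ← pow_mul]
  rw [h1, Nat.cast_le, show 4 = 2 * 2 from rfl, pow_mul, ← Nat.le_sqrt', ← Nat.le_sqrt',
    mul_comm, ← Nat.le_div_iff_mul_le hk, Finset.mem_Icc]
  omega

theorem termCount_eq {N k u κ q : ℕ} (hk : 0 < k) (hq : 0 < q) (hu : 0 < u) (huq : u.Coprime q)
    (hκ : u * κ = k ^ 2) :
    termCount N k u q = ∑ ν ∈ roots q,
      ∑ j ∈ Finset.Icc (-((N.sqrt.sqrt / k : ℕ) : ℤ)) (N.sqrt.sqrt / k : ℕ),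
      (2 * (width N (k * j.natAbs) / u / q)
      - (saw (width N (k * j.natAbs) / u / q - κ * (j.natAbs : ℝ) ^ 2 * ((ν : ℝ) / q))
        + saw (width N (k * j.natAbs) / u / q + κ * (j.natAbs : ℝ) ^ 2 * ((ν : ℝ) / q)))) := by
  classical
  have hkZ : (k : ℤ) ≠ 0 := by exact_mod_cast hk.ne'
  have h1 : termCount N k u q = ∑ ν ∈ roots q, (((points N).filter fun v : ℤ × ℤ =>
      (k : ℤ) ∣ v.2 ∧ (u : ℤ) ∣ v.1 ∧ (q : ℤ) ∣ v.1 - ν * v.2 ^ 2).card : ℝ) := by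
    unfold termCount
    simp only [rootCount_eq hq, Finset.natCast_card_filter, Finset.mul_sum]
    rw [Finset.sum_comm]
    refine Finset.sum_congr rfl fun ν _ => Finset.sum_congr rfl fun v _ => ?_
    by_cases a1 : (k : ℤ) ∣ v.2 <;> by_cases a2 : (u : ℤ) ∣ v.1 <;> simp [ind, a1, a2]
  rw [h1]
  refine Finset.sum_congr rfl fun ν _ => ?_
  set G := (points N).filter fun v : ℤ × ℤ =>
      (k : ℤ) ∣ v.2 ∧ (u : ℤ) ∣ v.1 ∧ (q : ℤ) ∣ v.1 - ν * v.2 ^ 2 with hG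
  have hGmem : ∀ v, v ∈ G ↔ v.1 ^ 2 + v.2 ^ 4 ≤ N ∧ (k : ℤ) ∣ v.2 ∧ (u : ℤ) ∣ v.1 ∧
      (q : ℤ) ∣ v.1 - ν * v.2 ^ 2 := fun v => by
    rw [hG, Finset.mem_filter, mem_points]
  rw [Finset.card_eq_sum_card_fiberwise (f := fun v : ℤ × ℤ => v.2 / k)
    (t := Finset.Icc (-((N.sqrt.sqrt / k : ℕ) : ℤ)) (N.sqrt.sqrt / k : ℕ))]
  · push_cast
    refine Finset.sum_congr rfl fun j hj => ?_
    have hj' := (pow_four_le_iff N k hk j).mpr hj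
    have hinj : Set.InjOn (Prod.fst : ℤ × ℤ → ℤ)
        ((G.filter fun v => v.2 / (k : ℤ) = j : Finset (ℤ × ℤ)) : Set (ℤ × ℤ)) := by
      intro v hv w hw h
      obtain ⟨v1, v2⟩ := Finset.mem_filter.mp hv
      obtain ⟨w1, w2⟩ := Finset.mem_filter.mp hw
      refine Prod.ext h ?_
      rw [← Int.mul_ediv_cancel' ((hGmem v).mp v1).2.1,
        ← Int.mul_ediv_cancel' ((hGmem w).mp w1).2.1, v2, w2]
    rw [← Finset.card_image_of_injOn hinj]
    refine card_fiber hq hu huq hκ ν j hj' _ fun a => ?_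
    rw [Finset.mem_image]
    constructor
    · rintro ⟨v, hv, rfl⟩
      obtain ⟨v1, v2⟩ := Finset.mem_filter.mp hv
      obtain ⟨g1, g2, g3, g4⟩ := (hGmem v).mp v1
      have e : (k : ℤ) * j = v.2 := by rw [← v2]; exact Int.mul_ediv_cancel' g2
      rw [e]
      exact ⟨g1, g3, g4⟩
    · rintro ⟨g1, g3, g4⟩
      refine ⟨(a, k * j), Finset.mem_filter.mpr ⟨(hGmem _).mpr ⟨g1, dvd_mul_right _ _, g3, g4⟩, ?_⟩,
        rfl⟩
      exact Int.mul_ediv_cancel_left _ hkZ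
  · intro v hv
    obtain ⟨g1, g2, g3, g4⟩ := (hGmem v).mp hv
    refine (pow_four_le_iff N k hk _).mp ?_
    rw [Int.mul_ediv_cancel' g2]
    have : 0 ≤ v.1 ^ 2 := by positivity
    linarith


/-! ### The main term -/

theorem sum_range_mul_le_of_antitone {f : ℕ → ℝ} (hf : Antitone f) (k m : ℕ) :
    ∑ n ∈ Finset.range (k * m), f n ≤ k * ∑ j ∈ Finset.range m, f (k * j) := by
  induction m with
  | zero => simp
  | succ m ih =>
    rw [Nat.mul_succ, Finset.sum_range_add, Finset.sum_range_succ, mul_add]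
    refine add_le_add ih ?_
    refine (Finset.sum_le_card_nsmul _ _ (f (k * m)) fun i _ => hf (by omega)).trans (le_of_eq ?_)
    simp

theorem le_sum_range_mul_of_antitone {f : ℕ → ℝ} (hf : Antitone f) (k m : ℕ) :
    k * ∑ j ∈ Finset.range m, f (k * (j + 1)) ≤ ∑ n ∈ Finset.range (k * m), f (n + 1) := by
  induction m with
  | zero => simp
  | succ m ih =>
    rw [Finset.sum_range_succ, mul_add, Nat.mul_succ, Finset.sum_range_add]
    refine add_le_add ih (le_trans (le_of_eq ?_) (Finset.card_nsmul_le_sum _ _ (f (k * (m + 1)))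
      fun i hi => hf ?_))
    · simp [mul_add]
    · have := Finset.mem_range.mp hi
      rw [mul_add]; omega

theorem sum_Icc_one_eq (f : ℕ → ℝ) (J : ℕ) :
    ∑ j ∈ Finset.Icc 1 J, f j = ∑ j ∈ Finset.range J, f (j + 1) := by
  rw [Finset.range_eq_Ico, Finset.sum_Ico_add' f 0 J 1]
  congr 1

/-- The sum of the radii over the multiples of `k`. -/
noncomputable def widthSum (N k : ℕ) : ℝ :=
  width N 0 + 2 * ∑ j ∈ Finset.Icc 1 (N.sqrt.sqrt / k), width N (k * j)

/-- `width` is decreasing, so comparing blocks of `k` consecutive terms with their end values gives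
an error of at most one value `width N 0 = √N`. No integral for the sum is evaluated. -/
theorem abs_widthSum_sub_le {N k : ℕ} (hk : 0 < k) :
    |widthSum N k - widthSum N 1 / k| ≤ √N := by
  set J₁ := N.sqrt.sqrt with hJ₁
  set J := J₁ / k with hJ
  set f := width N with hf
  have hk1 : (1 : ℝ) ≤ k := by exact_mod_cast hk
  have hanti : Antitone f := width_antitone N
  have hJk : k * J ≤ J₁ := Nat.mul_div_le J₁ k
  have hJk' : J₁ < k * (J + 1) := Nat.lt_mul_div_succ J₁ hk
  have hf0 : f 0 = √N := by simp [hf, width]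
  have hnn : ∀ n, 0 ≤ f n := width_nonneg N
  have h1 : k * ∑ j ∈ Finset.Icc 1 J, f (k * j) ≤ ∑ j ∈ Finset.Icc 1 J₁, f j := by
    rw [sum_Icc_one_eq, sum_Icc_one_eq]
    refine (le_sum_range_mul_of_antitone hanti k J).trans ?_
    exact Finset.sum_le_sum_of_subset_of_nonneg (Finset.range_subset_range.mpr hJk)
      fun n _ _ => hnn _
  have h2 : f 0 + ∑ j ∈ Finset.Icc 1 J₁, f j ≤ k * (f 0 + ∑ j ∈ Finset.Icc 1 J, f (k * j)) := by
    have e1 : f 0 + ∑ j ∈ Finset.Icc 1 J₁, f j = ∑ j ∈ Finset.range (J₁ + 1), f j := by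
      rw [Finset.sum_range_succ', sum_Icc_one_eq, add_comm]
    have e2 : f 0 + ∑ j ∈ Finset.Icc 1 J, f (k * j) = ∑ j ∈ Finset.range (J + 1), f (k * j) := by
      rw [Finset.sum_range_succ', sum_Icc_one_eq (fun j => f (k * j)), add_comm, mul_zero]
    rw [e1, e2]
    refine le_trans ?_ (sum_range_mul_le_of_antitone hanti k (J + 1))
    exact Finset.sum_le_sum_of_subset_of_nonneg (Finset.range_subset_range.mpr hJk')
      fun n _ _ => hnn _
  unfold widthSum
  rw [Nat.div_one, ← hJ₁, ← hJ]
  simp only [one_mul]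
  change |f 0 + 2 * ∑ j ∈ Finset.Icc 1 J, f (k * j) - (f 0 + 2 * ∑ j ∈ Finset.Icc 1 J₁, f j) / k| ≤ _
  set A := ∑ j ∈ Finset.Icc 1 J, f (k * j)
  set B := ∑ j ∈ Finset.Icc 1 J₁, f j
  have hkpos : (0 : ℝ) < k := by linarith
  have e : f 0 + 2 * A - (f 0 + 2 * B) / k = (k * (f 0 + 2 * A) - (f 0 + 2 * B)) / k := by
    field_simp
  rw [e, abs_div, abs_of_pos hkpos, div_le_iff₀ hkpos, ← hf0, abs_le]
  have := hnn 0
  constructor <;> nlinarith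

/-- The oscillating part of the count of lattice points in a term of an expansion. -/
noncomputable def oscSum (N k u κ q ν : ℕ) : ℝ :=
  ∑ j ∈ Finset.Icc 1 (N.sqrt.sqrt / k),
    (saw (width N (k * j) / u / q - κ * (j : ℝ) ^ 2 * ((ν : ℝ) / q))
      + saw (width N (k * j) / u / q + κ * (j : ℝ) ^ 2 * ((ν : ℝ) / q)))

/-- The three errors are the term `c = 0`, the sawtooth sums over `c ≠ 0` (doubled by `c ↦ -c`), and
the replacement of `widthSum N k` by `widthSum N 1 / k`. -/
theorem abs_termCount_sub_le {N k u κ q : ℕ} (hk : 0 < k) (hq : 0 < q) (hu : 0 < u)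
    (huq : u.Coprime q) (hκ : u * κ = k ^ 2) :
    |termCount N k u q - rho q / (k * u * q) * (2 * widthSum N 1)|
      ≤ rho q + 2 * ∑ ν ∈ roots q, |oscSum N k u κ q ν| + 2 * rho q * √N / (u * q) := by
  have hqR : (0 : ℝ) < q := by exact_mod_cast hq
  have huR : (0 : ℝ) < u := by exact_mod_cast hu
  have hkR : (0 : ℝ) < k := by exact_mod_cast hk
  set c := N.sqrt.sqrt / k with hc
  have h1 : termCount N k u q = rho q * (2 * widthSum N k / (u * q))
      - ∑ ν ∈ roots q, 2 * saw (√N / u / q) - 2 * ∑ ν ∈ roots q, oscSum N k u κ q ν := by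
    rw [termCount_eq hk hq hu huq hκ, rho_eq_card_roots hq, ← nsmul_eq_mul, ← Finset.sum_const,
      Finset.mul_sum, ← Finset.sum_sub_distrib, ← Finset.sum_sub_distrib]
    refine Finset.sum_congr rfl fun ν _ => ?_
    rw [sum_Icc_natAbs (fun j => 2 * (width N (k * j) / u / q)
      - (saw (width N (k * j) / u / q - κ * (j : ℝ) ^ 2 * ((ν : ℝ) / q))
        + saw (width N (k * j) / u / q + κ * (j : ℝ) ^ 2 * ((ν : ℝ) / q)))),
      Finset.sum_sub_distrib]
    have e0 : width N 0 = √N := by simp [width]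
    have e1 : ∑ j ∈ Finset.Icc 1 (N.sqrt.sqrt / k), 2 * (width N (k * j) / u / q)
        = 2 * (∑ j ∈ Finset.Icc 1 (N.sqrt.sqrt / k), width N (k * j)) / (u * q) := by
      rw [Finset.mul_sum, Finset.sum_div]
      refine Finset.sum_congr rfl fun j _ => by field_simp
    have e2 : ∑ j ∈ Finset.Icc 1 (N.sqrt.sqrt / k),
        (saw (width N (k * j) / u / q - κ * (j : ℝ) ^ 2 * ((ν : ℝ) / q))
        + saw (width N (k * j) / u / q + κ * (j : ℝ) ^ 2 * ((ν : ℝ) / q)))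
        = oscSum N k u κ q ν := rfl
    rw [e1, e2, widthSum, e0]
    simp only [mul_zero, Nat.cast_zero, ne_eq, OfNat.ofNat_ne_zero, not_false_eq_true, zero_pow,
      zero_mul, sub_zero, add_zero, e0]
    generalize saw (√N / u / q) = s₀
    field_simp
    ring
  have h2 : |∑ ν ∈ roots q, 2 * saw (√N / u / q)| ≤ rho q := by
    rw [Finset.sum_const, nsmul_eq_mul, ← rho_eq_card_roots hq, abs_mul, Nat.abs_cast, abs_mul]
    have := abs_saw_le (√N / u / q)
    rw [abs_of_pos (by norm_num : (0 : ℝ) < 2)]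
    refine mul_le_of_le_one_right (by positivity) (by linarith)
  have h3 : |∑ ν ∈ roots q, oscSum N k u κ q ν| ≤ ∑ ν ∈ roots q, |oscSum N k u κ q ν| :=
    Finset.abs_sum_le_sum_abs _ _
  have h4 : |rho q * (2 * widthSum N k / (u * q)) - rho q / (k * u * q) * (2 * widthSum N 1)|
      ≤ 2 * rho q * √N / (u * q) := by
    have e : rho q * (2 * widthSum N k / (u * q)) - rho q / (k * u * q) * (2 * widthSum N 1)
        = (2 * rho q / (u * q)) * (widthSum N k - widthSum N 1 / k) := by field_simp
    rw [e, abs_mul, abs_of_nonneg (by positivity)]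
    calc _ ≤ (2 * rho q / (u * q)) * √N := by
          gcongr
          exact abs_widthSum_sub_le hk
      _ = _ := by ring
  rw [h1]
  rw [abs_le] at h2 h3 h4 ⊢
  constructor <;> linarith [h2.1, h2.2, h3.1, h3.2, h4.1, h4.2]

theorem sqrt_sqrt_le (N : ℕ) : (N.sqrt.sqrt : ℝ) ≤ √N := by
  refine Real.le_sqrt_of_sq_le ?_
  have h1 : N.sqrt.sqrt ^ 2 ≤ N := (Nat.sqrt_le' _).trans (Nat.sqrt_le_self _)
  exact_mod_cast h1

/-- The case `d = 1`, with the oscillating sum bounded trivially by the number of `c ≤ N^{1/4}`. The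
sum of radii can thus be exchanged for `A(t)`. -/
theorem abs_total_sub_le {t : ℝ} (ht : 1 ≤ ⌊t⌋₊) :
    |total t - 2 * widthSum ⌊t⌋₊ 1| ≤ 6 * √(⌊t⌋₊ : ℝ) := by
  set N := ⌊t⌋₊ with hN
  have hN1 : (1 : ℝ) ≤ √N := by
    rw [Real.one_le_sqrt]; exact_mod_cast ht
  have h1 : total t + 1 = termCount N 1 1 1 := by
    rw [total_eq_totalDvd_one, totalDvd_add_one]
    unfold termCount
    refine Finset.sum_congr rfl fun v _ => ?_
    simp [ind, rootCount_one]
  have h2 := abs_termCount_sub_le (N := N) (k := 1) (u := 1) (κ := 1) (q := 1) one_pos one_pos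
    one_pos (by simp) (by norm_num)
  have h3 : ∑ ν ∈ roots 1, |oscSum N 1 1 1 1 ν| ≤ √N := by
    have hc : ((roots 1).card : ℝ) = 1 := by
      rw [← rho_eq_card_roots one_pos, rho_one]; norm_num
    refine (Finset.sum_le_card_nsmul _ _ (√N) fun ν _ => ?_).trans (by rw [nsmul_eq_mul, hc, one_mul])
    unfold oscSum
    refine (Finset.abs_sum_le_sum_abs _ _).trans ?_
    refine (Finset.sum_le_card_nsmul _ _ 1 fun j _ => ?_).trans ?_
    · refine (abs_add_le _ _).trans ?_
      have := abs_saw_le (width N (1 * j) / (1 : ℕ) / (1 : ℕ) - (1 : ℕ) * (j : ℝ) ^ 2 * ((ν : ℝ) / (1 : ℕ)))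
      have := abs_saw_le (width N (1 * j) / (1 : ℕ) / (1 : ℕ) + (1 : ℕ) * (j : ℝ) ^ 2 * ((ν : ℝ) / (1 : ℕ)))
      linarith
    · simpa using sqrt_sqrt_le N
  rw [rho_one, ← h1] at h2
  simp only [Nat.cast_one, mul_one, div_one, one_mul] at h2
  rw [abs_le] at h2 ⊢
  constructor <;> linarith [h2.1, h2.2]

/-- The bound for the error of a term of an expansion. -/
noncomputable def termError (N k u q : ℕ) : ℝ :=
  rho q + 2 * ∑ ν ∈ roots q, |oscSum N k u (k ^ 2 / u) q ν| + 2 * rho q * √N / (u * q)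

theorem termError_nonneg (N k u q : ℕ) : 0 ≤ termError N k u q := by
  unfold termError; positivity

theorem abs_termCount_sub_le_termError {N k u q : ℕ} (hk : 0 < k) (hq : 0 < q) (hu : 0 < u)
    (huq : u.Coprime q) (huk : u ∣ k ^ 2) :
    |termCount N k u q - rho q / (k * u * q) * (2 * widthSum N 1)| ≤ termError N k u q :=
  abs_termCount_sub_le hk hq hu huq (Nat.mul_div_cancel' huk)

open Classical in
/-- The tuples `(k, u, m, q)` that can occur in the expansion of `d`. -/
noncomputable def tuples (d : ℕ) : Finset (ℕ × ℕ × ℕ × ℕ) :=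
  (d.divisors ×ˢ d.divisors ×ˢ d.divisors ×ˢ d.divisors).filter fun v =>
    v.2.2.1 * v.2.2.2 = d ∧ v.1 ∣ v.2.1 ∧ v.2.1 ∣ v.2.2.1 ∧ v.2.2.1 ∣ v.1 ^ 2

theorem mem_tuples {d : ℕ} (hd : 0 < d) {v : ℕ × ℕ × ℕ × ℕ} : v ∈ tuples d ↔
    v.2.2.1 * v.2.2.2 = d ∧ v.1 ∣ v.2.1 ∧ v.2.1 ∣ v.2.2.1 ∧ v.2.2.1 ∣ v.1 ^ 2 := by
  rw [tuples, Finset.mem_filter, and_iff_right_iff_imp]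
  rintro ⟨h1, h2, h3, h4⟩
  have hm : v.2.2.1 ∣ d := Dvd.intro _ h1
  have hq : v.2.2.2 ∣ d := Dvd.intro_left _ h1
  simp only [Finset.mem_product, Nat.mem_divisors]
  exact ⟨⟨(h2.trans h3).trans hm, hd.ne'⟩, ⟨h3.trans hm, hd.ne'⟩, ⟨hm, hd.ne'⟩, hq, hd.ne'⟩

theorem termError_le_sum {N k u m q d : ℕ} (h : (k, u, m, q) ∈ tuples d) :
    termError N k u q ≤ ∑ v ∈ tuples d, termError N v.1 v.2.1 v.2.2.2 := by
  have := Finset.single_le_sum (s := tuples d)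
    (f := fun v : ℕ × ℕ × ℕ × ℕ => termError N v.1 v.2.1 v.2.2.2)
    (fun v _ => termError_nonneg _ _ _ _) h
  exact this

/-- Counts and densities carry the same weights, so the main terms cancel. The error of each piece
is at most the sum over all of `tuples d`; the number of pieces and the size of the weights
contribute one divisor function each. -/
theorem abs_remainder_le {t : ℝ} (ht : 1 ≤ ⌊t⌋₊) {d : ℕ} (hd : 0 < d) (hc : Cubefree d) :
    |remainder d t| ≤ (d.divisors.card : ℝ) ^ 2 * ∑ v ∈ tuples d, termError ⌊t⌋₊ v.1 v.2.1 v.2.2.2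
      + 1 + 6 * √(⌊t⌋₊ : ℝ) * (d.divisors.card / d) := by
  set N := ⌊t⌋₊ with hN
  obtain ⟨ι, _, lam, k, u, m, q, h1, h2, h3, h4⟩ := hasExpansion hd hc
  have hdvd : totalDvd d t + 1 = ∑ i, lam i * termCount N (k i) (u i) (q i) := by
    rw [totalDvd_add_one, ← hN]
    simp only [h3, termCount, Finset.mul_sum]
    rw [Finset.sum_comm]
  have hE : ∀ i, |termCount N (k i) (u i) (q i)
      - rho (q i) / (k i * u i * q i) * (2 * widthSum N 1)|
      ≤ ∑ v ∈ tuples d, termError N v.1 v.2.1 v.2.2.2 := by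
    intro i
    obtain ⟨a1, a2, a3, a4, a5, a6⟩ := h1 i
    have hm : 0 < m i := Nat.pos_of_ne_zero fun h => by rw [h, zero_mul] at a1; omega
    have hq : 0 < q i := Nat.pos_of_ne_zero fun h => by rw [h, mul_zero] at a1; omega
    have hu : 0 < u i := Nat.pos_of_dvd_of_pos a4 hm
    have hk : 0 < k i := Nat.pos_of_dvd_of_pos a3 hu
    refine (abs_termCount_sub_le_termError hk hq hu (a2.coprime_dvd_left a4)
      (a4.trans a5)).trans ?_
    have hmem : (k i, u i, m i, q i) ∈ tuples d := (mem_tuples hd).mpr ⟨a1, a3, a4, a5⟩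
    exact termError_le_sum hmem
  have hrem : remainder d t = ∑ i, lam i * (termCount N (k i) (u i) (q i)
      - rho (q i) / (k i * u i * q i) * (2 * widthSum N 1)) - 1
      - density d * (total t - 2 * widthSum N 1) := by
    have e : ∑ i, lam i * (termCount N (k i) (u i) (q i)
        - rho (q i) / (k i * u i * q i) * (2 * widthSum N 1))
        = (totalDvd d t + 1) - density d * (2 * widthSum N 1) := by
      rw [hdvd, h4, Finset.sum_mul, ← Finset.sum_sub_distrib]
      refine Finset.sum_congr rfl fun i _ => by ring
    rw [e]; unfold remainder; ring
  have hS : |∑ i, lam i * (termCount N (k i) (u i) (q i)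
      - rho (q i) / (k i * u i * q i) * (2 * widthSum N 1))|
      ≤ (d.divisors.card : ℝ) ^ 2 * ∑ v ∈ tuples d, termError N v.1 v.2.1 v.2.2.2 := by
    set Z := ∑ v ∈ tuples d, termError N v.1 v.2.1 v.2.2.2 with hZ
    have hZ0 : 0 ≤ Z := Finset.sum_nonneg fun v _ => termError_nonneg _ _ _ _
    refine (Finset.abs_sum_le_sum_abs _ _).trans ?_
    refine (Finset.sum_le_card_nsmul _ _ (d.divisors.card * Z) fun i _ => ?_).trans ?_
    · rw [abs_mul]
      exact mul_le_mul (h1 i).2.2.2.2.2 (hE i) (abs_nonneg _) (by positivity)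
    · rw [nsmul_eq_mul, Finset.card_univ, sq, mul_assoc]
      have : (Fintype.card ι : ℝ) ≤ d.divisors.card := by exact_mod_cast h2
      gcongr
  have hD : |density d * (total t - 2 * widthSum N 1)|
      ≤ 6 * √N * (d.divisors.card / d) := by
    rw [abs_mul, mul_comm]
    exact mul_le_mul (abs_total_sub_le ht) (abs_density_le hd hc) (abs_nonneg _) (by positivity)
  rw [hrem]
  rw [abs_le] at hS hD ⊢
  constructor <;> linarith [hS.1, hS.2, hD.1, hD.2]


/-! ### The sum of the remainders -/

/-- Since `2 ^ i` has `i + 1` divisors, a bound `M` for the divisor function also absorbs every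
logarithm that occurs. -/
theorem succ_le_of_card_divisors_le {M B i : ℕ}
    (hM : ∀ n : ℕ, 0 < n → n ≤ B → n.divisors.card ≤ M) (hi : 2 ^ i ≤ B) : i + 1 ≤ M := by
  have := hM (2 ^ i) (by positivity) hi
  rwa [Nat.divisors_prime_pow Nat.prime_two, Finset.card_map, Finset.card_range] at this

/-- The choice `K ≈ x³ / y` balances the large sieve term against the smoothing term. The factor `1
/ k` is kept so that the later sum over `k` is only harmonic. -/
theorem dispersion_bound {x y k u Q M J K I : ℝ} (hx : 0 < x) (hy : 0 < y) (hk : 1 ≤ k)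
    (hku : k ≤ u) (hM : 1 ≤ M) (hQu : Q ≤ y ^ 4 / u) (hJ : 0 ≤ J) (hJk : J ≤ x ^ 4 / k)
    (hK : x ^ 3 / y ≤ K) (hK' : K ≤ 2 * (x ^ 3 / y)) (hI : 0 ≤ I) (hIM : I ≤ M) :
    K * I * √(Q * M * (J * (x ^ 8 / u) + k ^ 2 / u * J ^ 3)) + J * (x ^ 8 / u) / K
      ≤ 5 * (M ^ 2 * (y * x ^ 9 / k)) := by
  have hk0 : 0 < k := by linarith
  have hu0 : 0 < u := by linarith
  have hJY : J * (x ^ 8 / u) ≤ x ^ 12 / (k * u) := by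
    calc J * (x ^ 8 / u) ≤ x ^ 4 / k * (x ^ 8 / u) := by gcongr
      _ = _ := by field_simp
  have hκJ3 : k ^ 2 / u * J ^ 3 ≤ x ^ 12 / (k * u) := by
    calc k ^ 2 / u * J ^ 3 ≤ k ^ 2 / u * (x ^ 4 / k) ^ 3 := by gcongr
      _ = _ := by field_simp
  have hroot : √(Q * M * (J * (x ^ 8 / u) + k ^ 2 / u * J ^ 3))
      ≤ 2 * M * (y ^ 2 * x ^ 6 / k) := by
    refine Real.sqrt_le_iff.mpr ⟨by positivity, ?_⟩
    calc Q * M * (J * (x ^ 8 / u) + k ^ 2 / u * J ^ 3)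
        ≤ (y ^ 4 / u) * M * (x ^ 12 / (k * u) + x ^ 12 / (k * u)) := by gcongr
      _ = 2 * M * (y ^ 4 * x ^ 12) * (1 / (k * u * u)) := by field_simp; ring
      _ ≤ 2 * M * (y ^ 4 * x ^ 12) * (1 / (k * k)) := by
          have : k * k ≤ k * u * u := by nlinarith [mul_pos hk0 hu0]
          gcongr
      _ ≤ 4 * (M * M) * (y ^ 4 * x ^ 12) * (1 / (k * k)) := by
          have : 2 * M ≤ 4 * (M * M) := by nlinarith
          gcongr
      _ = _ := by field_simp; ring
  have h1 : K * I * √(Q * M * (J * (x ^ 8 / u) + k ^ 2 / u * J ^ 3))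
      ≤ 4 * (M ^ 2 * (y * x ^ 9 / k)) := by
    calc _ ≤ 2 * (x ^ 3 / y) * M * (2 * M * (y ^ 2 * x ^ 6 / k)) := by gcongr
      _ = _ := by field_simp; ring
  have h2 : J * (x ^ 8 / u) / K ≤ y * x ^ 9 / k := by
    calc J * (x ^ 8 / u) / K ≤ x ^ 12 / (k * u) / (x ^ 3 / y) := by gcongr
      _ = (y * x ^ 9 / k) / u := by field_simp
      _ ≤ y * x ^ 9 / k := div_le_self (by positivity) (by linarith)
  have h3 : y * x ^ 9 / k ≤ M ^ 2 * (y * x ^ 9 / k) :=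
    le_mul_of_one_le_left (by positivity) (one_le_pow₀ hM)
  linarith

theorem sum_abs_oscSum_le : ∃ C : ℝ, 0 < C ∧ ∀ (N D M k u Q : ℕ) (x y : ℝ),
    1 ≤ x → 1 ≤ y → x ^ 16 = N → y ^ 4 = D → y ≤ x ^ 3 → 0 < k → k ∣ u → u ∣ k ^ 2 → 0 < Q →
    Q * u ≤ D → (∀ n : ℕ, 0 < n → n ≤ (2 * N) ^ 20 → n.divisors.card ≤ M) →
    ∑ v ∈ rootPairs Q, |oscSum N k u (k ^ 2 / u) v.1 v.2| ≤ C * (M ^ 2 * (y * x ^ 9 / k)) := by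
  obtain ⟨C, hC, hcore⟩ := sum_abs_sum_saw_le
  refine ⟨C * 5, by positivity, fun N D M k u Q x y hx hy hxN hyD hyx hk hku huk hQ hQu hM => ?_⟩
  have hN1 : 1 ≤ N := by
    have : (1 : ℝ) ≤ N := by rw [← hxN]; exact one_le_pow₀ hx
    exact_mod_cast this
  have hM1 : 1 ≤ M := by simpa using hM 1 one_pos (Nat.one_le_pow _ _ (by omega))
  have hM1R : (1 : ℝ) ≤ M := by exact_mod_cast hM1
  have hkR : (0 : ℝ) < k := by exact_mod_cast hk
  have hk1 : (1 : ℝ) ≤ k := by exact_mod_cast hk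
  have hu : 0 < u := Nat.pos_of_dvd_of_pos huk (by positivity)
  have huR : (0 : ℝ) < u := by exact_mod_cast hu
  have hkuR : (k : ℝ) ≤ u := by exact_mod_cast Nat.le_of_dvd hu hku
  have hx0 : 0 < x := by linarith
  have hy0 : 0 < y := by linarith
  set J := N.sqrt.sqrt / k with hJ
  -- If `k` exceeds `N^{1/4}` the sum is empty. Otherwise `k ≤ x ^ 4`, which bounds `κ` and gives `Y
  -- ≥ 1` below.
  rcases Nat.eq_zero_or_pos J with hJ0 | hJ0
  · have : ∀ v : ℕ × ℕ, oscSum N k u (k ^ 2 / u) v.1 v.2 = 0 := fun v => by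
      unfold oscSum; rw [← hJ, hJ0]; simp
    simp only [this, abs_zero, Finset.sum_const_zero]
    positivity
  have hJ1 : (N.sqrt.sqrt : ℝ) ≤ x ^ 4 := by
    have h1 : N.sqrt.sqrt ^ 4 ≤ N := by
      rw [show 4 = 2 * 2 from rfl, pow_mul]
      exact (Nat.pow_le_pow_left (Nat.sqrt_le' _) 2).trans (Nat.sqrt_le' _)
    have h2 : (N.sqrt.sqrt : ℝ) ^ 4 ≤ (x ^ 4) ^ 4 := by
      rw [← pow_mul, hxN]; exact_mod_cast h1
    exact le_of_pow_le_pow_left₀ four_ne_zero (by positivity) h2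
  have hJk : (J : ℝ) * k ≤ x ^ 4 := by
    refine le_trans ?_ hJ1
    exact_mod_cast Nat.div_mul_le_self _ _
  have hkx : (k : ℝ) ≤ x ^ 4 := by
    have : (1 : ℝ) ≤ J := by exact_mod_cast hJ0
    nlinarith
  have hJR : (J : ℝ) ≤ x ^ 4 / k := by rwa [le_div_iff₀ hkR]
  have hsqrt : √(N : ℝ) = x ^ 8 := by
    rw [← hxN, show (16 : ℕ) = 8 * 2 from rfl, pow_mul, Real.sqrt_sq (by positivity)]
  set κ := k ^ 2 / u with hκ
  have hκu : κ * u = k ^ 2 := Nat.div_mul_cancel huk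
  have hκ0 : 0 < κ := Nat.pos_of_ne_zero fun h => by
    rw [h, zero_mul] at hκu
    have : 0 < k ^ 2 := by positivity
    omega
  have hκR : (κ : ℝ) = k ^ 2 / u := by
    rw [eq_div_iff huR.ne']; exact_mod_cast hκu
  set K := ⌈x ^ 3 / y⌉₊ with hK
  have hK0 : 1 ≤ x ^ 3 / y := by rwa [le_div_iff₀ hy0, one_mul]
  have hKpos : 0 < K := Nat.ceil_pos.mpr (by linarith)
  have hKge : x ^ 3 / y ≤ K := Nat.le_ceil _
  have hKle : (K : ℝ) ≤ 2 * (x ^ 3 / y) := by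
    have := Nat.ceil_lt_add_one (show 0 ≤ x ^ 3 / y by linarith)
    linarith
  have hxle : ∀ n, n ≤ 16 → x ^ n ≤ N := fun n hn => by
    rw [← hxN]; exact pow_le_pow_right₀ hx hn
  have hKN : K ≤ 2 * N := by
    have : x ^ 3 / y ≤ x ^ 3 := div_le_self (by positivity) hy
    have h3 := hxle 3 (by norm_num)
    have : (K : ℝ) ≤ 2 * N := by linarith
    exact_mod_cast this
  have hDN : D ≤ N := by
    have : (D : ℝ) ≤ N := by
      rw [← hyD, ← hxN]
      calc y ^ 4 ≤ (x ^ 3) ^ 4 := by gcongr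
        _ = x ^ 12 := by ring
        _ ≤ x ^ 16 := pow_le_pow_right₀ hx (by norm_num)
    exact_mod_cast this
  have hQD : Q ≤ D := le_trans (Nat.le_mul_of_pos_right Q hu) hQu
  -- As `Y ≥ 1`, having `2 ^ I` beyond `Q ^ 2 * K ^ 3` makes the truncated Fourier tail acceptable.
  set I := Nat.log 2 (Q ^ 2 * K ^ 3) + 1 with hI
  have hI1 : Q ^ 2 * K ^ 3 < 2 ^ I := Nat.lt_pow_succ_log_self (by norm_num) _
  have hI2 : 2 ^ I ≤ (2 * N) ^ 6 := by
    have h1 : 2 ^ Nat.log 2 (Q ^ 2 * K ^ 3) ≤ Q ^ 2 * K ^ 3 := Nat.pow_log_le_self 2 (by positivity)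
    calc 2 ^ I = 2 * 2 ^ Nat.log 2 (Q ^ 2 * K ^ 3) := by rw [hI, pow_succ']
      _ ≤ 2 * (N ^ 2 * (2 * N) ^ 3) := by
          refine Nat.mul_le_mul_left 2 (h1.trans ?_)
          have := hQD.trans hDN
          gcongr
      _ = 16 * N ^ 5 := by ring
      _ ≤ 64 * N ^ 6 := by
          have : N ^ 5 ≤ N ^ 6 := Nat.pow_le_pow_right hN1 (by norm_num)
          omega
      _ = (2 * N) ^ 6 := by ring
  have h2N : ∀ a b : ℕ, a ≤ b → (2 * N) ^ a ≤ (2 * N) ^ b := fun a b h =>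
    Nat.pow_le_pow_right (by omega) h
  have hIM : (I : ℝ) ≤ M := by
    have := succ_le_of_card_divisors_le hM (hI2.trans (h2N 6 20 (by norm_num)))
    exact_mod_cast (by omega : I ≤ M)
  have hκJ : κ * J ^ 2 ≤ (2 * N) ^ 4 := by
    have h1 : κ ≤ N ^ 2 := by
      have h2 : κ ≤ k ^ 2 := Nat.div_le_self _ _
      have h3 : k ≤ N := by
        have := hkx.trans (hxle 4 (by norm_num))
        exact_mod_cast this
      exact h2.trans (Nat.pow_le_pow_left h3 2)
    have h2 : J ≤ N := (Nat.div_le_self _ _).trans ((Nat.sqrt_le_self _).trans (Nat.sqrt_le_self _))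
    calc κ * J ^ 2 ≤ N ^ 2 * N ^ 2 := by gcongr
      _ = N ^ 4 := by ring
      _ ≤ (2 * N) ^ 4 := Nat.pow_le_pow_left (by omega) 4
  set Y : ℝ := x ^ 8 / u with hY
  have hY1 : 1 ≤ Y := by
    rw [hY, le_div_iff₀ huR, one_mul]
    have h1 : (u : ℝ) ≤ k ^ 2 := by exact_mod_cast Nat.le_of_dvd (by positivity) huk
    calc (u : ℝ) ≤ k ^ 2 := h1
      _ ≤ (x ^ 4) ^ 2 := by gcongr
      _ = x ^ 8 := by ring
  have hmain := hcore Q J κ I M K Y (fun j => width N (k * j) / u) hQ hκ0 hKpos (by linarith)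
    (fun j => div_nonneg (width_nonneg _ _) huR.le)
    (fun j => by
      rw [hY, ← hsqrt]
      exact div_le_div_of_nonneg_right (width_le _ _) huR.le)
    (by
      have h1 : (Q : ℝ) ^ 2 * K ^ 3 ≤ 2 ^ I := by exact_mod_cast hI1.le
      have h2 : (1 : ℝ) ≤ Y ^ 2 := one_le_pow₀ hY1
      have h3 : (0 : ℝ) < 2 ^ I := by positivity
      nlinarith)
    (fun n hn hn' => hM n hn (hn'.trans (by
      rw [mul_assoc]
      calc 2 ^ I * (κ * J ^ 2) ≤ (2 * N) ^ 6 * (2 * N) ^ 4 := by gcongr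
        _ = (2 * N) ^ 10 := by ring
        _ ≤ _ := h2N 10 20 (by norm_num))))
  refine hmain.trans ?_
  rw [mul_assoc C 5]
  refine mul_le_mul_of_nonneg_left ?_ hC.le
  have hQR : (Q : ℝ) ≤ y ^ 4 / u := by
    rw [le_div_iff₀ huR, hyD]; exact_mod_cast hQu
  have hb := dispersion_bound hx0 hy0 hk1 hkuR hM1R hQR (Nat.cast_nonneg J) hJR
    hKge hKle (Nat.cast_nonneg I) hIM
  rw [← hκR, ← hY] at hb
  exact hb

theorem sum_rootPairs_eq (Q : ℕ) (f : ℕ → ℕ → ℝ) :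
    ∑ v ∈ rootPairs Q, f v.1 v.2 = ∑ q ∈ Finset.Ico Q (2 * Q), ∑ ν ∈ roots q, f q ν := by
  refine Finset.sum_finset_product' _ _ _ fun v => ?_
  rw [mem_rootPairs]
  simp only [roots, Finset.mem_Ico, Finset.mem_filter, Finset.mem_range]
  tauto

theorem sum_rho_eq (Q : ℕ) (hQ : 0 < Q) :
    ∑ q ∈ Finset.Ico Q (2 * Q), (rho q : ℝ) = (rootPairs Q).card := by
  have h := sum_rootPairs_eq Q fun _ _ => 1
  simp only [Finset.sum_const, nsmul_eq_mul, mul_one] at h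
  rw [h]
  refine Finset.sum_congr rfl fun q hq => ?_
  rw [rho_eq_card_roots (by have := (Finset.mem_Ico.mp hq).1; omega)]

/-- Dyadic blocks of `q`, with `M` paying for their number. The terms without oscillation are small
enough because `Q k ≤ D = y⁴ ≤ y x⁹` and `√N = x⁸`. -/
theorem sum_termError_le : ∃ C : ℝ, 0 < C ∧ ∀ (N D M k u : ℕ) (x y : ℝ),
    1 ≤ x → 1 ≤ y → x ^ 16 = N → y ^ 4 = D → y ≤ x ^ 3 → 0 < k → k ∣ u → u ∣ k ^ 2 →
    (∀ n : ℕ, 0 < n → n ≤ (2 * N) ^ 20 → n.divisors.card ≤ M) →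
    ∑ q ∈ Finset.Icc 1 (D / u), termError N k u q ≤ C * (M ^ 3 * (y * x ^ 9 / k)) := by
  obtain ⟨C₁, hC₁, hosc⟩ := sum_abs_oscSum_le
  obtain ⟨C₂, hC₂, hcard⟩ := card_rootPairs_le
  refine ⟨3 * C₂ + 2 * C₁, by positivity,
    fun N D M k u x y hx hy hxN hyD hyx hk hku huk hM => ?_⟩
  have hN1 : 1 ≤ N := by
    have : (1 : ℝ) ≤ N := by rw [← hxN]; exact one_le_pow₀ hx
    exact_mod_cast this
  have hM1 : 1 ≤ M := by simpa using hM 1 one_pos (Nat.one_le_pow _ _ (by omega))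
  have hM1R : (1 : ℝ) ≤ M := by exact_mod_cast hM1
  have hkR : (0 : ℝ) < k := by exact_mod_cast hk
  have hu : 0 < u := Nat.pos_of_dvd_of_pos huk (by positivity)
  have huR : (0 : ℝ) < u := by exact_mod_cast hu
  have hkuR : (k : ℝ) ≤ u := by exact_mod_cast Nat.le_of_dvd hu hku
  have hx0 : 0 < x := by linarith
  have hy0 : 0 < y := by linarith
  have hsqrt : √(N : ℝ) = x ^ 8 := by
    rw [← hxN, show (16 : ℕ) = 8 * 2 from rfl, pow_mul, Real.sqrt_sq (by positivity)]
  have hDN : D ≤ N := by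
    have : (D : ℝ) ≤ N := by
      rw [← hyD, ← hxN]
      calc y ^ 4 ≤ (x ^ 3) ^ 4 := by gcongr
        _ = x ^ 12 := by ring
        _ ≤ x ^ 16 := pow_le_pow_right₀ hx (by norm_num)
    exact_mod_cast this
  set Z := y * x ^ 9 / k with hZ
  have hZ0 : 0 ≤ Z := by positivity
  have hMZ : Z ≤ M ^ 2 * Z := le_mul_of_one_le_left hZ0 (one_le_pow₀ hM1R)
  have hblock : ∀ Q : ℕ, 0 < Q → Q ≤ D / u → ∑ q ∈ Finset.Ico Q (2 * Q), termError N k u q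
      ≤ (3 * C₂ + 2 * C₁) * (M ^ 2 * Z) := by
    intro Q hQ hQD
    have hQu : Q * u ≤ D := (Nat.le_div_iff_mul_le hu).mp hQD
    have hQR : (0 : ℝ) < Q := by exact_mod_cast hQ
    have hc : ((rootPairs Q).card : ℝ) ≤ C₂ * Q := hcard Q hQ
    have a1 : ∑ q ∈ Finset.Ico Q (2 * Q), (rho q : ℝ) ≤ C₂ * Z := by
      rw [sum_rho_eq Q hQ]
      refine hc.trans (mul_le_mul_of_nonneg_left ?_ hC₂.le)
      rw [hZ, le_div_iff₀ hkR]
      calc (Q : ℝ) * k ≤ Q * u := by gcongr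
        _ ≤ y ^ 4 := by rw [hyD]; exact_mod_cast hQu
        _ = y * y ^ 3 := by ring
        _ ≤ y * (x ^ 3) ^ 3 := by gcongr
        _ = y * x ^ 9 := by ring
    have a2 : ∑ q ∈ Finset.Ico Q (2 * Q), 2 * (rho q : ℝ) * √N / (u * q) ≤ 2 * C₂ * Z := by
      calc _ ≤ ∑ q ∈ Finset.Ico Q (2 * Q), (2 * √N / (u * Q)) * (rho q : ℝ) := by
            refine Finset.sum_le_sum fun q hq => ?_
            have hq' : (Q : ℝ) ≤ q := by exact_mod_cast (Finset.mem_Ico.mp hq).1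
            calc 2 * (rho q : ℝ) * √N / (u * q) ≤ 2 * (rho q : ℝ) * √N / (u * Q) := by gcongr
              _ = _ := by ring
        _ = (2 * √N / (u * Q)) * (rootPairs Q).card := by rw [← Finset.mul_sum, sum_rho_eq Q hQ]
        _ ≤ (2 * √N / (u * Q)) * (C₂ * Q) := by gcongr
        _ = 2 * C₂ * (x ^ 8 / u) := by rw [hsqrt]; field_simp
        _ ≤ 2 * C₂ * Z := by
            rw [hZ]
            have : x ^ 8 ≤ y * x ^ 9 := by
              have h1 : x ^ 8 ≤ x ^ 9 := pow_le_pow_right₀ hx (by norm_num)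
              have h2 : 0 < x ^ 9 := by positivity
              nlinarith
            gcongr
    have a3 : ∑ q ∈ Finset.Ico Q (2 * Q), 2 * ∑ ν ∈ roots q, |oscSum N k u (k ^ 2 / u) q ν|
        ≤ 2 * C₁ * (M ^ 2 * Z) := by
      rw [← Finset.mul_sum, ← sum_rootPairs_eq Q fun q ν => |oscSum N k u (k ^ 2 / u) q ν|,
        mul_assoc]
      exact mul_le_mul_of_nonneg_left
        (hosc N D M k u Q x y hx hy hxN hyD hyx hk hku huk hQ hQu hM) (by norm_num)
    unfold termError
    rw [Finset.sum_add_distrib, Finset.sum_add_distrib]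
    nlinarith
  rcases Nat.eq_zero_or_pos (D / u) with h0 | h0
  · rw [h0]; simp only [Finset.Icc_eq_empty_of_lt one_pos, Finset.sum_empty]; positivity
  set i₀ := Nat.log 2 (D / u) + 1 with hi₀
  have hlog : 2 ^ Nat.log 2 (D / u) ≤ D / u := Nat.pow_log_le_self 2 h0.ne'
  have hi₀M : (i₀ : ℝ) ≤ M := by
    have h1 : 2 ^ Nat.log 2 (D / u) ≤ (2 * N) ^ 20 := by
      refine hlog.trans ((Nat.div_le_self _ _).trans (hDN.trans ?_))
      calc N ≤ 2 * N := by omega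
        _ = (2 * N) ^ 1 := (pow_one _).symm
        _ ≤ _ := Nat.pow_le_pow_right (by omega) (by norm_num)
    exact_mod_cast succ_le_of_card_divisors_le hM h1
  -- The value at `q = 0` is set to zero, since the dyadic blocks start at `1` while the range
  -- starts at `0`.
  set f : ℕ → ℝ := fun q => if q = 0 then 0 else termError N k u q with hf
  have hf0 : ∀ q, 0 ≤ f q := fun q => by
    simp only [hf]; split_ifs
    · exact le_rfl
    · exact termError_nonneg _ _ _ _
  calc ∑ q ∈ Finset.Icc 1 (D / u), termError N k u q
      = ∑ q ∈ Finset.Icc 1 (D / u), f q := by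
        refine Finset.sum_congr rfl fun q hq => ?_
        have := (Finset.mem_Icc.mp hq).1
        simp only [hf]; rw [if_neg (by omega)]
    _ ≤ ∑ q ∈ Finset.range (2 ^ i₀), f q := by
        refine Finset.sum_le_sum_of_subset_of_nonneg (fun q hq => ?_) fun q _ _ => hf0 q
        have h1 := (Finset.mem_Icc.mp hq).2
        have h2 : D / u < 2 ^ i₀ := Nat.lt_pow_succ_log_self (by norm_num) _
        exact Finset.mem_range.mpr (by omega)
    _ = ∑ i ∈ Finset.range i₀, ∑ q ∈ Finset.Ico (2 ^ i) (2 * 2 ^ i), f q :=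
        sum_range_two_pow_eq f (by simp [hf]) i₀
    _ ≤ ∑ i ∈ Finset.range i₀, (3 * C₂ + 2 * C₁) * (M ^ 2 * Z) := by
        refine Finset.sum_le_sum fun i hi => ?_
        have hi' := Finset.mem_range.mp hi
        refine le_trans (le_of_eq ?_) (hblock (2 ^ i) (by positivity)
          ((Nat.pow_le_pow_right (by norm_num) (by omega)).trans hlog))
        refine Finset.sum_congr rfl fun q hq => ?_
        have h1 := (Finset.mem_Ico.mp hq).1
        have h2 : 0 < 2 ^ i := by positivity
        simp only [hf]; rw [if_neg (by omega)]
    _ = i₀ * ((3 * C₂ + 2 * C₁) * (M ^ 2 * Z)) := by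
        rw [Finset.sum_const, Finset.card_range, nsmul_eq_mul]
    _ ≤ M * ((3 * C₂ + 2 * C₁) * (M ^ 2 * Z)) := by gcongr
    _ = _ := by ring


/-! ### Summation over all moduli -/

theorem sum_one_div_le {M B D : ℕ} (hM : ∀ n : ℕ, 0 < n → n ≤ B → n.divisors.card ≤ M)
    (hD : 0 < D) (hDB : D ≤ B) : ∑ k ∈ Finset.Icc 1 D, 1 / (k : ℝ) ≤ 2 * M := by
  have h1 : ∑ k ∈ Finset.Icc 1 D, 1 / (k : ℝ) = (harmonic D : ℝ) := by
    rw [harmonic_eq_sum_Icc]; push_cast; simp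
  have h2 := harmonic_le_one_add_log D
  set i := Nat.log 2 D with hi
  have h3 : i + 1 ≤ M :=
    succ_le_of_card_divisors_le hM ((Nat.pow_log_le_self 2 hD.ne').trans hDB)
  have h3R : (i : ℝ) + 1 ≤ M := by exact_mod_cast h3
  have h4 : Real.log D ≤ (i + 1) * Real.log 2 := by
    have h5 : (D : ℝ) ≤ 2 ^ (i + 1) := by
      exact_mod_cast (Nat.lt_pow_succ_log_self (by norm_num) D).le
    have h6 := Real.log_le_log (by exact_mod_cast hD) h5
    rw [Real.log_pow] at h6
    exact_mod_cast h6
  have h7 : Real.log 2 ≤ 1 := by linarith [Real.log_two_lt_d9]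
  have h8 : (0 : ℝ) ≤ i := by positivity
  rw [h1]
  nlinarith

-- A tuple determines `d = m q`, so tuples of different `d` are distinct and may be summed freely.
-- The range of `q` is `D / u` because `u ≤ m`; `m` itself is only counted, as a divisor of `k²`.
open Classical in
theorem sum_tuples_le {D : ℕ} (F : ℕ → ℕ → ℕ → ℝ) (hF : ∀ k u q, 0 ≤ F k u q) :
    ∑ d ∈ Finset.Icc 1 D, ∑ v ∈ tuples d, F v.1 v.2.1 v.2.2.2
      ≤ ∑ k ∈ Finset.Icc 1 D, ∑ u ∈ (k ^ 2).divisors.filter (fun u => k ∣ u),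
        ∑ _m ∈ (k ^ 2).divisors, ∑ q ∈ Finset.Icc 1 (D / u), F k u q := by
  have hdisj : (↑(Finset.Icc 1 D) : Set ℕ).PairwiseDisjoint tuples := by
    intro d hd e he hde
    rw [Function.onFun, Finset.disjoint_left]
    intro v hv hv'
    have hd' := (Finset.mem_Icc.mp hd).1
    have he' := (Finset.mem_Icc.mp he).1
    exact hde (((mem_tuples (by omega)).mp hv).1.symm.trans ((mem_tuples (by omega)).mp hv').1)
  rw [← Finset.sum_biUnion hdisj]
  have hR : ∑ k ∈ Finset.Icc 1 D, ∑ u ∈ (k ^ 2).divisors.filter (fun u => k ∣ u),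
        ∑ _m ∈ (k ^ 2).divisors, ∑ q ∈ Finset.Icc 1 (D / u), F k u q
      = ∑ w ∈ (Finset.Icc 1 D).sigma fun k => ((k ^ 2).divisors.filter (fun u => k ∣ u)).sigma
          fun u => (k ^ 2).divisors ×ˢ Finset.Icc 1 (D / u), F w.1 w.2.1 w.2.2.2 := by
    rw [Finset.sum_sigma]
    refine Finset.sum_congr rfl fun k _ => ?_
    rw [Finset.sum_sigma]
    refine Finset.sum_congr rfl fun u _ => ?_
    rw [Finset.sum_product]
  rw [hR]
  set X := (Finset.Icc 1 D).sigma fun k => ((k ^ 2).divisors.filter (fun u => k ∣ u)).sigma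
          fun u => (k ^ 2).divisors ×ˢ Finset.Icc 1 (D / u) with hX
  set φ : ℕ × ℕ × ℕ × ℕ → (_ : ℕ) × (_ : ℕ) × (ℕ × ℕ) := fun v => ⟨v.1, v.2.1, v.2.2⟩ with hφ
  have hinj : Function.Injective φ := by
    rintro ⟨a, b, c, d⟩ ⟨a', b', c', d'⟩ h
    simp only [hφ, Sigma.mk.injEq, heq_eq_eq] at h
    obtain ⟨rfl, rfl, h⟩ := h
    simp only [Prod.mk.injEq] at h
    obtain ⟨rfl, rfl⟩ := h
    rfl
  have himg : ∑ v ∈ (Finset.Icc 1 D).biUnion tuples, F v.1 v.2.1 v.2.2.2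
      = ∑ w ∈ ((Finset.Icc 1 D).biUnion tuples).image φ, F w.1 w.2.1 w.2.2.2 := by
    rw [Finset.sum_image hinj.injOn]
  rw [himg]
  refine Finset.sum_le_sum_of_subset_of_nonneg ?_ fun w _ _ => hF _ _ _
  intro w hw
  obtain ⟨v, hv, rfl⟩ := Finset.mem_image.mp hw
  obtain ⟨d, hd, hvd⟩ := Finset.mem_biUnion.mp hv
  obtain ⟨d1, d2⟩ := Finset.mem_Icc.mp hd
  obtain ⟨h1, h2, h3, h4⟩ := (mem_tuples d1).mp hvd
  have hm : 0 < v.2.2.1 := Nat.pos_of_ne_zero fun h => by rw [h, zero_mul] at h1; omega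
  have hq : 0 < v.2.2.2 := Nat.pos_of_ne_zero fun h => by rw [h, mul_zero] at h1; omega
  have hu : 0 < v.2.1 := Nat.pos_of_dvd_of_pos h3 hm
  have hk : 0 < v.1 := Nat.pos_of_dvd_of_pos h2 hu
  have hk2 : v.1 ^ 2 ≠ 0 := by positivity
  have hum : v.2.1 ≤ v.2.2.1 := Nat.le_of_dvd hm h3
  have hmd : v.2.2.1 ≤ d := Nat.le_of_dvd d1 (Dvd.intro _ h1)
  have hku : v.1 ≤ v.2.1 := Nat.le_of_dvd hu h2
  simp only [hX, hφ, Finset.mem_sigma, Finset.mem_Icc, Finset.mem_filter, Nat.mem_divisors,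
    Finset.mem_product]
  refine ⟨⟨hk, by omega⟩, ⟨⟨h3.trans h4, hk2⟩, h2⟩, ⟨h4, hk2⟩, hq, ?_⟩
  rw [Nat.le_div_iff_mul_le hu]
  calc v.2.2.2 * v.2.1 ≤ v.2.2.2 * v.2.2.1 := Nat.mul_le_mul_left _ hum
    _ = d := by rw [mul_comm]; exact h1
    _ ≤ D := d2

/-- The remainder sum in terms of a bound `M` for the divisor function. -/
theorem remainderSum_le : ∃ C : ℝ, 0 < C ∧ ∀ (M D : ℕ) (t x y : ℝ),
    1 ≤ x → 1 ≤ y → x ^ 16 = ⌊t⌋₊ → y ^ 4 = D → y ≤ x ^ 3 →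
    (∀ n : ℕ, 0 < n → n ≤ (2 * ⌊t⌋₊) ^ 20 → n.divisors.card ≤ M) →
    remainderSum D t ≤ C * (M ^ 8 * (y * x ^ 9)) := by
  classical
  obtain ⟨C, hC, hterm⟩ := sum_termError_le
  refine ⟨2 * C + 13, by positivity, fun M D t x y hx hy hxN hyD hyx hM => ?_⟩
  set N := ⌊t⌋₊ with hN
  have hN1 : 1 ≤ N := by
    have : (1 : ℝ) ≤ N := by rw [← hxN]; exact one_le_pow₀ hx
    exact_mod_cast this
  have hD1 : 1 ≤ D := by
    have : (1 : ℝ) ≤ D := by rw [← hyD]; exact one_le_pow₀ hy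
    exact_mod_cast this
  have hM1 : 1 ≤ M := by simpa using hM 1 one_pos (Nat.one_le_pow _ _ (by omega))
  have hM1R : (1 : ℝ) ≤ M := by exact_mod_cast hM1
  have hx0 : 0 < x := by linarith
  have hy0 : 0 < y := by linarith
  have hsqrt : √(N : ℝ) = x ^ 8 := by
    rw [← hxN, show (16 : ℕ) = 8 * 2 from rfl, pow_mul, Real.sqrt_sq (by positivity)]
  have hDN : D ≤ N := by
    have : (D : ℝ) ≤ N := by
      rw [← hyD, ← hxN]
      calc y ^ 4 ≤ (x ^ 3) ^ 4 := by gcongr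
        _ = x ^ 12 := by ring
        _ ≤ x ^ 16 := pow_le_pow_right₀ hx (by norm_num)
    exact_mod_cast this
  have hD2 : D ^ 2 ≤ (2 * N) ^ 20 := by
    calc D ^ 2 ≤ (2 * N) ^ 2 := Nat.pow_le_pow_left (by omega) 2
      _ ≤ _ := Nat.pow_le_pow_right (by omega) (by norm_num)
  have hD1' : D ≤ (2 * N) ^ 20 := (Nat.le_self_pow two_ne_zero D).trans hD2
  have hτ : ∀ d ∈ Finset.Icc 1 D, (d.divisors.card : ℝ) ≤ M := fun d hd => by
    obtain ⟨h1, h2⟩ := Finset.mem_Icc.mp hd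
    exact_mod_cast hM d h1 (h2.trans hD1')
  have hτ2 : ∀ d ∈ Finset.Icc 1 D, ((d ^ 2).divisors.card : ℝ) ≤ M := fun d hd => by
    obtain ⟨h1, h2⟩ := Finset.mem_Icc.mp hd
    exact_mod_cast hM (d ^ 2) (by positivity) ((Nat.pow_le_pow_left h2 2).trans hD2)
  set Z := y * x ^ 9 with hZ
  have hZ0 : 0 ≤ Z := by positivity
  have hharm := sum_one_div_le hM hD1 hD1'
  -- the oscillating terms
  have hosc : ∑ d ∈ Finset.Icc 1 D, ∑ v ∈ tuples d, termError N v.1 v.2.1 v.2.2.2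
      ≤ 2 * C * (M ^ 6 * Z) := by
    refine (sum_tuples_le (termError N) (termError_nonneg N)).trans ?_
    calc _ ≤ ∑ k ∈ Finset.Icc 1 D, (M : ℝ) * (M * (C * (M ^ 3 * (Z / k)))) := by
          refine Finset.sum_le_sum fun k hk => ?_
          have hk1 := (Finset.mem_Icc.mp hk).1
          have hcardu : (((k ^ 2).divisors.filter (fun u => k ∣ u)).card : ℝ) ≤ M :=
            le_trans (by exact_mod_cast Finset.card_filter_le _ _) (hτ2 k hk)
          have hpos : 0 ≤ C * (M ^ 3 * (Z / k)) := by positivity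
          refine (Finset.sum_le_card_nsmul _ _ (M * (C * (M ^ 3 * (Z / k)))) fun u hu => ?_).trans
            (by rw [nsmul_eq_mul]; gcongr)
          simp only [Finset.mem_filter, Nat.mem_divisors] at hu
          refine (Finset.sum_le_card_nsmul _ _ (C * (M ^ 3 * (Z / k))) fun m _ => ?_).trans
            (by rw [nsmul_eq_mul]; exact mul_le_mul_of_nonneg_right (hτ2 k hk) hpos)
          exact hterm N D M k u x y hx hy hxN hyD hyx hk1 hu.2 hu.1.1 hM
      _ = C * (M ^ 5 * Z) * ∑ k ∈ Finset.Icc 1 D, 1 / (k : ℝ) := by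
          rw [Finset.mul_sum]
          refine Finset.sum_congr rfl fun k _ => by ring
      _ ≤ C * (M ^ 5 * Z) * (2 * M) := by gcongr
      _ = _ := by ring
  have hDZ : (D : ℝ) ≤ Z := by
    rw [← hyD, hZ]
    calc y ^ 4 = y * y ^ 3 := by ring
      _ ≤ y * (x ^ 3) ^ 3 := by gcongr
      _ = y * x ^ 9 := by ring
  have hNZ : √(N : ℝ) ≤ Z := by
    rw [hsqrt, hZ]
    have h1 : x ^ 8 ≤ x ^ 9 := pow_le_pow_right₀ hx (by norm_num)
    have h2 : 0 < x ^ 9 := by positivity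
    nlinarith
  have hM8 : ∀ n, n ≤ 8 → (M : ℝ) ^ n * Z ≤ M ^ 8 * Z := fun n hn =>
    mul_le_mul_of_nonneg_right (pow_le_pow_right₀ hM1R hn) hZ0
  unfold remainderSum
  rw [Nat.floor_natCast]
  calc ∑ d ∈ Finset.Icc 1 D with Cubefree d, |remainder d t|
      ≤ ∑ d ∈ Finset.Icc 1 D with Cubefree d,
          ((M : ℝ) ^ 2 * ∑ v ∈ tuples d, termError N v.1 v.2.1 v.2.2.2 + 1
            + 6 * √N * (M * (1 / d))) := by
        refine Finset.sum_le_sum fun d hd => ?_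
        obtain ⟨hd1, hd2⟩ := Finset.mem_filter.mp hd
        refine (abs_remainder_le hN1 (Finset.mem_Icc.mp hd1).1 hd2).trans ?_
        have h0 : 0 ≤ ∑ v ∈ tuples d, termError N v.1 v.2.1 v.2.2.2 :=
          Finset.sum_nonneg fun v _ => termError_nonneg _ _ _ _
        have h1 := hτ d hd1
        rw [mul_one_div]
        gcongr
    _ ≤ ∑ d ∈ Finset.Icc 1 D,
          ((M : ℝ) ^ 2 * ∑ v ∈ tuples d, termError N v.1 v.2.1 v.2.2.2 + 1
            + 6 * √N * (M * (1 / d))) := by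
        refine Finset.sum_le_sum_of_subset_of_nonneg (Finset.filter_subset _ _) fun d _ _ => ?_
        have h0 : 0 ≤ ∑ v ∈ tuples d, termError N v.1 v.2.1 v.2.2.2 :=
          Finset.sum_nonneg fun v _ => termError_nonneg _ _ _ _
        positivity
    _ = (M : ℝ) ^ 2 * (∑ d ∈ Finset.Icc 1 D, ∑ v ∈ tuples d, termError N v.1 v.2.1 v.2.2.2) + D
          + 6 * √N * (M * ∑ d ∈ Finset.Icc 1 D, 1 / (d : ℝ)) := by
        rw [Finset.sum_add_distrib, Finset.sum_add_distrib, ← Finset.mul_sum, ← Finset.mul_sum,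
          ← Finset.mul_sum]
        simp
    _ ≤ (M : ℝ) ^ 2 * (2 * C * (M ^ 6 * Z)) + Z + 6 * Z * (M * (2 * M)) := by gcongr
    _ = 2 * C * (M ^ 8 * Z) + M ^ 0 * Z + 12 * (M ^ 2 * Z) := by ring
    _ ≤ 2 * C * (M ^ 8 * Z) + M ^ 8 * Z + 12 * (M ^ 8 * Z) := by
        have := hM8 0 (by norm_num)
        have := hM8 2 (by norm_num)
        linarith
    _ = _ := by ring


/-! ### The divisor bound -/

/-- Compare `v + 1` with `p^{v ε}` at each prime power. Primes above `2^{1/ε}` need no constant, and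
each of the boundedly many smaller ones costs at most a fixed factor `K`. -/
theorem exists_card_divisors_le {ε : ℝ} (hε : 0 < ε) :
    ∃ C : ℝ, 1 ≤ C ∧ ∀ n : ℕ, 0 < n → (n.divisors.card : ℝ) ≤ C * (n : ℝ) ^ ε := by
  set K : ℝ := max 1 (1 / (ε * Real.log 2)) with hK
  have hlog2 : 0 < Real.log 2 := Real.log_pos one_lt_two
  have hK1 : 1 ≤ K := le_max_left _ _
  have hK2 : 1 ≤ K * (ε * Real.log 2) := by
    have : 1 / (ε * Real.log 2) ≤ K := le_max_right _ _
    rwa [div_le_iff₀ (by positivity)] at this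
  set P : ℕ := ⌈(2 : ℝ) ^ (1 / ε)⌉₊ with hP
  have hsmall : ∀ p v : ℕ, 2 ≤ p → ((v + 1 : ℕ) : ℝ) ≤ K * ((p ^ v : ℕ) : ℝ) ^ ε := by
    intro p v hp
    have h1 : ((2 : ℝ) ^ v) ^ ε ≤ ((p ^ v : ℕ) : ℝ) ^ ε := by
      push_cast
      have : (2 : ℝ) ≤ p := by exact_mod_cast hp
      gcongr
    have h2 : 1 + v * (ε * Real.log 2) ≤ ((2 : ℝ) ^ v) ^ ε := by
      rw [Real.rpow_def_of_pos (by positivity), Real.log_pow]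
      have := Real.add_one_le_exp (v * Real.log 2 * ε)
      linarith
    have h3 : (0 : ℝ) ≤ v := by positivity
    calc ((v + 1 : ℕ) : ℝ) = v + 1 := by push_cast; ring
      _ ≤ K * (1 + v * (ε * Real.log 2)) := by nlinarith
      _ ≤ _ := by gcongr; exact h2.trans h1
  have hlarge : ∀ p v : ℕ, P ≤ p → ((v + 1 : ℕ) : ℝ) ≤ ((p ^ v : ℕ) : ℝ) ^ ε := by
    intro p v hp
    have h1 : (2 : ℝ) ^ (1 / ε) ≤ p := (Nat.le_ceil _).trans (by exact_mod_cast hp)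
    have h2 : (2 : ℝ) ≤ (p : ℝ) ^ ε := by
      calc (2 : ℝ) = ((2 : ℝ) ^ (1 / ε)) ^ ε := by
            rw [← Real.rpow_mul (by norm_num), one_div_mul_cancel hε.ne', Real.rpow_one]
        _ ≤ _ := by gcongr
    calc ((v + 1 : ℕ) : ℝ) ≤ ((2 ^ v : ℕ) : ℝ) := by exact_mod_cast Nat.lt_two_pow_self
      _ = (2 : ℝ) ^ v := by push_cast; ring
      _ ≤ ((p : ℝ) ^ ε) ^ v := by gcongr
      _ = _ := by
          push_cast
          rw [← Real.rpow_natCast, ← Real.rpow_mul (by positivity), mul_comm,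
            Real.rpow_mul (by positivity), Real.rpow_natCast]
  refine ⟨K ^ P, one_le_pow₀ hK1, fun n hn => ?_⟩
  have hprod : (n : ℝ) ^ ε = ∏ p ∈ n.primeFactors, ((p ^ n.factorization p : ℕ) : ℝ) ^ ε := by
    rw [Real.finsetProd_rpow _ _ fun _ _ => by positivity]
    congr 1
    have h := Nat.prod_factorization_pow_eq_self hn.ne'
    conv_lhs => rw [← h]
    rw [Finsupp.prod, Nat.support_factorization]
    push_cast; rfl
  set c : ℕ → ℝ := fun p => if p < P then K else 1 with hc
  have hc1 : ∀ p, 1 ≤ c p := fun p => by simp only [hc]; split_ifs <;> [exact hK1; exact le_rfl]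
  have hcprod : ∏ p ∈ n.primeFactors, c p ≤ K ^ P := by
    have h1 : ∏ p ∈ n.primeFactors, c p ≤ ∏ p ∈ n.primeFactors ∪ Finset.range P, c p :=
      Finset.prod_le_prod_of_subset_of_one_le Finset.subset_union_left
        (fun p _ => zero_le_one.trans (hc1 p)) fun p _ _ => hc1 p
    have h2 : ∏ p ∈ n.primeFactors ∪ Finset.range P, c p = ∏ p ∈ Finset.range P, c p := by
      symm
      refine Finset.prod_subset Finset.subset_union_right fun p _ hp => ?_
      simp only [hc]
      rw [if_neg (by simpa using hp)]
    have h3 : ∏ p ∈ Finset.range P, c p = K ^ P := by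
      rw [Finset.prod_congr rfl (fun p hp => by
        simp only [hc]; rw [if_pos (Finset.mem_range.mp hp)]), Finset.prod_const, Finset.card_range]
    rw [← h3, ← h2]; exact h1
  rw [Nat.card_divisors hn.ne', hprod]
  push_cast
  calc ∏ p ∈ n.primeFactors, ((n.factorization p : ℝ) + 1)
      ≤ ∏ p ∈ n.primeFactors, c p * ((p ^ n.factorization p : ℕ) : ℝ) ^ ε := by
        refine Finset.prod_le_prod (fun p _ => by positivity) fun p hp => ?_
        have hp2 := (Nat.prime_of_mem_primeFactors hp).two_le
        have e : ((n.factorization p + 1 : ℕ) : ℝ) = n.factorization p + 1 := by push_cast; ring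
        rw [← e]
        simp only [hc]
        split_ifs with h
        · exact hsmall p _ hp2
        · rw [one_mul]; exact hlarge p _ (not_lt.mp h)
    _ = (∏ p ∈ n.primeFactors, c p) * ∏ p ∈ n.primeFactors,
          ((p ^ n.factorization p : ℕ) : ℝ) ^ ε := Finset.prod_mul_distrib
    _ ≤ K ^ P * ∏ p ∈ n.primeFactors, ((p ^ n.factorization p : ℕ) : ℝ) ^ ε := by gcongr
    _ = _ := by push_cast; rfl

/-! ### The size of `A(x)` and the trivial bound -/

theorem total_nonneg (t : ℝ) : 0 ≤ total t := Finset.sum_nonneg fun _ _ => by positivity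

theorem natSqrt_sqrt_le {N : ℕ} {x : ℝ} (hx : 1 ≤ x) (hxN : x ^ 16 = N) :
    (N.sqrt.sqrt : ℝ) ≤ x ^ 4 := by
  have h1 : N.sqrt.sqrt ^ 4 ≤ N := by
    rw [show 4 = 2 * 2 from rfl, pow_mul]
    exact (Nat.pow_le_pow_left (Nat.sqrt_le' _) 2).trans (Nat.sqrt_le' _)
  have h2 : (N.sqrt.sqrt : ℝ) ^ 4 ≤ (x ^ 4) ^ 4 := by
    rw [← pow_mul, hxN]; exact_mod_cast h1
  exact le_of_pow_le_pow_left₀ four_ne_zero (by positivity) h2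

theorem total_le {t x : ℝ} (hx : 1 ≤ x) (hxN : x ^ 16 = ⌊t⌋₊) : total t ≤ 12 * x ^ 12 := by
  set N := ⌊t⌋₊ with hN
  have hN1 : 1 ≤ N := by
    have : (1 : ℝ) ≤ N := by rw [← hxN]; exact one_le_pow₀ hx
    exact_mod_cast this
  have hsqrt : √(N : ℝ) = x ^ 8 := by
    rw [← hxN, show (16 : ℕ) = 8 * 2 from rfl, pow_mul, Real.sqrt_sq (by positivity)]
  have h1 := (abs_le.mp (abs_total_sub_le (t := t) hN1)).2
  rw [← hN, hsqrt] at h1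
  have h2 : widthSum N 1 ≤ x ^ 8 + 2 * (x ^ 4 * x ^ 8) := by
    unfold widthSum
    rw [Nat.div_one, ← hsqrt]
    have h3 : ∑ j ∈ Finset.Icc 1 N.sqrt.sqrt, width N (1 * j) ≤ x ^ 4 * √N := by
      refine (Finset.sum_le_card_nsmul _ _ (√N) fun j _ => width_le _ _).trans ?_
      rw [nsmul_eq_mul, Nat.card_Icc, Nat.add_sub_cancel]
      gcongr
      exact natSqrt_sqrt_le hx hxN
    have := width_le N 0
    linarith
  have h4 : x ^ 8 ≤ x ^ 12 := pow_le_pow_right₀ hx (by norm_num)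
  have h5 : x ^ 4 * x ^ 8 = x ^ 12 := by ring
  linarith

theorem le_total {t x : ℝ} (hx : 2 ≤ x) (hxN : x ^ 16 = ⌊t⌋₊) : x ^ 12 / 2 ≤ total t := by
  set N := ⌊t⌋₊ with hN
  have hN1 : 1 ≤ N := by
    have : (1 : ℝ) ≤ N := by rw [← hxN]; exact one_le_pow₀ (by linarith)
    exact_mod_cast this
  have hsqrt : √(N : ℝ) = x ^ 8 := by
    rw [← hxN, show (16 : ℕ) = 8 * 2 from rfl, pow_mul, Real.sqrt_sq (by positivity)]
  have h1 := (abs_le.mp (abs_total_sub_le (t := t) hN1)).1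
  rw [← hN, hsqrt] at h1
  -- For `c ≤ x⁴ / 2` at most a sixteenth of `N` is used up, so the radius is at least `x⁸ / 2`. The
  -- loss of `8 x⁸` in all is absorbed since `x⁴ ≥ 16`.
  set J := ⌊x ^ 4 / 2⌋₊ with hJ
  have hJle : (J : ℝ) ≤ x ^ 4 / 2 := Nat.floor_le (by positivity)
  have hJge : x ^ 4 / 2 - 1 ≤ J := (Nat.sub_one_lt_floor _).le
  have hJ4 : (J : ℝ) ^ 4 ≤ N / 16 := by
    calc (J : ℝ) ^ 4 ≤ (x ^ 4 / 2) ^ 4 := by gcongr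
      _ = (N : ℝ) / 16 := by rw [← hxN]; ring
  have hJJ : J ≤ N.sqrt.sqrt := by
    rw [Nat.le_sqrt', Nat.le_sqrt', ← pow_mul]
    have : (J : ℝ) ^ 4 ≤ N := hJ4.trans (by
      have : (0 : ℝ) ≤ N := by positivity
      linarith)
    exact_mod_cast this
  have hw : ∀ j ∈ Finset.Icc 1 J, x ^ 8 / 2 ≤ width N (1 * j) := by
    intro j hj
    have hj' : (j : ℝ) ≤ J := by exact_mod_cast (Finset.mem_Icc.mp hj).2
    unfold width
    refine Real.le_sqrt_of_sq_le ?_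
    have h5 : ((1 * j : ℕ) : ℝ) ^ 4 ≤ N / 16 := by
      rw [one_mul]
      exact (pow_le_pow_left₀ (by positivity) hj' 4).trans hJ4
    have h6 : (x ^ 8 / 2) ^ 2 = N / 4 := by rw [← hxN]; ring
    have : (0 : ℝ) ≤ N := by positivity
    rw [h6]; linarith
  have h2 : 2 * (J * (x ^ 8 / 2)) ≤ widthSum N 1 := by
    unfold widthSum
    rw [Nat.div_one]
    have h3 : (J : ℝ) * (x ^ 8 / 2) ≤ ∑ j ∈ Finset.Icc 1 N.sqrt.sqrt, width N (1 * j) := by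
      refine le_trans ?_ (Finset.sum_le_sum_of_subset_of_nonneg
        (Finset.Icc_subset_Icc_right hJJ) fun j _ _ => width_nonneg _ _)
      have := Finset.card_nsmul_le_sum _ _ _ hw
      rwa [nsmul_eq_mul, Nat.card_Icc, Nat.add_sub_cancel] at this
    have := width_nonneg N 0
    linarith
  have h7 : (16 : ℝ) ≤ x ^ 4 := by
    calc (16 : ℝ) = 2 ^ 4 := by norm_num
      _ ≤ x ^ 4 := by gcongr
  have h8 : 0 < x ^ 8 := by positivity
  have h9 : x ^ 12 = x ^ 4 * x ^ 8 := by ring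
  rw [h9]
  nlinarith

theorem sum_totalDvd_le {M D : ℕ} {t : ℝ}
    (hM : ∀ n : ℕ, 0 < n → n ≤ ⌊t⌋₊ → n.divisors.card ≤ M) :
    ∑ d ∈ Finset.Icc 1 D, totalDvd d t ≤ M * total t := by
  unfold totalDvd total
  simp only [Finset.sum_filter]
  rw [Finset.sum_comm, Finset.mul_sum]
  refine Finset.sum_le_sum fun n hn => ?_
  obtain ⟨hn1, hn2⟩ := Finset.mem_Icc.mp hn
  rw [← Finset.sum_filter, Finset.sum_const, nsmul_eq_mul]
  gcongr
  refine le_trans (Finset.card_le_card fun d hd => ?_) (hM n hn1 hn2)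
  exact Nat.mem_divisors.mpr ⟨(Finset.mem_filter.mp hd).2, by omega⟩

/-- Both halves of `r_d` are bounded separately, after exchanging the sums over `d` and `n` in the
first. This covers `D > N^{3/4}`, where the choice of `K` is not available. -/
theorem remainderSum_le_trivial {M D : ℕ} {t : ℝ}
    (hM : ∀ n : ℕ, 0 < n → n ≤ ⌊t⌋₊ → n.divisors.card ≤ M) :
    remainderSum D t
      ≤ (M + ∑ d ∈ Finset.Icc 1 D, (d.divisors.card : ℝ) / d) * total t := by
  classical
  have ht := total_nonneg t
  have hd0 : ∀ d, 0 ≤ totalDvd d t := fun d => Finset.sum_nonneg fun _ _ => by positivity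
  unfold remainderSum
  rw [Nat.floor_natCast]
  calc ∑ d ∈ Finset.Icc 1 D with Cubefree d, |remainder d t|
      ≤ ∑ d ∈ Finset.Icc 1 D with Cubefree d,
          (totalDvd d t + (d.divisors.card : ℝ) / d * total t) := by
        refine Finset.sum_le_sum fun d hd => ?_
        obtain ⟨hd1, hd2⟩ := Finset.mem_filter.mp hd
        unfold remainder
        refine (abs_sub _ _).trans ?_
        rw [abs_of_nonneg (hd0 d), abs_mul, abs_of_nonneg ht]
        gcongr
        exact abs_density_le (Finset.mem_Icc.mp hd1).1 hd2
    _ ≤ ∑ d ∈ Finset.Icc 1 D, (totalDvd d t + (d.divisors.card : ℝ) / d * total t) := by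
        refine Finset.sum_le_sum_of_subset_of_nonneg (Finset.filter_subset _ _) fun d _ _ => ?_
        have := hd0 d
        positivity
    _ ≤ _ := by
        rw [Finset.sum_add_distrib, ← Finset.sum_mul, add_mul]
        have := sum_totalDvd_le (D := D) hM
        linarith

theorem exists_sum_card_divisors_div_le {δ : ℝ} (hδ : 0 < δ) : ∃ C : ℝ, 0 < C ∧ ∀ D : ℕ, 1 ≤ D →
    ∑ d ∈ Finset.Icc 1 D, (d.divisors.card : ℝ) / d ≤ C * (D : ℝ) ^ δ := by
  obtain ⟨C, hC, hdiv⟩ := exists_card_divisors_le (half_pos hδ)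
  refine ⟨C * (1 + 1 / (δ / 2)), by positivity, fun D hD => ?_⟩
  have hD1 : (1 : ℝ) ≤ D := by exact_mod_cast hD
  have hpow1 : (1 : ℝ) ≤ (D : ℝ) ^ (δ / 2) := Real.one_le_rpow hD1 (by positivity)
  have hharm : ∑ d ∈ Finset.Icc 1 D, 1 / (d : ℝ) ≤ (1 + 1 / (δ / 2)) * (D : ℝ) ^ (δ / 2) := by
    have h1 : ∑ k ∈ Finset.Icc 1 D, 1 / (k : ℝ) = (harmonic D : ℝ) := by
      rw [harmonic_eq_sum_Icc]; push_cast; simp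
    have h2 := harmonic_le_one_add_log D
    have h3 := Real.log_le_rpow_div (show (0 : ℝ) ≤ D by linarith) (half_pos hδ)
    rw [h1, add_mul]
    have : (D : ℝ) ^ (δ / 2) / (δ / 2) = 1 / (δ / 2) * (D : ℝ) ^ (δ / 2) := by ring
    linarith
  calc ∑ d ∈ Finset.Icc 1 D, (d.divisors.card : ℝ) / d
      ≤ ∑ d ∈ Finset.Icc 1 D, C * (D : ℝ) ^ (δ / 2) * (1 / d) := by
        refine Finset.sum_le_sum fun d hd => ?_
        obtain ⟨h1, h2⟩ := Finset.mem_Icc.mp hd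
        rw [mul_one_div]
        have : (d : ℝ) ≤ D := by exact_mod_cast h2
        gcongr
        refine (hdiv d h1).trans ?_
        gcongr
    _ = C * (D : ℝ) ^ (δ / 2) * ∑ d ∈ Finset.Icc 1 D, 1 / (d : ℝ) := by rw [Finset.mul_sum]
    _ ≤ C * (D : ℝ) ^ (δ / 2) * ((1 + 1 / (δ / 2)) * (D : ℝ) ^ (δ / 2)) := by gcongr
    _ = C * (1 + 1 / (δ / 2)) * ((D : ℝ) ^ (δ / 2) * (D : ℝ) ^ (δ / 2)) := by ring
    _ = _ := by rw [← Real.rpow_add (by linarith)]; congr 2; ring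


/-! ### The level of distribution -/

/-- A natural number bounding all divisor functions up to `(2 * N) ^ 20`, whose eighth power is
`O(N ^ ε)`. -/
theorem exists_divisor_majorant {ε : ℝ} (hε : 0 < ε) : ∃ C : ℝ, 1 ≤ C ∧ ∀ N : ℕ, 1 ≤ N →
    ∃ M : ℕ, 1 ≤ M ∧ (M : ℝ) ^ 8 ≤ C * (N : ℝ) ^ ε ∧
      ∀ n : ℕ, 0 < n → n ≤ (2 * N) ^ 20 → n.divisors.card ≤ M := by
  -- The exponent `160 = 20 * 8` accounts for the range `(2 * N) ^ 20` and the eighth power.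
  have hε' : 0 < ε / 160 := by positivity
  obtain ⟨K, hK, hdiv⟩ := exists_card_divisors_le hε'
  refine ⟨K ^ 8 * 2 ^ ε, ?_, fun N hN => ?_⟩
  · exact one_le_mul_of_one_le_of_one_le (one_le_pow₀ hK)
      (Real.one_le_rpow (by norm_num) hε.le)
  have hN1 : (1 : ℝ) ≤ N := by exact_mod_cast hN
  set b : ℝ := K * (((2 * N) ^ 20 : ℕ) : ℝ) ^ (ε / 160) with hb
  have hb0 : 0 ≤ b := by positivity
  have hM : ∀ n : ℕ, 0 < n → n ≤ (2 * N) ^ 20 → n.divisors.card ≤ ⌊b⌋₊ := by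
    intro n hn hn'
    refine Nat.le_floor ((hdiv n hn).trans ?_)
    have : (n : ℝ) ≤ (((2 * N) ^ 20 : ℕ) : ℝ) := by exact_mod_cast hn'
    rw [hb]; gcongr
  refine ⟨⌊b⌋₊, ?_, ?_, hM⟩
  · simpa using hM 1 one_pos (Nat.one_le_pow _ _ (by omega))
  · calc (⌊b⌋₊ : ℝ) ^ 8 ≤ b ^ 8 := by gcongr; exact Nat.floor_le hb0
      _ = K ^ 8 * ((2 * N : ℝ) ^ ε) := by
          rw [hb, mul_pow]
          congr 1
          push_cast
          rw [← Real.rpow_natCast, ← Real.rpow_natCast, ← Real.rpow_mul (by positivity),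
            ← Real.rpow_mul (by positivity)]
          congr 1
          push_cast; ring
      _ = _ := by rw [Real.mul_rpow (by norm_num) (by positivity)]; ring

theorem remainderSum_eq_zero {D t : ℝ} (ht : ⌊t⌋₊ = 0) : remainderSum D t = 0 := by
  classical
  refine Finset.sum_eq_zero fun d _ => ?_
  simp [remainder, totalDvd, total, ht]

theorem remainderSum_floor (D t : ℝ) : remainderSum (⌊D⌋₊ : ℝ) t = remainderSum D t := by
  unfold remainderSum
  rw [Nat.floor_natCast]

theorem remainderSum_le_rpow {ε : ℝ} (hε : 0 < ε) : ∃ C : ℝ, 0 < C ∧ ∀ (D : ℕ) (t : ℝ), 1 ≤ D →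
    1 ≤ ⌊t⌋₊ → remainderSum D t
      ≤ C * ((D : ℝ) ^ (1 / 4 : ℝ) * (⌊t⌋₊ : ℝ) ^ (9 / 16 + ε : ℝ)) := by
  obtain ⟨C₁, hC₁, hmain⟩ := remainderSum_le
  obtain ⟨C₂, hC₂, hmaj⟩ := exists_divisor_majorant hε
  -- In the range `y > x ^ 3` write `D = x ^ 12 * w ^ 4` with `w ≥ 1`. Then `δ ≤ 1 / 4` gives `(w ^
  -- 4) ^ δ ≤ w`, and `δ ≤ ε` gives `(x ^ 12) ^ δ ≤ N ^ ε`.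
  set δ : ℝ := min (1 / 4) ε with hδ
  have hδ0 : 0 < δ := lt_min (by norm_num) hε
  have hδ1 : δ ≤ 1 / 4 := min_le_left _ _
  have hδ2 : δ ≤ ε := min_le_right _ _
  obtain ⟨C₃, hC₃, hdiv⟩ := exists_sum_card_divisors_div_le hδ0
  refine ⟨C₁ * C₂ + (C₂ + C₃) * 12, by positivity, fun D t hD ht => ?_⟩
  set N := ⌊t⌋₊ with hN
  have hN1 : (1 : ℝ) ≤ N := by exact_mod_cast ht
  have hD1 : (1 : ℝ) ≤ D := by exact_mod_cast hD
  set x : ℝ := (N : ℝ) ^ (1 / 16 : ℝ) with hx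
  set y : ℝ := (D : ℝ) ^ (1 / 4 : ℝ) with hy
  have hx1 : 1 ≤ x := Real.one_le_rpow hN1 (by norm_num)
  have hy1 : 1 ≤ y := Real.one_le_rpow hD1 (by norm_num)
  have hxN : x ^ 16 = N := by
    rw [hx, ← Real.rpow_natCast, ← Real.rpow_mul (by positivity)]; norm_num
  have hyD : y ^ 4 = D := by
    rw [hy, ← Real.rpow_natCast, ← Real.rpow_mul (by positivity)]; norm_num
  obtain ⟨M, hM1, hM8, hMdiv⟩ := hmaj N ht
  have hMr : (1 : ℝ) ≤ M := by exact_mod_cast hM1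
  set E : ℝ := (N : ℝ) ^ ε with hE
  have hE1 : 1 ≤ E := Real.one_le_rpow hN1 hε.le
  have hpow : (N : ℝ) ^ (9 / 16 + ε : ℝ) = x ^ 9 * E := by
    rw [Real.rpow_add (by linarith), hx, ← Real.rpow_natCast, ← Real.rpow_mul (by positivity)]
    norm_num
    exact Or.inl hE.symm
  rw [hpow]
  have hP : 0 ≤ y * (x ^ 9 * E) := by positivity
  rcases le_or_gt y (x ^ 3) with hle | hgt
  · calc remainderSum D t ≤ C₁ * ((M : ℝ) ^ 8 * (y * x ^ 9)) :=
          hmain M D t x y hx1 hy1 hxN hyD hle hMdiv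
      _ ≤ C₁ * (C₂ * E * (y * x ^ 9)) := by gcongr
      _ = C₁ * C₂ * (y * (x ^ 9 * E)) := by ring
      _ ≤ _ := by
          gcongr
          have : 0 ≤ (C₂ + C₃) * 12 := by positivity
          linarith
  · have htriv := remainderSum_le_trivial (D := D) (t := t) (M := M) fun n hn hn' =>
      hMdiv n hn (hn'.trans (by
        calc N ≤ 2 * N := by omega
          _ ≤ (2 * N) ^ 20 := Nat.le_self_pow (by norm_num) _))
    have hMle : (M : ℝ) ≤ C₂ * E := by
      calc (M : ℝ) = (M : ℝ) ^ 1 := (pow_one _).symm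
        _ ≤ (M : ℝ) ^ 8 := pow_le_pow_right₀ hMr (by norm_num)
        _ ≤ _ := hM8
    have hDδ : (D : ℝ) ^ δ * x ^ 3 ≤ y * E := by
      set w : ℝ := y / x ^ 3 with hw
      have hw1 : 1 ≤ w := by rw [hw, le_div_iff₀ (by positivity)]; linarith
      have hyw : y = x ^ 3 * w := by rw [hw]; field_simp
      have hDw : (D : ℝ) ^ δ = (x ^ 12) ^ δ * (w ^ 4) ^ δ := by
        rw [← hyD, hyw, ← Real.mul_rpow (by positivity) (by positivity)]
        congr 1; ring
      have hw4 : (w ^ 4) ^ δ ≤ w := by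
        calc (w ^ 4) ^ δ ≤ (w ^ 4) ^ (1 / 4 : ℝ) :=
              Real.rpow_le_rpow_of_exponent_le (one_le_pow₀ hw1) hδ1
          _ = w := by
              rw [← Real.rpow_natCast, ← Real.rpow_mul (by positivity)]; norm_num
      have hx12 : (x ^ 12) ^ δ ≤ E := by
        calc (x ^ 12) ^ δ ≤ (x ^ 16) ^ δ := by gcongr; norm_num
          _ = (N : ℝ) ^ δ := by rw [hxN]
          _ ≤ E := Real.rpow_le_rpow_of_exponent_le hN1 hδ2
      calc (D : ℝ) ^ δ * x ^ 3 = (x ^ 12) ^ δ * (w ^ 4) ^ δ * x ^ 3 := by rw [hDw]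
        _ ≤ E * w * x ^ 3 := by gcongr
        _ = y * E := by rw [hyw]; ring
    calc remainderSum D t ≤ (M + ∑ d ∈ Finset.Icc 1 D, (d.divisors.card : ℝ) / d) * total t :=
          htriv
      _ ≤ (C₂ * E + C₃ * (D : ℝ) ^ δ) * (12 * x ^ 12) := by
          have := total_nonneg t
          gcongr
          · exact hdiv D hD
          · exact total_le hx1 hxN
      _ = (C₂ * (E * x ^ 3) + C₃ * ((D : ℝ) ^ δ * x ^ 3)) * (12 * x ^ 9) := by ring
      _ ≤ (C₂ * (E * y) + C₃ * (y * E)) * (12 * x ^ 9) := by gcongr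
      _ = (C₂ + C₃) * 12 * (y * (x ^ 9 * E)) := by ring
      _ ≤ _ := by
          gcongr
          have : 0 ≤ C₁ * C₂ := by positivity
          linarith

theorem exists_remainderSum_le {ε : ℝ} (hε : 0 < ε) : ∃ C : ℝ, 0 < C ∧ ∀ x D t : ℝ, 1 ≤ x →
    1 ≤ D → t ≤ x → remainderSum D t ≤ C * (D ^ (1 / 4 : ℝ) * x ^ (9 / 16 + ε : ℝ)) := by
  obtain ⟨C, hC, h⟩ := remainderSum_le_rpow hε
  refine ⟨C, hC, fun x D t hx hD htx => ?_⟩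
  rcases Nat.eq_zero_or_pos ⌊t⌋₊ with h0 | h0
  · rw [remainderSum_eq_zero h0]; positivity
  have hfD : (⌊D⌋₊ : ℝ) ≤ D := Nat.floor_le (by linarith)
  have hft : (⌊t⌋₊ : ℝ) ≤ x := (Nat.floor_le (Nat.pos_of_floor_pos h0).le).trans htx
  rw [← remainderSum_floor]
  refine (h ⌊D⌋₊ t (Nat.floor_pos.mpr hD) h0).trans ?_
  gcongr

theorem rpow_le_total {x : ℝ} (hx : (2 : ℝ) ^ 17 ≤ x) : x ^ (3 / 4 : ℝ) / 4 ≤ total x := by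
  have hx0 : (0 : ℝ) < x := lt_of_lt_of_le (by norm_num) hx
  set N := ⌊x⌋₊ with hN
  have hNx : x / 2 ≤ N := by
    have := (Nat.sub_one_lt_floor x).le
    have : (2 : ℝ) ≤ x := le_trans (by norm_num) hx
    linarith
  set z : ℝ := (N : ℝ) ^ (1 / 16 : ℝ) with hz
  have hzN : z ^ 16 = N := by
    rw [hz, ← Real.rpow_natCast, ← Real.rpow_mul (by positivity)]; norm_num
  have hz2 : 2 ≤ z := by
    -- From `x ≥ 2 ^ 17` comes `N ≥ x / 2 ≥ 2 ^ 16`, hence `z ≥ 2`.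
    refine le_of_pow_le_pow_left₀ (n := 16) (by norm_num) (by positivity) ?_
    rw [hzN]
    linarith
  refine le_trans ?_ (le_total hz2 hzN)
  have h12 : (x / 2) ^ (3 / 4 : ℝ) ≤ z ^ 12 := by
    have : z ^ 12 = (N : ℝ) ^ (3 / 4 : ℝ) := by
      rw [hz, ← Real.rpow_natCast, ← Real.rpow_mul (by positivity)]; norm_num
    rw [this]; gcongr
  have h2 : x ^ (3 / 4 : ℝ) = 2 ^ (3 / 4 : ℝ) * (x / 2) ^ (3 / 4 : ℝ) := by
    rw [← Real.mul_rpow (by norm_num) (by positivity)]; congr 1; ring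
  have h3 : (2 : ℝ) ^ (3 / 4 : ℝ) ≤ 2 := by
    calc (2 : ℝ) ^ (3 / 4 : ℝ) ≤ 2 ^ (1 : ℝ) :=
          Real.rpow_le_rpow_of_exponent_le (by norm_num) (by norm_num)
      _ = 2 := Real.rpow_one 2
  have h4 : 0 ≤ (x / 2) ^ (3 / 4 : ℝ) := by positivity
  nlinarith

/-- Part (i) with `ε / 8` has exponent `(3/4 - ε) / 4 + 9/16 + ε/8 = 3/4 - ε/8`. The spare `x^{ε/8}`
dominates `(log x)^{5B/4}`, which combines the `B / 4` coming from `D^{1/4}` with the `B` to be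
saved. -/
theorem exists_level_of_distribution {ε : ℝ} (hε : 0 < ε) (B : ℝ) :
    ∃ x₀ : ℝ, 2 ≤ x₀ ∧ ∀ x t : ℝ, x₀ ≤ x → t ≤ x →
      remainderSum (x ^ (3 / 4 - ε : ℝ) * Real.log x ^ B) t ≤ total x * Real.log x ^ (-B) := by
  obtain ⟨C, hC, hbound⟩ := exists_remainderSum_le (ε := ε / 8) (by positivity)
  have hlittle := (isLittleO_log_rpow_rpow_atTop (5 * B / 4) (show 0 < ε / 8 by positivity)).bound
    (show (0 : ℝ) < 1 / (4 * C) by positivity)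
  obtain ⟨x₁, hx₁⟩ := Filter.eventually_atTop.mp hlittle
  refine ⟨max x₁ (2 ^ 17), (by norm_num : (2 : ℝ) ≤ 2 ^ 17).trans (le_max_right _ _),
    fun x t hx htx => ?_⟩
  have hx17 : (2 : ℝ) ^ 17 ≤ x := (le_max_right _ _).trans hx
  have hx1 : 1 < x := lt_of_lt_of_le (by norm_num) hx17
  have hlog : 0 < Real.log x := Real.log_pos hx1
  set ℓ := Real.log x with hℓ
  -- For large `ε` the level can fall below `1`, outside the range of part (i); the sum is then
  -- empty.
  rcases lt_or_ge (x ^ (3 / 4 - ε : ℝ) * ℓ ^ B) 1 with hD | hD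
  · have : remainderSum (x ^ (3 / 4 - ε : ℝ) * ℓ ^ B) t = 0 := by
      unfold remainderSum
      rw [Nat.floor_eq_zero.mpr hD]
      simp
    rw [this]
    have := total_nonneg x
    positivity
  have hl := hx₁ x ((le_max_left _ _).trans hx)
  rw [Real.norm_of_nonneg (by positivity), Real.norm_of_nonneg (by positivity), ← hℓ,
    div_mul_eq_mul_div, one_mul, le_div_iff₀ (by positivity)] at hl
  have e1 : (x ^ (3 / 4 - ε : ℝ) * ℓ ^ B) ^ (1 / 4 : ℝ) * x ^ (9 / 16 + ε / 8 : ℝ)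
      = x ^ (3 / 4 - ε / 8 : ℝ) * ℓ ^ (B / 4) := by
    rw [Real.mul_rpow (by positivity) (by positivity), ← Real.rpow_mul (by positivity),
      ← Real.rpow_mul (by positivity), mul_right_comm, ← Real.rpow_add (by positivity)]
    congr 2 <;> ring
  have e2 : ℓ ^ (B / 4) = ℓ ^ (5 * B / 4) * ℓ ^ (-B) := by
    rw [← Real.rpow_add hlog]; congr 1; ring
  have e3 : x ^ (3 / 4 : ℝ) = x ^ (3 / 4 - ε / 8 : ℝ) * x ^ (ε / 8) := by
    rw [← Real.rpow_add (by positivity)]; congr 1; ring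
  calc remainderSum (x ^ (3 / 4 - ε : ℝ) * ℓ ^ B) t
      ≤ C * ((x ^ (3 / 4 - ε : ℝ) * ℓ ^ B) ^ (1 / 4 : ℝ) * x ^ (9 / 16 + ε / 8 : ℝ)) :=
        hbound x _ t hx1.le hD htx
    _ = x ^ (3 / 4 - ε / 8 : ℝ) * (ℓ ^ (5 * B / 4) * (4 * C)) / 4 * ℓ ^ (-B) := by
        rw [e1, e2]; ring
    _ ≤ x ^ (3 / 4 - ε / 8 : ℝ) * x ^ (ε / 8) / 4 * ℓ ^ (-B) := by gcongr
    _ = x ^ (3 / 4 : ℝ) / 4 * ℓ ^ (-B) := by rw [← e3]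
    _ ≤ _ := by
        gcongr
        exact rpow_le_total hx17

end QuarticSieve

theorem proposition3p5 :
    (∀ ε : ℝ, 0 < ε → ∃ C : ℝ, 0 < C ∧
      ∀ x D t : ℝ, 1 ≤ x → 1 ≤ D → t ≤ x →
        QuarticSieve.remainderSum D t
          ≤ C * (D ^ (1 / 4 : ℝ) * x ^ (9 / 16 + ε : ℝ))) ∧
    (∀ ε : ℝ, 0 < ε → ∀ B : ℝ, 0 < B → ∃ x₀ : ℝ, 2 ≤ x₀ ∧
      ∀ x t : ℝ, x₀ ≤ x → t ≤ x →
        QuarticSieve.remainderSum (x ^ (3 / 4 - ε : ℝ) * Real.log x ^ B) t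
          ≤ QuarticSieve.total x * Real.log x ^ (-B)) := by
  exact ⟨fun ε hε => QuarticSieve.exists_remainderSum_le hε,
    fun ε hε B _ => QuarticSieve.exists_level_of_distribution hε B⟩
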